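/- Let $0<q<1$, $n\ge 0$. Let $\hat V^{\rm ext}$ be the algebra of complex formal power series in $x_1,\dots,x_n$ with $x_ix_j=q\,x_jx_i$ for $i>j$ (basis of ordered monomials $x^E=x_1^{e_1}\cdots x_n^{e_n}$), and $V^{\rm ext}$ the algebra of complex formal power series in $\partial_1,\dots,\partial_n$ with $\partial_i\partial_j=q\,\partial_j\partial_i$ for $i<j$ (basis $\partial^E=\partial_n^{e_n}\cdots\partial_1^{e_1}$). Each series is realized as the commutative power series in $z_1,\dots,z_n$ with the same coefficients with respect to these bases. Put $(a;p)_k=\prod_{l<k}(1-ap^l)$, $e_p(t)=\sum_k\frac{t^k}{(p;p)_k}$, $E_p(t)=\sum_k\frac{p^{k(k-1)/2}t^k}{(p;p)_k}$, $G_{q^2}(q^2\underline x)=E_{q^4}(-q^4\sum_jx_j^2)$, $g_{q^2}(\underline\partial)=e_{q^4}(-\sum_j\partial_j^2)$. *Lattice order integral.* For a permutation $\sigma$ of $\{1,\dots,n\}$ and $\gamma\in\mathbb R_{>0}^n$, integrate successively with respect to $x_{\sigma(1)},\dots,x_{\sigma(n)}$. In the step for $x_l$, the current series $f$ is replaced by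 its part $\Pi_0f$ that is even in every variable; the expression $$(1-q^2)\sum_{k\in\mathbb Z}\sum_{\varepsilon=\pm1}q^{2k}x_l\,(\Pi_0f)(q^{-2}x_1,\dots,q^{-2}x_{l-1},\varepsilon q^{2k}x_l,x_{l+1},\dots,x_n)$$ is realized on commuting variables and evaluated at $z_l=\gamma_l$. It is required that all the inner power series converge absolutely everywhere and that the outer sum converges absolutely to an entire function of the remaining variables; the series realized by this function is the result of the step. If this is possible in all steps and the realization of the original $f$ converges near $0$, then $f$ is l.o. integrable for $(\sigma,\gamma)$, and the final constant is $I''_{(\sigma,\gamma)}(f)$. The class $\mathcal R_{(\sigma,\gamma)}$ consists of the $f$ such that $f\,x^E$ is l.o. integrable for $(\sigma,\gamma)$ for every $E$. *Right integral.* $g\in V^{\rm ext}$ is integrable if its realization has an analytic continuation to $\mathbb R^n+iU$ for an open neighbourhood $U$ of $0$ in $\mathbb R^n$ (whose restriction to $\mathbb R^n$ is denoted ${}_{1\cdot}g$), and if for every $a\in(\mathbb R\setminus\{0\})^n$ the Jackson integral $$\int_{-a_1\infty}^{a_1\infty}\!\!\cdots\int_{-a_n\infty}^{a_n\infty}{}_{1\cdot}g\,d_{q^2}\underline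 t=(1-q^2)^n\sum_{K\in\mathbb Z^n}\sum_{\varepsilon\in\{\pm1\}^n}\Bigl(\prod_jq^{2k_j}a_j\Bigr)\,{}_{1\cdot}g(\varepsilon_1q^{2k_1}a_1,\dots,\varepsilon_nq^{2k_n}a_n)$$ converges absolutely. The expression $g\leftharpoonup\int_{-b_1\partial_1\infty}^{b_1\partial_1\infty}\cdots\int_{-b_n\partial_n\infty}^{b_n\partial_n\infty}$ is realized as the function of $z\in(\mathbb R\setminus\{0\})^n$ given by this integral with $a_j=q^{n-j}b_jz_j$, and expressions of this type are identified with these functions of $z$. $g\leftharpoonup J'$ is the integral, with all $b_j=1$, of the part of $g$ that is even in every variable. The class $\mathcal S$ consists of the $g$ such that for every $E$ the even part of $\partial^E g$ is integrable. *Transforms.* With $\exp(x|\,c_1\partial_1,\dots,c_n\partial_n)=\sum_E x^E\otimes\prod_j\frac{c_j^{e_j}}{[e_j]_{q^2}!}\,\partial^E$, where $[m]_p!=\prod_{j=1}^m\frac{p^j-1}{p-1}$, and with the antipode $S(x^E)=(-1)^{|E|}q^{|E|^2-|E|}x^E$, $$F''(\sigma,\gamma)(f)=(I''_{(\sigma,\gamma)}\otimes{\rm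 id})\Bigl((f\otimes1)\,\exp\bigl(x|\tfrac{i}{1-q^2}(q^{1-j}\partial_j)_j\bigr)\Bigr)\in V^{\rm ext}\qquad(f\in\mathcal R_{(\sigma,\gamma)}),$$ $$G_S(g)=(S\otimes J')\Bigl(\exp\bigl(x|\tfrac{iq^2}{1-q^2}(q^{n-j}\partial_j)_j\bigr)(1\otimes g)\Bigr)\qquad(g\in\mathcal S),$$ the products being taken in the first, respectively second, tensor factor; $G_S(g)$ is a power series in the $x_j$ whose coefficients are realized as functions of $z$. **Proposition.** Let $\beta\in\{\pm1\}^n$, let $b_j=0$ if $\beta_j=1$ and $b_j=1$ if $\beta_j=-1$, and put $B(\beta)_k=\sum_{j<k}b_j$, $B(\beta)^k=\sum_{j>k}b_j$. Let $\sigma$ be a permutation of $\{1,\dots,n\}$ and $$\gamma_{\sigma(k)}=q^{B(\beta)^{\sigma(k)}+k-1+\#\{j<k\,|\,\sigma(j)>\sigma(k)\}},\qquad\tilde\gamma_k=\gamma_kq^{B(\beta)^k}\qquad(1\le k\le n).$$ Then $G_{q^2}(q^2\underline x)$ is l.o. integrable for $(\sigma,\tilde\gamma)$, $g_{q^2}(\underline\partial)$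 is integrable, and with $$\Lambda=I''_{(\sigma,\tilde\gamma)}\bigl(G_{q^2}(q^2\underline x)\bigr)\cdot\Bigl(g_{q^2}(\underline\partial)\leftharpoonup\int_{-q^{B(\beta)_1}\partial_1\infty}^{q^{B(\beta)_1}\partial_1\infty}\cdots\int_{-q^{B(\beta)_n}\partial_n\infty}^{q^{B(\beta)_n}\partial_n\infty}\Bigr)$$ the following hold. 1. For all complex polynomials $p_1,\dots,p_n$ with $p_j(-t)=\beta_jp_j(t)$, the series $f=E_{q^4}(-q^4x_n^2)p_n(x_n)\cdots E_{q^4}(-q^4x_1^2)p_1(x_1)$ lies in $\mathcal R_{(\sigma,\gamma)}$, $F''(\sigma,\gamma)(f)\in\mathcal S$, and $G_S\bigl(F''(\sigma,\gamma)(f)\bigr)=f\otimes\Lambda$. 2. For all complex polynomials $r_1,\dots,r_n$ with $r_j(-t)=\beta_jr_j(t)$, the series $g=r_n(\partial_n)e_{q^4}(-\partial_n^2)\cdots r_1(\partial_1)e_{q^4}(-\partial_1^2)$ lies in $\mathcal S$; for every $z\in(\mathbb R\setminus\{0\})^n$ the series in the $x_j$ given by $G_S(g)$ at $z$ lies in $\mathcal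 R_{(\sigma,\gamma)}$, and $(F''(\sigma,\gamma)\otimes{\rm id})\,G_S(g)=g\otimes\Lambda$. -/

import Mathlib

open Filter Topology

noncomputable section

namespace QSpace

/-! ### Quantum spaces of formal power series -/

/-- Exponent of `q` produced when two ordered monomials with exponents `E`, `F` are multiplied:
moving a generator with index `i` to the right past a generator with index `j` costs `q ^ w i j`. -/
def twist {n : ℕ} (w : Fin n → Fin n → ℕ) (E F : Fin n →₀ ℕ) : ℕ :=
  ∑ i, ∑ j, w i j * (E i * F j)

/-- Formal power series over `ℂ` in `n` `q`-commuting generators, given by their coefficients with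
respect to the basis of ordered monomials; the product of the ordered monomials with exponents
`E` and `F` is `q ^ twist w E F` times the ordered monomial with exponent `E + F`. -/
def QSeries (n : ℕ) (_q : ℝ) (_w : Fin n → Fin n → ℕ) : Type := (Fin n →₀ ℕ) → ℂ

section ring

variable {n : ℕ} {q : ℝ} {w : Fin n → Fin n → ℕ}

instance : AddCommGroup (QSeries n q w) := inferInstanceAs (AddCommGroup ((Fin n →₀ ℕ) → ℂ))

instance : Module ℂ (QSeries n q w) := inferInstanceAs (Module ℂ ((Fin n →₀ ℕ) → ℂ))

instance : Mul (QSeries n q w) :=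
  ⟨fun c d G => ∑ p ∈ Finset.HasAntidiagonal.antidiagonal G, (q : ℂ) ^ twist w p.1 p.2 * (c p.1 * d p.2)⟩

/-- The ordered monomial with exponent `E`. -/
def mono (E : Fin n →₀ ℕ) : QSeries n q w := fun F => if F = E then 1 else 0

instance : One (QSeries n q w) := ⟨mono 0⟩

/-- The `i`-th generator. -/
def gen (i : Fin n) : QSeries n q w := mono (Finsupp.single i 1)

theorem mul_apply (c d : QSeries n q w) (G : Fin n →₀ ℕ) :
    (c * d) G = ∑ p ∈ Finset.HasAntidiagonal.antidiagonal G, (q : ℂ) ^ twist w p.1 p.2 * (c p.1 * d p.2) := rfl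

theorem one_apply (G : Fin n →₀ ℕ) : (1 : QSeries n q w) G = if G = 0 then 1 else 0 := rfl

theorem add_apply (c d : QSeries n q w) (G : Fin n →₀ ℕ) : (c + d) G = c G + d G := rfl

theorem zero_apply (G : Fin n →₀ ℕ) : (0 : QSeries n q w) G = 0 := rfl

theorem smul_apply (a : ℂ) (c : QSeries n q w) (G : Fin n →₀ ℕ) : (a • c) G = a * c G := rfl

theorem twist_zero_left (F : Fin n →₀ ℕ) : twist w 0 F = 0 := by simp [twist]

theorem twist_zero_right (E : Fin n →₀ ℕ) : twist w E 0 = 0 := by simp [twist]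

theorem twist_add_left (E E' F : Fin n →₀ ℕ) :
    twist w (E + E') F = twist w E F + twist w E' F := by
  simp only [twist, Finsupp.add_apply, ← Finset.sum_add_distrib]
  exact Finset.sum_congr rfl fun i _ => Finset.sum_congr rfl fun j _ => by ring

theorem twist_add_right (E F F' : Fin n →₀ ℕ) :
    twist w E (F + F') = twist w E F + twist w E F' := by
  simp only [twist, Finsupp.add_apply, ← Finset.sum_add_distrib]
  exact Finset.sum_congr rfl fun i _ => Finset.sum_congr rfl fun j _ => by ring

theorem mono_mul_mono (E F : Fin n →₀ ℕ) :
    (mono E * mono F : QSeries n q w) = (q : ℂ) ^ twist w E F • mono (E + F) := by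
  funext G
  rw [mul_apply, smul_apply]
  by_cases h : G = E + F
  · subst h
    rw [Finset.sum_eq_single (E, F)]
    · simp [mono]
    · rintro ⟨a, b⟩ _ hab
      by_cases h1 : a = E
      · by_cases h2 : b = F
        · exact absurd (by rw [h1, h2]) hab
        · simp [mono, h2]
      · simp [mono, h1]
    · intro h
      simp at h
  · rw [Finset.sum_eq_zero]
    · simp [mono, h]
    · rintro ⟨a, b⟩ hab
      rw [Finset.HasAntidiagonal.mem_antidiagonal] at hab
      by_cases h1 : a = E
      · by_cases h2 : b = F
        · exact absurd (by rw [← hab, h1, h2]) h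
        · simp [mono, h2]
      · simp [mono, h1]

theorem one_mul' (c : QSeries n q w) : 1 * c = c := by
  funext G
  rw [mul_apply, Finset.sum_eq_single (0, G)]
  · simp [one_apply, twist_zero_left]
  · rintro ⟨a, b⟩ hab hne
    rw [Finset.HasAntidiagonal.mem_antidiagonal] at hab
    have : a ≠ 0 := by
      rintro rfl
      exact hne (by simpa using hab)
    simp [one_apply, this]
  · intro h
    simp at h

theorem mul_one' (c : QSeries n q w) : c * 1 = c := by
  funext G
  rw [mul_apply, Finset.sum_eq_single (G, 0)]
  · simp [one_apply, twist_zero_right]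
  · rintro ⟨a, b⟩ hab hne
    rw [Finset.HasAntidiagonal.mem_antidiagonal] at hab
    have : b ≠ 0 := by
      rintro rfl
      exact hne (by simpa using hab)
    simp [one_apply, this]
  · intro h
    simp at h

theorem mul_assoc' (a b c : QSeries n q w) : a * b * c = a * (b * c) := by
  funext G
  simp only [mul_apply, Finset.sum_mul, Finset.mul_sum, Finset.sum_sigma']
  refine Finset.sum_nbij' (fun ⟨⟨_i, j⟩, ⟨k, l⟩⟩ => ⟨(k, l + j), (l, j)⟩)
    (fun ⟨⟨i, _j⟩, ⟨k, l⟩⟩ => ⟨(i + k, l), (i, k)⟩) ?_ ?_ ?_ ?_ ?_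
  · rintro ⟨⟨i, j⟩, ⟨k, l⟩⟩ h
    simp only [Finset.mem_sigma, Finset.HasAntidiagonal.mem_antidiagonal] at h ⊢
    exact ⟨by rw [← h.1, ← h.2, add_assoc], trivial⟩
  · rintro ⟨⟨i, j⟩, ⟨k, l⟩⟩ h
    simp only [Finset.mem_sigma, Finset.HasAntidiagonal.mem_antidiagonal] at h ⊢
    exact ⟨by rw [← h.1, ← h.2, add_assoc], trivial⟩
  · rintro ⟨⟨i, j⟩, ⟨k, l⟩⟩ h
    simp only [Finset.mem_sigma, Finset.HasAntidiagonal.mem_antidiagonal] at h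
    obtain ⟨_, rfl⟩ := h
    rfl
  · rintro ⟨⟨i, j⟩, ⟨k, l⟩⟩ h
    simp only [Finset.mem_sigma, Finset.HasAntidiagonal.mem_antidiagonal] at h
    obtain ⟨_, rfl⟩ := h
    rfl
  · rintro ⟨⟨i, j⟩, ⟨k, l⟩⟩ h
    simp only [Finset.mem_sigma, Finset.HasAntidiagonal.mem_antidiagonal] at h
    obtain ⟨_, rfl⟩ := h
    simp only [twist_add_left, twist_add_right, pow_add]
    ring

instance : Ring (QSeries n q w) :=
  { (inferInstance : AddCommGroup (QSeries n q w)) with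
    mul := (· * ·)
    one := 1
    mul_assoc := mul_assoc'
    one_mul := one_mul'
    mul_one := mul_one'
    zero_mul := fun a => by
      funext G
      simp [mul_apply, zero_apply]
    mul_zero := fun a => by
      funext G
      simp [mul_apply, zero_apply]
    left_distrib := fun a b c => by
      funext G
      simp only [mul_apply, add_apply, mul_add, Finset.sum_add_distrib]
    right_distrib := fun a b c => by
      funext G
      simp only [mul_apply, add_apply, add_mul, mul_add, Finset.sum_add_distrib] }

instance : Algebra ℂ (QSeries n q w) :=
  Algebra.ofModule
    (fun r x y => by
      funext G
      simp only [mul_apply, smul_apply, Finset.mul_sum]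
      exact Finset.sum_congr rfl fun p _ => by ring)
    (fun r x y => by
      funext G
      simp only [mul_apply, smul_apply, Finset.mul_sum]
      exact Finset.sum_congr rfl fun p _ => by ring)

end ring

/-- The completed braided covector algebra: generators `x₁, …, xₙ` with `xᵢ xⱼ = q xⱼ xᵢ` for
`i > j`; the ordered monomials are `x₁ ^ e₁ ⋯ xₙ ^ eₙ`. -/
abbrev Cov (n : ℕ) (q : ℝ) : Type := QSeries n q (fun i j => if j < i then 1 else 0)

/-- The completed braided vector algebra: generators `∂₁, …, ∂ₙ` with `∂ᵢ ∂ⱼ = q ∂ⱼ ∂ᵢ` for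
`i < j`; the ordered monomials are `∂ₙ ^ eₙ ⋯ ∂₁ ^ e₁`. -/
abbrev Vec (n : ℕ) (q : ℝ) : Type := QSeries n q (fun i j => if i < j then 1 else 0)

theorem twist_single {n : ℕ} (w : Fin n → Fin n → ℕ) (i j : Fin n) :
    twist w (Finsupp.single i 1) (Finsupp.single j 1) = w i j := by
  unfold twist
  rw [Finset.sum_eq_single i, Finset.sum_eq_single j]
  · simp
  · intro b _ hb
    simp [hb.symm]
  · simp
  · intro b _ hb
    simp [hb.symm]
  · simp

theorem Cov.gen_mul_gen {n : ℕ} {q : ℝ} {i j : Fin n} (h : j < i) :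
    (gen i * gen j : Cov n q) = (q : ℂ) • (gen j * gen i) := by
  simp only [gen, mono_mul_mono, twist_single, h, h.not_gt, if_true, if_false, pow_one, pow_zero,
    one_smul, add_comm]

theorem Vec.gen_mul_gen {n : ℕ} {q : ℝ} {i j : Fin n} (h : i < j) :
    (gen i * gen j : Vec n q) = (q : ℂ) • (gen j * gen i) := by
  simp only [gen, mono_mul_mono, twist_single, h, h.not_gt, if_true, if_false, pow_one, pow_zero,
    one_smul, add_comm]

/-- Total degree `|E|`. -/
def deg {n : ℕ} (E : Fin n →₀ ℕ) : ℕ := ∑ j, E j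

/-- The value `∏ zⱼ ^ eⱼ` of a commutative monomial. -/
def monoVal {n : ℕ} (z : Fin n → ℂ) (E : Fin n →₀ ℕ) : ℂ := ∏ j, z j ^ E j

section operations

variable {n : ℕ} {q : ℝ} {w : Fin n → Fin n → ℕ}

/-- `f(a₁ x₁, …, aₙ xₙ)`. -/
def rescale (a : Fin n → ℂ) (f : QSeries n q w) : QSeries n q w := fun E => monoVal a E * f E

/-- The part of `f` that is even in every generator. -/
def evenPart (f : QSeries n q w) : QSeries n q w := fun E => if ∀ j, Even (E j) then f E else 0

/-- Substitution of an element `u` without constant term into the one-variable power series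
`∑ aₖ tᵏ`: the powers `u ^ k` with `k > |E|` do not contribute to the coefficient at `E`. -/
def subst (a : ℕ → ℂ) (u : QSeries n q w) : QSeries n q w :=
  fun E => ∑ k ∈ Finset.range (deg E + 1), a k * (u ^ k) E

/-- The value at `z` of `f ▷ 1` (respectively `1 ◁ f`), the commutative power series with the same
coefficients as `f` with respect to the ordered monomials. -/
def evalAt (f : QSeries n q w) (z : Fin n → ℂ) : ℂ := ∑' E, f E * monoVal z E

/-- The class of series `f` such that `f ▷ 1` converges absolutely in a neighbourhood of `0`. -/
def InC (f : QSeries n q w) : Prop := ∃ r : ℝ, 0 < r ∧ Summable fun E => ‖f E‖ * r ^ deg E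

/-- The braided antipode, `S(x^E) = (-1)^|E| q^(|E|² - |E|) x^E` on ordered monomials. -/
def antipode (f : QSeries n q w) : QSeries n q w :=
  fun E => (-1) ^ deg E * (q : ℂ) ^ (deg E * (deg E - 1)) * f E

end operations

/-! ### `q`-special functions -/

/-- `(a; p)ₖ`. -/
def qPoch (a p : ℂ) (k : ℕ) : ℂ := ∏ l ∈ Finset.range k, (1 - a * p ^ l)

/-- Coefficients of `e_p(t) = ∑ tᵏ / (p; p)ₖ`. -/
def eCoeff (p : ℂ) (k : ℕ) : ℂ := 1 / qPoch p p k

/-- Coefficients of `E_p(t) = ∑ p^(k(k-1)/2) tᵏ / (p; p)ₖ`. -/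
def ECoeff (p : ℂ) (k : ℕ) : ℂ := p ^ (k * (k - 1) / 2) / qPoch p p k

/-- `[m]_p! = ∏_{j=1}^m (p^j - 1)/(p - 1)`. -/
def qFactorial (p : ℂ) (m : ℕ) : ℂ := ∏ j ∈ Finset.Icc 1 m, (p ^ j - 1) / (p - 1)

/-- The Gaussian `G_{q²}(q² x) = E_{q⁴}(-∑ⱼ (q² xⱼ)²)` in the covector algebra. -/
def bigGaussian (n : ℕ) (q : ℝ) : Cov n q :=
  subst (ECoeff ((q : ℂ) ^ 4)) (-∑ j, ((q : ℂ) ^ 2 • gen j) ^ 2)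

/-- The Gaussian `g_{q²}(∂) = e_{q⁴}(-∑ⱼ ∂ⱼ²)` in the vector algebra. -/
def smallGaussian (n : ℕ) (q : ℝ) : Vec n q :=
  subst (eCoeff ((q : ℂ) ^ 4)) (-∑ j, gen j ^ 2)

/-! ### Lattice order integration on the covector algebra -/

/-- The summand `(1 - q²) q^{2h} x_l f(q⁻² x₁, …, q⁻² x_{l-1}, ε q^{2h} x_l, x_{l+1}, …, xₙ)` of the
braided partial integral of `f` from `-x_l · ∞` to `x_l · ∞`. -/
def partialTerm {n : ℕ} {q : ℝ} (l : Fin n) (h : ℤ) (ε : ℤˣ) (f : Cov n q) : Cov n q :=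
  ((1 - (q : ℂ) ^ 2) * (q : ℂ) ^ (2 * h)) •
    (gen l * rescale (fun j => if j < l then (q : ℂ) ^ (-2 : ℤ)
      else if j = l then ((ε : ℤ) : ℂ) * (q : ℂ) ^ (2 * h) else 1) f)

/-- `g` is the result of integrating `f` with respect to `x_l` over the lattice generated by `c`:
the integral of the even part of `f`, realized on commuting variables and evaluated at `z_l = c`,
converges absolutely to an entire function of the other variables, and `g` is the power series
with that function as realization. -/
def IsPartialIntegral {n : ℕ} {q : ℝ} (c : ℝ) (l : Fin n) (f g : Cov n q) : Prop :=
  ∀ z : Fin n → ℂ,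
    (∀ (h : ℤ) (ε : ℤˣ), Summable fun E =>
      partialTerm l h ε (evenPart f) E * monoVal (Function.update z l (c : ℂ)) E) ∧
    (Summable fun E => g E * monoVal z E) ∧
    HasSum (fun p : ℤ × ℤˣ =>
      evalAt (partialTerm l p.1 p.2 (evenPart f)) (Function.update z l (c : ℂ))) (evalAt g z)

/-- `v` is the value obtained by successively integrating `f` with respect to the listed
variables over the lattice generated by `γ`. -/
def HasIteratedIntegral {n : ℕ} {q : ℝ} (γ : Fin n → ℝ) : List (Fin n) → Cov n q → ℂ → Prop
  | [], f, v => v = f 0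
  | l :: ls, f, v => ∃ g : Cov n q, IsPartialIntegral (γ l) l f g ∧ HasIteratedIntegral γ ls g v

/-- Lattice order integrability for the order `σ` and the lattice generated by `γ`. -/
def LOIntegrable {n : ℕ} {q : ℝ} (σ : Equiv.Perm (Fin n)) (γ : Fin n → ℝ) (f : Cov n q) : Prop :=
  InC f ∧ ∃ v : ℂ, HasIteratedIntegral γ (List.ofFn σ) f v

open Classical in
/-- The lattice order integral `I''_{(σ,γ)} f` (with value `0` if it does not exist). -/
def loIntegral {n : ℕ} {q : ℝ} (σ : Equiv.Perm (Fin n)) (γ : Fin n → ℝ) (f : Cov n q) : ℂ :=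
  if h : ∃ v : ℂ, HasIteratedIntegral γ (List.ofFn σ) f v then h.choose else 0

/-- The class of series `f` such that `f x^E` is lattice order integrable for every `E`. -/
def InR {n : ℕ} {q : ℝ} (σ : Equiv.Perm (Fin n)) (γ : Fin n → ℝ) (f : Cov n q) : Prop :=
  ∀ E : Fin n →₀ ℕ, LOIntegrable σ γ (f * mono E)

/-! ### Integration on the vector algebra -/

/-- `G` is analytic on `ℝⁿ + iU` for some open neighbourhood `U` of `0` in `ℝⁿ`, and coincides near
`0` with the commutative power series realizing `f`. -/
def IsContinuation {n : ℕ} {q : ℝ} (f : Vec n q) (G : (Fin n → ℂ) → ℂ) : Prop :=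
  (∃ U : Set (Fin n → ℝ), IsOpen U ∧ (0 : Fin n → ℝ) ∈ U ∧
    AnalyticOnNhd ℂ G {w | (fun j => (w j).im) ∈ U}) ∧
  ∀ᶠ w in 𝓝 (0 : Fin n → ℂ), HasSum (fun E => f E * monoVal w E) (G w)

open Classical in
/-- The analytic continuation of the realization of `f` (its values on `ℝⁿ` are unique). -/
def continuation {n : ℕ} {q : ℝ} (f : Vec n q) : (Fin n → ℂ) → ℂ :=
  if h : ∃ G, IsContinuation f G then h.choose else 0

/-- Summand of the `n`-variable Jackson `q²`-integral with bounds `-aⱼ · ∞` and `aⱼ · ∞`. -/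
def jacksonTerm {n : ℕ} (q : ℝ) (a : Fin n → ℝ) (G : (Fin n → ℂ) → ℂ)
    (p : (Fin n → ℤ) × (Fin n → ℤˣ)) : ℂ :=
  (1 - (q : ℂ) ^ 2) ^ n * (∏ j, (q : ℂ) ^ (2 * p.1 j) * (a j : ℂ)) *
    G (fun j => ((p.2 j : ℤ) : ℂ) * (q : ℂ) ^ (2 * p.1 j) * (a j : ℂ))

/-- Integrability: the realization of `g` continues analytically to `ℝⁿ + iU`, and it is absolutely
`q²`-integrable over every lattice outside the coordinate hyperplanes. -/
def VecIntegrable {n : ℕ} {q : ℝ} (g : Vec n q) : Prop :=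
  (∃ G, IsContinuation g G) ∧
  ∀ a : Fin n → ℝ, (∀ j, a j ≠ 0) → Summable (jacksonTerm q a (continuation g))

/-- The integral of `g`, acting from the right, with bounds `-bⱼ ∂ⱼ · ∞` and `bⱼ ∂ⱼ · ∞`, i.e.
`(1 - q²)ⁿ ∑ g(εₙ q^{2kₙ} bₙ ∂ₙ, …, ε₁ q^{2k₁} b₁ ∂₁) q^{2|K|} b₁ ∂₁ ⋯ bₙ ∂ₙ`, realized as a
function of `z`: multiplying by `∂₁ ⋯ ∂ₙ` from the right multiplies by `∏ⱼ q^{n-j} zⱼ` and replaces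
`zⱼ` by `q^{n-j} zⱼ` (here `n - j` is `Fin.rev j`). -/
def rightIntegral {n : ℕ} {q : ℝ} (b : Fin n → ℝ) (g : Vec n q) (z : Fin n → ℝ) : ℂ :=
  ∑' p, jacksonTerm q (fun j => q ^ (Fin.rev j : ℕ) * b j * z j) (continuation g) p

/-- The integral `J'`, the right integral of the even part. -/
def evenRightIntegral {n : ℕ} {q : ℝ} (g : Vec n q) (z : Fin n → ℝ) : ℂ :=
  rightIntegral (fun _ => 1) (evenPart g) z

/-- The class of series `g` such that every monomial times `g` is `J'`-integrable. -/
def InS {n : ℕ} {q : ℝ} (g : Vec n q) : Prop :=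
  ∀ E : Fin n →₀ ℕ, VecIntegrable (evenPart (mono E * g))

/-! ### The transforms -/

/-- The coefficients of `exp(x | c₁ ∂₁, …, cₙ ∂ₙ)`, where
`exp(x | ∂) = ∑_E x₁^e₁ ⋯ xₙ^eₙ ⊗ ∂ₙ^eₙ/[eₙ]_{q²}! ⋯ ∂₁^e₁/[e₁]_{q²}!`, with respect to the tensor
products of ordered monomials. -/
def expCoeff {n : ℕ} (q : ℝ) (c : Fin n → ℂ) (E F : Fin n →₀ ℕ) : ℂ :=
  if E = F then monoVal c F / ∏ j, qFactorial ((q : ℂ) ^ 2) (F j) else 0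

/-- The component in the covector algebra of `exp(x | c₁ ∂₁, …, cₙ ∂ₙ)` at `∂ₙ^fₙ ⋯ ∂₁^f₁`. -/
def expCov {n : ℕ} (q : ℝ) (c : Fin n → ℂ) (F : Fin n →₀ ℕ) : Cov n q := fun E => expCoeff q c E F

/-- The component in the vector algebra of `exp(x | c₁ ∂₁, …, cₙ ∂ₙ)` at `x₁^e₁ ⋯ xₙ^eₙ`. -/
def expVec {n : ℕ} (q : ℝ) (c : Fin n → ℂ) (E : Fin n →₀ ℕ) : Vec n q := fun F => expCoeff q c E F

/-- `F''(σ,γ) = (I''_{(σ,γ)} ⊗ id)(m ⊗ id)(id ⊗ exp(x | i/(1-q²) (q^{1-j} ∂ⱼ)ⱼ))`: the coefficient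
at `∂ₙ^fₙ ⋯ ∂₁^f₁` is the integral of `f` times the corresponding component of `exp`. -/
def weakFourier {n : ℕ} {q : ℝ} (σ : Equiv.Perm (Fin n)) (γ : Fin n → ℝ) (f : Cov n q) : Vec n q :=
  fun F => loIntegral σ γ (f * expCov q
    (fun j => Complex.I / (1 - (q : ℂ) ^ 2) * ((q : ℂ) ^ (j : ℕ))⁻¹) F)

/-- `G_S = [(S ⊗ m)(exp(x | i q²/(1-q²) (q^{n-j} ∂ⱼ)ⱼ) ⊗ id)] ↼ (id ⊗ J')`. The second tensor
component is realized at the point `z`, so that the result is a power series in the `xⱼ`. -/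
def inverseFourier {n : ℕ} {q : ℝ} (g : Vec n q) (z : Fin n → ℝ) : Cov n q :=
  antipode (fun E => evenRightIntegral (expVec q
    (fun j => Complex.I * (q : ℂ) ^ 2 / (1 - (q : ℂ) ^ 2) * (q : ℂ) ^ (Fin.rev j : ℕ)) E * g) z)

/-! ### Parities and the series to be transformed -/

/-- The number `0` for an even entry (`+1`) and `1` for an odd entry (`-1`). -/
def parityBit (s : ℤˣ) : ℕ := if s = 1 then 0 else 1

/-- `B(β)_k`, the number of odd entries of `β` with index smaller than `k`. -/
def lowerB {n : ℕ} (β : Fin n → ℤˣ) (k : Fin n) : ℕ :=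
  ∑ j ∈ Finset.univ.filter (· < k), parityBit (β j)

/-- `B(β)^k`, the number of odd entries of `β` with index larger than `k`. -/
def upperB {n : ℕ} (β : Fin n → ℤˣ) (k : Fin n) : ℕ :=
  ∑ j ∈ Finset.univ.filter (k < ·), parityBit (β j)

/-- The polynomial `p` has parity `s`: `p(-t) = s p(t)`. -/
def HasParity (s : ℤˣ) (p : Polynomial ℂ) : Prop :=
  p.comp (-Polynomial.X) = Polynomial.C ((s : ℤ) : ℂ) * p

/-- `E_{q⁴}(-q⁴ xₙ²) pₙ(xₙ) ⋯ E_{q⁴}(-q⁴ x₁²) p₁(x₁)`. -/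
def covSeries {n : ℕ} (q : ℝ) (p : Fin n → Polynomial ℂ) : Cov n q :=
  (List.ofFn fun j => subst (ECoeff ((q : ℂ) ^ 4)) (-((q : ℂ) ^ 4 • gen j ^ 2)) *
    Polynomial.aeval (gen j : Cov n q) (p j)).reverse.prod

/-- `pₙ(∂ₙ) e_{q⁴}(-∂ₙ²) ⋯ p₁(∂₁) e_{q⁴}(-∂₁²)`. -/
def vecSeries {n : ℕ} (q : ℝ) (p : Fin n → Polynomial ℂ) : Vec n q :=
  (List.ofFn fun j => Polynomial.aeval (gen j : Vec n q) (p j) *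
    subst (eCoeff ((q : ℂ) ^ 4)) (-gen j ^ 2)).reverse.prod

end QSpace

end

noncomputable section

namespace QSpace

/-! ### One-variable `q`-exponential power series -/

section OneVariable

open PowerSeries

/-! Both transforms reduce to one variable. An ordered product A_n(x_n)⋯A_1(x_1) has as coefficients
a power of q times products of one-variable coefficients (`prodSer`). This shape survives
multiplication by a monomial, passage to the even part (which is the series itself or 0 when every
factor has a parity) and each integration step; the factors are only multiplied by monomials and
rescaled by powers of q. The Gaussians have this shape by a q-multinomial theorem, because squares
of generators q⁴-commute (`sum_gen_sq_pow`).

In one variable put u(t) = E_{q⁴}(-q⁴t²), v(t) = E_{q⁴}(t²) and e = 1/v, which continues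
e_{q⁴}(-t²). The equations u(q⁻²t) = (1-t²)u(t) and e(q²t) = (1+t²)e(t), together with the
invariance of Jackson q²-sums under q²-dilation, give two-step recursions for the moments, so that u
is transformed into a multiple of e and conversely. Multiplication by the variable before a
transform becomes a q-difference operator after it; hence p·u goes to a multiple of `polyV p`·e and
r·e to a multiple of `polyC r`·u (`momentV_eq`, `momentC_eq`). Each of these polynomial maps turns
the difference operator defining the other into multiplication by X, so they are mutually inverse
(`polyC_polyV`, `polyV_polyC`).

Convergence has two sources. The zeros of u at ±q^{-2m}, m ≥ 1, cut off the sum over the lattice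
generated by 1. The function v has no zero in the strip |Im t| < 1 and dominates every power on the
real line, so polynomials times e are summable over every real lattice.

The noncommutativity leaves only bookkeeping of powers of q. While x_l is integrated, a monomial of
degree d in the other variables dilates the lattice of x_l by q^d. On the even part d is even, the
q²-lattice does not change, and the integral factors (`isPartialIntegral_prodSer`). Thus only the
parity of the exponent of the lattice generator matters: earlier steps contribute their number plus
a number of inversions, the monomials of exp contribute the number of odd β_j with larger index
modulo 2, and the prescribed γ makes the total even. On the vector side the dilation is by q to the
number of odd β_j with smaller index, modulo 2, which explains the bounds in Λ. The remaining powers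
of q cancel against those in the arguments of exp and in the antipode, except one (`shiftExp`) that
F'' shares with the integral of the Gaussian. -/

theorem qPoch_succ (a p : ℂ) (k : ℕ) : qPoch a p (k + 1) = qPoch a p k * (1 - a * p ^ k) :=
  Finset.prod_range_succ _ _

theorem qPoch_zero (a p : ℂ) : qPoch a p 0 = 1 := Finset.prod_range_zero _

theorem qPoch_self_succ (p : ℂ) (k : ℕ) :
    qPoch p p (k + 1) = qPoch p p k * (1 - p ^ (k + 1)) := by
  rw [qPoch_succ, pow_succ']

theorem qPoch_self_ne_zero {p : ℂ} (hp : ∀ k, k ≠ 0 → p ^ k ≠ 1) (k : ℕ) : qPoch p p k ≠ 0 := by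
  induction k with
  | zero => simp [qPoch_zero]
  | succ k ih =>
    rw [qPoch_self_succ]
    exact mul_ne_zero ih (sub_ne_zero.2 (hp _ k.succ_ne_zero).symm)

theorem pow_pow_ne_one {q : ℂ} (hq : ∀ k, k ≠ 0 → q ^ k ≠ 1) {m : ℕ} (hm : m ≠ 0) :
    ∀ k, k ≠ 0 → (q ^ m) ^ k ≠ 1 := fun k hk => by
  rw [← pow_mul]
  exact hq _ (mul_ne_zero hm hk)

/-- Absorbs the factor 1/(1-q²) in the arguments of exp: its powers divided by the q-factorial
become reciprocals of q-shifted factorials. -/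
theorem qPoch_eq_qFactorial {p : ℂ} (hp : ∀ k, k ≠ 0 → p ^ k ≠ 1) (m : ℕ) :
    qPoch p p m = (1 - p) ^ m * qFactorial p m := by
  have h1 : p - 1 ≠ 0 := sub_ne_zero.2 (by simpa using hp 1 one_ne_zero)
  induction m with
  | zero => simp [qPoch_zero, qFactorial]
  | succ m ih =>
    rw [qPoch_self_succ, ih, qFactorial, qFactorial, Finset.prod_Icc_succ_top (by omega)]
    field_simp
    ring

/-- The power series `a(X²)`. -/
def evenSer (a : ℕ → ℂ) : PowerSeries ℂ := mk fun k => if Even k then a (k / 2) else 0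

theorem coeff_evenSer_two_mul (a : ℕ → ℂ) (k : ℕ) : coeff (2 * k) (evenSer a) = a k := by
  simp [evenSer]

theorem coeff_evenSer_odd (a : ℕ → ℂ) {k : ℕ} (hk : ¬ Even k) : coeff k (evenSer a) = 0 := by
  simp [evenSer, hk]

/-- The power series `e_{q⁴}(-X²)`. -/
def eSer (q : ℂ) : PowerSeries ℂ := evenSer fun k => (-1) ^ k * eCoeff (q ^ 4) k

/-- The power series `E_{q⁴}(X²)`. -/
def vSer (q : ℂ) : PowerSeries ℂ := evenSer fun k => ECoeff (q ^ 4) k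

/-- The power series `E_{q⁴}(-q⁴ X²)`. -/
def uSer (q : ℂ) : PowerSeries ℂ := evenSer fun k => (-q ^ 4) ^ k * ECoeff (q ^ 4) k

/-- Since (iq²X)² = -q⁴X², convergence and functional equation of `uSer` need not be proved
separately from those of `vSer`. -/
theorem rescale_vSer (q : ℂ) : PowerSeries.rescale (Complex.I * q ^ 2) (vSer q) = uSer q := by
  ext k
  rcases Nat.even_or_odd' k with ⟨m, rfl | rfl⟩
  · rw [coeff_rescale, vSer, uSer, coeff_evenSer_two_mul, coeff_evenSer_two_mul, pow_mul, mul_pow,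
      Complex.I_sq]
    ring
  · rw [coeff_rescale, vSer, uSer, coeff_evenSer_odd, coeff_evenSer_odd, mul_zero] <;> simp

theorem constantCoeff_eSer (q : ℂ) : coeff 0 (eSer q) = 1 := by
  exact (coeff_evenSer_two_mul _ 0).trans (by simp [eCoeff, qPoch_zero])

theorem constantCoeff_vSer (q : ℂ) : coeff 0 (vSer q) = 1 := by
  exact (coeff_evenSer_two_mul _ 0).trans (by simp [ECoeff, qPoch_zero])

theorem constantCoeff_uSer (q : ℂ) : coeff 0 (uSer q) = 1 := by
  rw [← rescale_vSer, coeff_rescale, constantCoeff_vSer]; simp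

variable {q : ℂ}

/-- Coefficient form of φ(q²X) = (1+X²)φ(X). This recurrence and its analogues for `vSer` and `uSer`
also serve to recognise the moment series. -/
theorem eSer_recurrence (hq : ∀ k, k ≠ 0 → q ^ k ≠ 1) (k : ℕ) :
    (1 - q ^ (2 * (k + 2))) * coeff (k + 2) (eSer q) = -coeff k (eSer q) := by
  have hp := pow_pow_ne_one hq (show 4 ≠ 0 by decide)
  rcases Nat.even_or_odd' k with ⟨m, rfl | rfl⟩
  · rw [show 2 * m + 2 = 2 * (m + 1) by ring, eSer, coeff_evenSer_two_mul, coeff_evenSer_two_mul,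
      eCoeff, eCoeff, qPoch_self_succ]
    have h1 := qPoch_self_ne_zero hp m
    have h2 : 1 - (q ^ 4) ^ (m + 1) ≠ 0 := sub_ne_zero.2 (hp _ m.succ_ne_zero).symm
    have h3 : q ^ (2 * (2 * (m + 1))) = (q ^ 4) ^ (m + 1) := by ring
    rw [h3]
    field_simp
    ring
  · rw [eSer, coeff_evenSer_odd, coeff_evenSer_odd]
    · simp
    · simp
    · rw [show 2 * m + 1 + 2 = 2 * (m + 1) + 1 by ring]; simp

theorem vSer_recurrence (hq : ∀ k, k ≠ 0 → q ^ k ≠ 1) (k : ℕ) :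
    (1 - q ^ (2 * (k + 2))) * coeff (k + 2) (vSer q) = q ^ (2 * k) * coeff k (vSer q) := by
  have hp := pow_pow_ne_one hq (show 4 ≠ 0 by decide)
  rcases Nat.even_or_odd' k with ⟨m, rfl | rfl⟩
  · rw [show 2 * m + 2 = 2 * (m + 1) by ring, vSer, coeff_evenSer_two_mul, coeff_evenSer_two_mul,
      ECoeff, ECoeff, qPoch_self_succ, Nat.triangle_succ]
    have h1 := qPoch_self_ne_zero hp m
    have h2 : 1 - (q ^ 4) ^ (m + 1) ≠ 0 := sub_ne_zero.2 (hp _ m.succ_ne_zero).symm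
    have h3 : q ^ (2 * (2 * (m + 1))) = (q ^ 4) ^ (m + 1) := by ring
    have h4 : q ^ (2 * (2 * m)) = (q ^ 4) ^ m := by ring
    rw [h3, h4, pow_add (q ^ 4) _ m, mul_div_assoc', div_eq_iff (mul_ne_zero h1 h2)]
    field_simp
  · rw [vSer, coeff_evenSer_odd, coeff_evenSer_odd]
    · simp
    · simp
    · rw [show 2 * m + 1 + 2 = 2 * (m + 1) + 1 by ring]; simp

theorem uSer_recurrence (hq : ∀ k, k ≠ 0 → q ^ k ≠ 1) (k : ℕ) :
    (1 - q ^ (2 * (k + 2))) * coeff (k + 2) (uSer q) = -q ^ (2 * k + 4) * coeff k (uSer q) := by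
  have h := vSer_recurrence hq k
  rw [← rescale_vSer, coeff_rescale, coeff_rescale, mul_left_comm, h, pow_add _ k 2, mul_pow _ _ 2,
    Complex.I_sq]
  ring

theorem coeff_one_evenSer (a : ℕ → ℂ) : coeff 1 (evenSer a) = 0 := coeff_evenSer_odd a (by decide)

/-- A power series is determined by its first two coefficients and a two-step recurrence. -/
theorem ext_of_recurrence {f g : PowerSeries ℂ} (a b : ℕ → ℂ) (ha : ∀ k, a k ≠ 0)
    (h0 : coeff 0 f = coeff 0 g) (h1 : coeff 1 f = coeff 1 g)
    (hf : ∀ k, a k * coeff (k + 2) f = b k * coeff k f)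
    (hg : ∀ k, a k * coeff (k + 2) g = b k * coeff k g) : f = g := by
  ext k
  induction k using Nat.twoStepInduction with
  | zero => exact h0
  | one => exact h1
  | more k ih _ => exact mul_left_cancel₀ (ha k) (by rw [hf, hg, ih])

theorem coeff_X_sq_mul_zero (f : PowerSeries ℂ) : coeff 0 (X ^ 2 * f) = 0 := by
  rw [coeff_X_pow_mul']; simp

theorem coeff_X_sq_mul_one (f : PowerSeries ℂ) : coeff 1 (X ^ 2 * f) = 0 := by
  rw [coeff_X_pow_mul']; simp

theorem rescale_eSer (hq : ∀ k, k ≠ 0 → q ^ k ≠ 1) :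
    PowerSeries.rescale (q ^ 2) (eSer q) = (1 + X ^ 2) * eSer q := by
  ext k
  rw [coeff_rescale, add_mul, one_mul, map_add]
  match k with
  | 0 => rw [coeff_X_sq_mul_zero]; simp
  | 1 => rw [coeff_X_sq_mul_one, eSer, coeff_one_evenSer]; simp
  | k + 2 =>
    rw [coeff_X_pow_mul, ← pow_mul]
    linear_combination -eSer_recurrence hq k

theorem vSer_eq (hq : ∀ k, k ≠ 0 → q ^ k ≠ 1) :
    vSer q = (1 + X ^ 2) * PowerSeries.rescale (q ^ 2) (vSer q) := by
  ext k
  rw [add_mul, one_mul, map_add, coeff_rescale]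
  match k with
  | 0 => rw [coeff_X_sq_mul_zero]; simp
  | 1 => rw [coeff_X_sq_mul_one, vSer, coeff_one_evenSer]; simp
  | k + 2 =>
    rw [coeff_X_pow_mul, coeff_rescale, ← pow_mul, ← pow_mul]
    linear_combination vSer_recurrence hq k

theorem rescale_uSer (hq0 : q ≠ 0) (hq : ∀ k, k ≠ 0 → q ^ k ≠ 1) :
    PowerSeries.rescale (q ^ 2)⁻¹ (uSer q) = (1 - X ^ 2) * uSer q := by
  ext k
  rw [sub_mul, one_mul, map_sub, coeff_rescale]
  match k with
  | 0 => rw [coeff_X_sq_mul_zero]; simp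
  | 1 => rw [coeff_X_sq_mul_one, uSer, coeff_one_evenSer]; simp
  | k + 2 =>
    rw [coeff_X_pow_mul, inv_pow, ← pow_mul]
    have h := uSer_recurrence hq k
    have h2 : q ^ (2 * (k + 2)) ≠ 0 := pow_ne_zero _ hq0
    field_simp
    linear_combination h

/-- By the two functional equations the product is invariant under X ↦ q²X. As q is not a root of
unity, it is constant. -/
theorem eSer_mul_vSer (hq : ∀ k, k ≠ 0 → q ^ k ≠ 1) : eSer q * vSer q = 1 := by
  have h : PowerSeries.rescale (q ^ 2) (eSer q * vSer q) = eSer q * vSer q := by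
    rw [map_mul, rescale_eSer hq]
    conv_rhs => rw [vSer_eq hq]
    ring
  ext k
  match k with
  | 0 => simpa [coeff_zero_eq_constantCoeff] using
      congr_arg₂ (· * ·) (constantCoeff_eSer q) (constantCoeff_vSer q)
  | k + 1 =>
    have h1 := congr_arg (coeff (k + 1)) h
    rw [coeff_rescale, ← pow_mul] at h1
    rw [coeff_one, if_neg k.succ_ne_zero]
    have h2 : (q ^ (2 * (k + 1)) - 1) * coeff (k + 1) (eSer q * vSer q) = 0 := by
      linear_combination h1
    exact (mul_eq_zero.1 h2).resolve_left (sub_ne_zero.2 (hq _ (by omega)))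

end OneVariable

/-! ### The transforms of one-variable polynomials -/

section PolynomialTransforms

open Polynomial

/-- `r(a X)`. -/
def scaleArg (a : ℂ) (r : ℂ[X]) : ℂ[X] := r.comp (C a * X)

theorem scaleArg_X_mul (a : ℂ) (r : ℂ[X]) : scaleArg a (X * r) = C a * (X * scaleArg a r) := by
  simp [scaleArg, mul_assoc]

theorem scaleArg_comp_neg (a : ℂ) (r : ℂ[X]) :
    scaleArg a (r.comp (-X)) = (scaleArg a r).comp (-X) := by
  simp [scaleArg, comp_assoc]

theorem coeff_zero_scaleArg (a : ℂ) (r : ℂ[X]) : (scaleArg a r).coeff 0 = r.coeff 0 := by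
  simp [scaleArg, coeff_zero_eq_eval_zero]

theorem coe_scaleArg (a : ℂ) (r : ℂ[X]) :
    ((scaleArg a r : ℂ[X]) : PowerSeries ℂ) = PowerSeries.rescale a (r : PowerSeries ℂ) := by
  ext k
  rw [coeff_coe, PowerSeries.coeff_rescale, coeff_coe, scaleArg, comp_C_mul_X_coeff, mul_comm]

/-- `(r(X) - (1 + X²) r(q² X)) / X`. -/
def downV (q : ℂ) : ℂ[X] →ₗ[ℂ] ℂ[X] where
  toFun r := divX (r - (1 + X ^ 2) * scaleArg (q ^ 2) r)
  map_add' r s := by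
    rw [← divX_add]; congr 1; simp only [scaleArg, add_comp]; ring
  map_smul' a r := by
    simp only [RingHom.id_apply, smul_eq_C_mul, scaleArg, mul_comp, C_comp]
    rw [← divX_C_mul]; congr 1; ring

/-- `((1 - X²) p(q⁻² X) - p(X)) / X`. -/
def downC (q : ℂ) : ℂ[X] →ₗ[ℂ] ℂ[X] where
  toFun r := divX ((1 - X ^ 2) * scaleArg (q ^ 2)⁻¹ r - r)
  map_add' r s := by
    rw [← divX_add]; congr 1; simp only [scaleArg, add_comp]; ring
  map_smul' a r := by
    simp only [RingHom.id_apply, smul_eq_C_mul, scaleArg, mul_comp, C_comp]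
    rw [← divX_C_mul]; congr 1; ring

variable {q : ℂ}

theorem X_mul_downV (r : ℂ[X]) : X * downV q r = r - (1 + X ^ 2) * scaleArg (q ^ 2) r := by
  have h := divX_mul_X_add (r - (1 + X ^ 2) * scaleArg (q ^ 2) r)
  -- `divX` discards the constant coefficient, so the division by X is exact only because that
  -- coefficient vanishes.
  have h0 : (r - (1 + X ^ 2) * scaleArg (q ^ 2) r).coeff 0 = 0 := by
    simp [mul_coeff_zero, coeff_zero_scaleArg]
  rw [h0, C_0, add_zero, mul_comm] at h
  exact h

theorem X_mul_downC (r : ℂ[X]) :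
    X * downC q r = (1 - X ^ 2) * scaleArg (q ^ 2)⁻¹ r - r := by
  have h := divX_mul_X_add ((1 - X ^ 2) * scaleArg (q ^ 2)⁻¹ r - r)
  have h0 : ((1 - X ^ 2) * scaleArg (q ^ 2)⁻¹ r - r).coeff 0 = 0 := by
    simp [mul_coeff_zero, coeff_zero_scaleArg]
  rw [h0, C_0, add_zero, mul_comm] at h
  exact h

theorem X_mul_cancel {r s : ℂ[X]} (h : X * r = X * s) : r = s := mul_left_cancel₀ X_ne_zero h

/-- A q-Leibniz rule: with X it makes `downV` satisfy a q-Weyl relation with parameter q². The rule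
for `downC` is the same with q⁻². -/
theorem downV_X_mul (r : ℂ[X]) :
    downV q (X * r) = C (1 - q ^ 2) * r + C (q ^ 2) * (X * downV q r) := by
  apply X_mul_cancel
  rw [X_mul_downV, X_mul_downV, scaleArg_X_mul]
  simp only [C_sub, C_1]
  ring

theorem downC_X_mul (r : ℂ[X]) :
    downC q (X * r) = C ((q ^ 2)⁻¹ - 1) * r + C (q ^ 2)⁻¹ * (X * downC q r) := by
  apply X_mul_cancel
  rw [X_mul_downC, X_mul_downC, scaleArg_X_mul]
  simp only [C_sub, C_1]
  ring

theorem downV_one : downV q 1 = -X := by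
  apply X_mul_cancel
  rw [X_mul_downV]
  simp [scaleArg]
  ring

theorem downC_one : downC q 1 = -X := by
  apply X_mul_cancel
  rw [X_mul_downC]
  simp [scaleArg]
  ring

/-- The scaling and the factor 1+X² preserve parity; the division by X reverses it. -/
theorem downV_comp_neg (r : ℂ[X]) : downV q (r.comp (-X)) = -(downV q r).comp (-X) := by
  apply X_mul_cancel
  have h := congr_arg (fun s : ℂ[X] => s.comp (-X)) (X_mul_downV (q := q) r)
  simp only [mul_comp, sub_comp, add_comp, X_comp, one_comp, pow_comp] at h
  rw [X_mul_downV, scaleArg_comp_neg]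
  linear_combination -h

theorem downC_comp_neg (r : ℂ[X]) : downC q (r.comp (-X)) = -(downC q r).comp (-X) := by
  apply X_mul_cancel
  have h := congr_arg (fun s : ℂ[X] => s.comp (-X)) (X_mul_downC (q := q) r)
  simp only [mul_comp, sub_comp, X_comp, one_comp, pow_comp] at h
  rw [X_mul_downC, scaleArg_comp_neg]
  linear_combination -h

/-- The polynomial `r` such that the transform of `p(x) E_{q⁴}(-q⁴ x²)` is a multiple of
`r(∂) e_{q⁴}(-∂²)`. -/
def polyV (q : ℂ) (p : ℂ[X]) : ℂ[X] :=
  aeval (R := ℂ) (A := Module.End ℂ ℂ[X]) (-Complex.I • downV q) p 1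

/-- The polynomial `p` such that the inverse transform of `r(∂) e_{q⁴}(-∂²)` is a multiple of
`p(x) E_{q⁴}(-q⁴ x²)`. -/
def polyC (q : ℂ) (r : ℂ[X]) : ℂ[X] :=
  aeval (R := ℂ) (A := Module.End ℂ ℂ[X]) (Complex.I • downC q) r 1

theorem polyV_one : polyV q 1 = 1 := by simp [polyV]

theorem polyC_one : polyC q 1 = 1 := by simp [polyC]

theorem polyV_add (p s : ℂ[X]) : polyV q (p + s) = polyV q p + polyV q s := by simp [polyV]

theorem polyC_add (p s : ℂ[X]) : polyC q (p + s) = polyC q p + polyC q s := by simp [polyC]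

theorem polyV_C_mul (a : ℂ) (p : ℂ[X]) : polyV q (C a * p) = C a * polyV q p := by
  simp [polyV, ← smul_eq_C_mul]

theorem polyC_C_mul (a : ℂ) (p : ℂ[X]) : polyC q (C a * p) = C a * polyC q p := by
  simp [polyC, ← smul_eq_C_mul]

theorem polyV_X_mul (p : ℂ[X]) : polyV q (X * p) = C (-Complex.I) * downV q (polyV q p) := by
  simp [polyV, smul_eq_C_mul]

theorem polyC_X_mul (p : ℂ[X]) : polyC q (X * p) = C Complex.I * downC q (polyC q p) := by
  simp [polyC, smul_eq_C_mul]

/-- Induction on polynomials by sums, scalar multiples and multiplication by `X`. -/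
theorem poly_induction {P : ℂ[X] → Prop} (p : ℂ[X]) (h1 : P 1)
    (hadd : ∀ p s, P p → P s → P (p + s)) (hC : ∀ a p, P p → P (C a * p))
    (hX : ∀ p, P p → P (X * p)) : P p := by
  have hpow : ∀ m : ℕ, P (X ^ m) := fun m => by
    induction m with
    | zero => simpa using h1
    | succ m ih => rw [pow_succ']; exact hX _ ih
  induction p using Polynomial.induction_on' with
  | add p s hp hs => exact hadd p s hp hs
  | monomial m a => rw [← C_mul_X_pow_eq_monomial]; exact hC _ _ (hpow m)

/-- `polyC` turns multiplication by X into i·`downC`; here it turns -i·`downV` back into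
multiplication by X. The relation holds on 1 because both operators send 1 to -X, and it propagates
along multiplication by X because the two Leibniz rules are one q-Weyl relation with q² inverted. -/
theorem polyC_downV (hq0 : q ≠ 0) (r : ℂ[X]) :
    polyC q (C (-Complex.I) * downV q r) = X * polyC q r := by
  have hq2 : (C (q ^ 2) * C (q ^ 2)⁻¹ : ℂ[X]) = 1 := by
    rw [← C_mul, mul_inv_cancel₀ (pow_ne_zero 2 hq0), C_1]
  have hI : (C Complex.I * C Complex.I : ℂ[X]) = -1 := by rw [← C_mul, Complex.I_mul_I]; simp
  induction r using poly_induction with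
  | h1 =>
    rw [downV_one, show (C (-Complex.I) * -X : ℂ[X]) = C Complex.I * (X * 1) by simp,
      polyC_C_mul, polyC_X_mul, polyC_one, downC_one]
    linear_combination -X * hI
  | hadd p s hp hs => rw [map_add, mul_add, polyC_add, hp, hs, polyC_add, mul_add]
  | hC a p hp =>
    rw [← smul_eq_C_mul (p := p), map_smul, smul_eq_C_mul, smul_eq_C_mul, mul_left_comm, polyC_C_mul, hp,
      polyC_C_mul]
    ring
  | hX p hp =>
    rw [downV_X_mul, mul_add, polyC_add, mul_left_comm, polyC_C_mul, polyC_C_mul,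
      show (C (-Complex.I) * (C (q ^ 2) * (X * downV q p)) : ℂ[X]) =
        C (q ^ 2) * (X * (C (-Complex.I) * downV q p)) by ring,
      polyC_C_mul, polyC_X_mul, hp, downC_X_mul, polyC_X_mul]
    simp only [C_sub, C_neg, C_1]
    linear_combination (C Complex.I * polyC q p + C Complex.I * X * downC q (polyC q p)) * hq2

theorem polyV_downC (hq0 : q ≠ 0) (p : ℂ[X]) :
    polyV q (C Complex.I * downC q p) = X * polyV q p := by
  have hq2 : (C (q ^ 2) * C (q ^ 2)⁻¹ : ℂ[X]) = 1 := by
    rw [← C_mul, mul_inv_cancel₀ (pow_ne_zero 2 hq0), C_1]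
  have hI : (C Complex.I * C Complex.I : ℂ[X]) = -1 := by rw [← C_mul, Complex.I_mul_I]; simp
  induction p using poly_induction with
  | h1 =>
    rw [downC_one, show (C Complex.I * -X : ℂ[X]) = C (-Complex.I) * (X * 1) by simp,
      polyV_C_mul, polyV_X_mul, polyV_one, downV_one]
    simp only [C_neg]
    linear_combination -X * hI
  | hadd p s hp hs => rw [map_add, mul_add, polyV_add, hp, hs, polyV_add, mul_add]
  | hC a p hp =>
    rw [← smul_eq_C_mul (p := p), map_smul, smul_eq_C_mul, smul_eq_C_mul, mul_left_comm, polyV_C_mul, hp,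
      polyV_C_mul]
    ring
  | hX p hp =>
    rw [downC_X_mul, mul_add, polyV_add, mul_left_comm, polyV_C_mul, polyV_C_mul,
      show (C Complex.I * (C (q ^ 2)⁻¹ * (X * downC q p)) : ℂ[X]) =
        C (q ^ 2)⁻¹ * (X * (C Complex.I * downC q p)) by ring,
      polyV_C_mul, polyV_X_mul, hp, downV_X_mul, polyV_X_mul]
    simp only [C_sub, C_neg, C_1]
    linear_combination (C Complex.I * polyV q p - C Complex.I * X * downV q (polyV q p)) * hq2

theorem polyC_polyV (hq0 : q ≠ 0) (p : ℂ[X]) : polyC q (polyV q p) = p := by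
  induction p using poly_induction with
  | h1 => rw [polyV_one, polyC_one]
  | hadd p s hp hs => rw [polyV_add, polyC_add, hp, hs]
  | hC a p hp => rw [polyV_C_mul, polyC_C_mul, hp]
  | hX p hp => rw [polyV_X_mul, polyC_downV hq0, hp]

theorem polyV_polyC (hq0 : q ≠ 0) (r : ℂ[X]) : polyV q (polyC q r) = r := by
  induction r using poly_induction with
  | h1 => rw [polyC_one, polyV_one]
  | hadd p s hp hs => rw [polyC_add, polyV_add, hp, hs]
  | hC a p hp => rw [polyC_C_mul, polyV_C_mul, hp]
  | hX p hp => rw [polyC_X_mul, polyV_downC hq0, hp]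

theorem polyV_comp_neg (p : ℂ[X]) : polyV q (p.comp (-X)) = (polyV q p).comp (-X) := by
  induction p using poly_induction with
  | h1 => simp [polyV_one]
  | hadd p s hp hs => rw [add_comp, polyV_add, hp, hs, polyV_add, add_comp]
  | hC a p hp => rw [mul_comp, C_comp, polyV_C_mul, hp, polyV_C_mul, mul_comp, C_comp]
  | hX p hp =>
    rw [mul_comp, X_comp, show -X * p.comp (-X) = C (-1) * (X * p.comp (-X)) by simp, polyV_C_mul,
      polyV_X_mul, hp, downV_comp_neg, polyV_X_mul, mul_comp, C_comp]
    simp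

theorem polyC_comp_neg (p : ℂ[X]) : polyC q (p.comp (-X)) = (polyC q p).comp (-X) := by
  induction p using poly_induction with
  | h1 => simp [polyC_one]
  | hadd p s hp hs => rw [add_comp, polyC_add, hp, hs, polyC_add, add_comp]
  | hC a p hp => rw [mul_comp, C_comp, polyC_C_mul, hp, polyC_C_mul, mul_comp, C_comp]
  | hX p hp =>
    rw [mul_comp, X_comp, show -X * p.comp (-X) = C (-1) * (X * p.comp (-X)) by simp, polyC_C_mul,
      polyC_X_mul, hp, downC_comp_neg, polyC_X_mul, mul_comp, C_comp]
    simp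

theorem HasParity.polyV {s : ℤˣ} {p : ℂ[X]} (hp : HasParity s p) : HasParity s (polyV q p) := by
  rw [HasParity, ← polyV_comp_neg, hp, polyV_C_mul]

theorem HasParity.polyC {s : ℤˣ} {p : ℂ[X]} (hp : HasParity s p) : HasParity s (polyC q p) := by
  rw [HasParity, ← polyC_comp_neg, hp, polyC_C_mul]

/-- The series with coefficients `i^k / (q²; q²)ₖ L(X^k p)`. -/
def momentV (q : ℂ) (L : ℂ[X] →ₗ[ℂ] ℂ) (p : ℂ[X]) : PowerSeries ℂ :=
  PowerSeries.mk fun k => Complex.I ^ k / qPoch (q ^ 2) (q ^ 2) k * L (X ^ k * p)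

/-- The series with coefficients `(-i q²)^k q^(k(k-1)) / (q²; q²)ₖ M(X^k r)`. -/
def momentC (q : ℂ) (M : ℂ[X] →ₗ[ℂ] ℂ) (r : ℂ[X]) : PowerSeries ℂ :=
  PowerSeries.mk fun k => (-Complex.I * q ^ 2) ^ k * q ^ (k * (k - 1)) /
    qPoch (q ^ 2) (q ^ 2) k * M (X ^ k * r)

theorem powerSeries_X_mul_cancel {f g : PowerSeries ℂ}
    (h : PowerSeries.X * f = PowerSeries.X * g) : f = g := by
  ext k
  simpa [PowerSeries.coeff_succ_X_mul] using congr_arg (PowerSeries.coeff (k + 1)) h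

theorem rescale_C (a b : ℂ) : PowerSeries.rescale a (PowerSeries.C b) = PowerSeries.C b := by
  ext k
  rw [PowerSeries.coeff_rescale, PowerSeries.coeff_C]
  split_ifs with h <;> simp [h]

/-- The quotient of consecutive shifted factorials is 1-q^{2(k+1)}, so the index shift caused by X
acts on the generating series as a q²-difference. -/
theorem X_mul_momentV (hq : ∀ k, k ≠ 0 → q ^ k ≠ 1) (L : ℂ[X] →ₗ[ℂ] ℂ) (p : ℂ[X]) :
    PowerSeries.X * momentV q L (X * p) =
      PowerSeries.C (-Complex.I) * (momentV q L p - PowerSeries.rescale (q ^ 2) (momentV q L p)) := by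
  have hp := pow_pow_ne_one hq (show 2 ≠ 0 by decide)
  ext k
  rw [PowerSeries.coeff_C_mul, map_sub, PowerSeries.coeff_rescale]
  match k with
  | 0 => simp
  | k + 1 =>
    rw [PowerSeries.coeff_succ_X_mul]
    simp only [momentV, PowerSeries.coeff_mk, qPoch_self_succ]
    have h1 := qPoch_self_ne_zero hp k
    have h2 : 1 - (q ^ 2) ^ (k + 1) ≠ 0 := sub_ne_zero.2 (hp _ k.succ_ne_zero).symm
    rw [show X ^ (k + 1) * p = X ^ k * (X * p) by ring, pow_succ Complex.I]
    field_simp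
    linear_combination L (X ^ k * (X * p)) * Complex.I_sq

/-- As for `momentV`, but the quadratic factor q^{k(k-1)} from the antipode contributes q^{2k} per
index shift and replaces the q²-difference by a q⁻²-difference. -/
theorem X_mul_momentC (hq0 : q ≠ 0) (hq : ∀ k, k ≠ 0 → q ^ k ≠ 1) (M : ℂ[X] →ₗ[ℂ] ℂ) (r : ℂ[X]) :
    PowerSeries.X * momentC q M (X * r) =
      PowerSeries.C Complex.I *
        (PowerSeries.rescale (q ^ 2)⁻¹ (momentC q M r) - momentC q M r) := by
  have hp := pow_pow_ne_one hq (show 2 ≠ 0 by decide)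
  ext k
  rw [PowerSeries.coeff_C_mul, map_sub, PowerSeries.coeff_rescale]
  match k with
  | 0 => simp
  | k + 1 =>
    rw [PowerSeries.coeff_succ_X_mul]
    simp only [momentC, PowerSeries.coeff_mk, qPoch_self_succ, Nat.add_sub_cancel]
    have h1 := qPoch_self_ne_zero hp k
    have h2 : 1 - (q ^ 2) ^ (k + 1) ≠ 0 := sub_ne_zero.2 (hp _ k.succ_ne_zero).symm
    have h3 : q ^ ((k + 1) * k) = q ^ (k * (k - 1)) * q ^ (2 * k) := by
      rw [← pow_add]; congr 1; cases k
      · rfl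
      · simp; ring
    have h4 : (-Complex.I * q ^ 2) ^ (k + 1) = (-Complex.I * q ^ 2) ^ k * (-Complex.I * q ^ 2) :=
      pow_succ _ _
    rw [show X ^ (k + 1) * r = X ^ k * (X * r) by ring, h3, h4, inv_pow]
    generalize (-Complex.I * q ^ 2) ^ k = a
    generalize L1 : M (X ^ k * (X * r)) = m
    field_simp
    linear_combination
      (a * m * q ^ (2 * k + 2) * (1 - q ^ (2 * (k + 1)))) * Complex.I_sq

/-- The moment recursion hL becomes, after division by the shifted factorials, the two-step
recurrence of `eSer`; the vanishing first moment supplies the odd initial value. -/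
theorem momentV_one (hq : ∀ k, k ≠ 0 → q ^ k ≠ 1) (L : ℂ[X] →ₗ[ℂ] ℂ) (h1 : L X = 0)
    (hL : ∀ m, L (X ^ (m + 2)) = (1 - q ^ (2 * (m + 1))) * L (X ^ m)) :
    momentV q L 1 = PowerSeries.C (L 1) * eSer q := by
  have hp := pow_pow_ne_one hq (show 2 ≠ 0 by decide)
  refine ext_of_recurrence (fun k => 1 - q ^ (2 * (k + 2))) (fun _ => -1)
    (fun k => sub_ne_zero.2 (hq _ (by omega)).symm) ?_ ?_ (fun k => ?_) (fun k => ?_)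
  · rw [PowerSeries.coeff_C_mul, constantCoeff_eSer]; simp [momentV, qPoch_zero]
  · rw [PowerSeries.coeff_C_mul, eSer, coeff_one_evenSer]; simp [momentV, h1]
  · simp only [momentV, PowerSeries.coeff_mk, mul_one, hL, qPoch_self_succ]
    have h1 := qPoch_self_ne_zero hp k
    have h2 : 1 - q ^ (2 * (k + 1)) ≠ 0 := sub_ne_zero.2 (hq _ (by omega)).symm
    have h3 : 1 - q ^ (2 * (k + 2)) ≠ 0 := sub_ne_zero.2 (hq _ (by omega)).symm
    rw [← pow_mul, ← pow_mul, show 2 * (k + 1 + 1) = 2 * (k + 2) by ring, pow_add _ _ 2,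
      Complex.I_sq]
    field_simp
  · rw [PowerSeries.coeff_C_mul, PowerSeries.coeff_C_mul]
    linear_combination L 1 * eSer_recurrence hq k

theorem momentC_one (hq0 : q ≠ 0) (hq : ∀ k, k ≠ 0 → q ^ k ≠ 1) (M : ℂ[X] →ₗ[ℂ] ℂ) (h1 : M X = 0)
    (hM : ∀ m, M (X ^ (m + 2)) = ((q ^ (2 * (m + 1)))⁻¹ - 1) * M (X ^ m)) :
    momentC q M 1 = PowerSeries.C (M 1) * uSer q := by
  have hp := pow_pow_ne_one hq (show 2 ≠ 0 by decide)
  refine ext_of_recurrence (fun k => 1 - q ^ (2 * (k + 2))) (fun k => -q ^ (2 * k + 4))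
    (fun k => sub_ne_zero.2 (hq _ (by omega)).symm) ?_ ?_ (fun k => ?_) (fun k => ?_)
  · rw [PowerSeries.coeff_C_mul, constantCoeff_uSer]; simp [momentC, qPoch_zero]
  · rw [PowerSeries.coeff_C_mul, uSer, coeff_one_evenSer]; simp [momentC, h1]
  · simp only [momentC, PowerSeries.coeff_mk, mul_one, hM, qPoch_self_succ]
    have h1 := qPoch_self_ne_zero hp k
    have h2 : 1 - q ^ (2 * (k + 1)) ≠ 0 := sub_ne_zero.2 (hq _ (by omega)).symm
    have h3 : 1 - q ^ (2 * (k + 2)) ≠ 0 := sub_ne_zero.2 (hq _ (by omega)).symm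
    have h4 : q ^ ((k + 2) * (k + 2 - 1)) = q ^ (k * (k - 1)) * q ^ (4 * k + 2) := by
      rw [← pow_add]; congr 1; cases k
      · rfl
      · simp; ring
    have h5 : (-Complex.I * q ^ 2) ^ (k + 2) = -(-Complex.I * q ^ 2) ^ k * q ^ 4 := by
      rw [pow_add, mul_pow _ _ 2, neg_sq, Complex.I_sq]; ring
    rw [← pow_mul, ← pow_mul, show 2 * (k + 1 + 1) = 2 * (k + 2) by ring, h4, h5]
    generalize (-Complex.I * q ^ 2) ^ k = a
    generalize M (X ^ k) = m
    have h6 : q ^ (2 * (k + 1)) ≠ 0 := pow_ne_zero _ hq0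
    have h7 : (q ^ (2 * (k + 1)))⁻¹ - 1 = (1 - q ^ (2 * (k + 1))) / q ^ (2 * (k + 1)) := by
      field_simp
    rw [h7]
    have h8 : q ^ (4 * k + 2) * q ^ 4 = q ^ (2 * k + 4) * q ^ (2 * (k + 1)) := by ring
    generalize q ^ (k * (k - 1)) = b
    generalize q ^ (2 * (k + 2)) = d at *
    generalize q ^ (2 * (k + 1)) = f at *
    generalize q ^ (4 * k + 2) = g at *
    generalize q ^ 4 = h at *
    field_simp
    linear_combination (-a * b * m) * h8
  · rw [PowerSeries.coeff_C_mul, PowerSeries.coeff_C_mul]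
    linear_combination M 1 * uSer_recurrence hq k

theorem momentV_add (L : ℂ[X] →ₗ[ℂ] ℂ) (p s : ℂ[X]) :
    momentV q L (p + s) = momentV q L p + momentV q L s := by
  ext k; simp [momentV, mul_add]

theorem momentC_add (L : ℂ[X] →ₗ[ℂ] ℂ) (p s : ℂ[X]) :
    momentC q L (p + s) = momentC q L p + momentC q L s := by
  ext k; simp [momentC, mul_add]

theorem momentV_C_mul (L : ℂ[X] →ₗ[ℂ] ℂ) (a : ℂ) (p : ℂ[X]) :
    momentV q L (C a * p) = PowerSeries.C a * momentV q L p := by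
  ext k
  rw [PowerSeries.coeff_C_mul]
  simp only [momentV, PowerSeries.coeff_mk]
  rw [mul_left_comm, ← smul_eq_C_mul, map_smul, smul_eq_mul, mul_left_comm]

theorem momentC_C_mul (L : ℂ[X] →ₗ[ℂ] ℂ) (a : ℂ) (p : ℂ[X]) :
    momentC q L (C a * p) = PowerSeries.C a * momentC q L p := by
  ext k
  rw [PowerSeries.coeff_C_mul]
  simp only [momentC, PowerSeries.coeff_mk]
  rw [mul_left_comm, ← smul_eq_C_mul, map_smul, smul_eq_mul, mul_left_comm]

/-- The case p = 1 is the transform of the Gaussian. Each further X applies a q²-difference to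
polynomial times `eSer`, and the functional equation of `eSer` turns that into `downV` on the
polynomial. -/
theorem momentV_eq (hq : ∀ k, k ≠ 0 → q ^ k ≠ 1) (L : ℂ[X] →ₗ[ℂ] ℂ) (h1 : L X = 0)
    (hL : ∀ m, L (X ^ (m + 2)) = (1 - q ^ (2 * (m + 1))) * L (X ^ m)) (p : ℂ[X]) :
    momentV q L p = PowerSeries.C (L 1) * ((polyV q p : ℂ[X]) * eSer q) := by
  induction p using poly_induction with
  | h1 => rw [momentV_one hq L h1 hL, polyV_one, coe_one, one_mul]
  | hadd p s hp hs => rw [momentV_add, hp, hs, polyV_add, coe_add]; ring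
  | hC a p hp => rw [momentV_C_mul, hp, polyV_C_mul, coe_mul, coe_C]; ring
  | hX p hp =>
    apply powerSeries_X_mul_cancel
    have h := congr_arg (fun s : ℂ[X] => (s : PowerSeries ℂ)) (X_mul_downV (q := q) (polyV q p))
    simp only [coe_mul, coe_sub, coe_add, coe_one, coe_pow, coe_X, coe_scaleArg] at h
    rw [X_mul_momentV hq, hp, polyV_X_mul, map_mul, map_mul, rescale_eSer hq, coe_mul, coe_C,
      rescale_C]
    linear_combination (-PowerSeries.C (-Complex.I) * PowerSeries.C (L 1) * eSer q) * h

theorem momentC_eq (hq0 : q ≠ 0) (hq : ∀ k, k ≠ 0 → q ^ k ≠ 1) (M : ℂ[X] →ₗ[ℂ] ℂ) (h1 : M X = 0)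
    (hM : ∀ m, M (X ^ (m + 2)) = ((q ^ (2 * (m + 1)))⁻¹ - 1) * M (X ^ m)) (r : ℂ[X]) :
    momentC q M r = PowerSeries.C (M 1) * (uSer q * (polyC q r : ℂ[X])) := by
  induction r using poly_induction with
  | h1 => rw [momentC_one hq0 hq M h1 hM, polyC_one, coe_one, mul_one]
  | hadd p s hp hs => rw [momentC_add, hp, hs, polyC_add, coe_add]; ring
  | hC a p hp => rw [momentC_C_mul, hp, polyC_C_mul, coe_mul, coe_C]; ring
  | hX p hp =>
    apply powerSeries_X_mul_cancel
    have h := congr_arg (fun s : ℂ[X] => (s : PowerSeries ℂ)) (X_mul_downC (q := q) (polyC q p))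
    simp only [coe_mul, coe_sub, coe_one, coe_pow, coe_X, coe_scaleArg] at h
    rw [X_mul_momentC hq0 hq, hp, polyC_X_mul, map_mul, map_mul, rescale_uSer hq0 hq, coe_mul, coe_C,
      rescale_C]
    linear_combination (-PowerSeries.C Complex.I * PowerSeries.C (M 1) * uSer q) * h

end PolynomialTransforms

/-! ### Values of one-variable power series -/

section Values

/-- Absolute convergence of a power series at `w`. -/
def ConvAt (φ : PowerSeries ℂ) (w : ℂ) : Prop :=
  Summable fun k => ‖PowerSeries.coeff k φ * w ^ k‖

/-- The value of a power series at `w`. -/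
def pval (φ : PowerSeries ℂ) (w : ℂ) : ℂ := ∑' k, PowerSeries.coeff k φ * w ^ k

/-- Absolute convergence on the whole plane. -/
def Entire (φ : PowerSeries ℂ) : Prop := ∀ w, ConvAt φ w

variable {φ ψ : PowerSeries ℂ} {w : ℂ}

theorem ConvAt.hasSum (h : ConvAt φ w) :
    HasSum (fun k => PowerSeries.coeff k φ * w ^ k) (pval φ w) :=
  (Summable.of_norm h).hasSum

theorem coeff_mul_mul_pow (φ ψ : PowerSeries ℂ) (w : ℂ) (k : ℕ) :
    PowerSeries.coeff k (φ * ψ) * w ^ k = ∑ x ∈ Finset.HasAntidiagonal.antidiagonal k,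
      PowerSeries.coeff x.1 φ * w ^ x.1 * (PowerSeries.coeff x.2 ψ * w ^ x.2) := by
  rw [PowerSeries.coeff_mul, Finset.sum_mul]
  refine Finset.sum_congr rfl fun x hx => ?_
  rw [← Finset.HasAntidiagonal.mem_antidiagonal.1 hx, pow_add, mul_mul_mul_comm]

theorem ConvAt.mul (h1 : ConvAt φ w) (h2 : ConvAt ψ w) : ConvAt (φ * ψ) w := by
  simp only [ConvAt, coeff_mul_mul_pow]
  exact summable_norm_sum_mul_antidiagonal_of_summable_norm
    (f := fun k => PowerSeries.coeff k φ * w ^ k) (g := fun k => PowerSeries.coeff k ψ * w ^ k) h1 h2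

theorem pval_mul (h1 : ConvAt φ w) (h2 : ConvAt ψ w) : pval (φ * ψ) w = pval φ w * pval ψ w := by
  simp only [pval, coeff_mul_mul_pow]
  exact (tsum_mul_tsum_eq_tsum_sum_antidiagonal_of_summable_norm h1 h2).symm

theorem convAt_rescale {a : ℂ} (h : ConvAt φ (a * w)) : ConvAt (PowerSeries.rescale a φ) w := by
  refine (summable_congr fun k => ?_).2 h
  rw [PowerSeries.coeff_rescale, mul_pow]
  congr 1; ring

theorem pval_rescale (a : ℂ) : pval (PowerSeries.rescale a φ) w = pval φ (a * w) := by
  refine tsum_congr fun k => ?_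
  rw [PowerSeries.coeff_rescale, mul_pow]
  ring

theorem Entire.rescale (h : Entire φ) (a : ℂ) : Entire (PowerSeries.rescale a φ) :=
  fun _ => convAt_rescale (h _)

theorem Entire.mul (h1 : Entire φ) (h2 : Entire ψ) : Entire (φ * ψ) := fun w => (h1 w).mul (h2 w)

theorem coeff_coe_mul_pow_eq_zero (p : Polynomial ℂ) (w : ℂ) (k : ℕ)
    (hk : k ∉ Finset.range (p.natDegree + 1)) :
    PowerSeries.coeff k (p : PowerSeries ℂ) * w ^ k = 0 := by
  rw [Polynomial.coeff_coe, Polynomial.coeff_eq_zero_of_natDegree_lt, zero_mul]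
  simpa [Nat.lt_succ_iff] using hk

theorem entire_coe (p : Polynomial ℂ) : Entire (p : PowerSeries ℂ) := fun w =>
  summable_of_ne_finset_zero (s := Finset.range (p.natDegree + 1)) fun k hk => by
    rw [coeff_coe_mul_pow_eq_zero p w k hk, norm_zero]

theorem pval_coe (p : Polynomial ℂ) (w : ℂ) : pval (p : PowerSeries ℂ) w = p.eval w := by
  rw [pval, tsum_eq_sum (s := Finset.range (p.natDegree + 1))
    fun k hk => coeff_coe_mul_pow_eq_zero p w k hk, Polynomial.eval_eq_sum_range]
  simp only [Polynomial.coeff_coe]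

theorem pval_one_add_sq_mul (h : Entire φ) (w : ℂ) :
    pval ((1 + PowerSeries.X ^ 2) * φ) w = (1 + w ^ 2) * pval φ w := by
  have h1 : (1 + PowerSeries.X ^ 2 : PowerSeries ℂ) =
      ((1 + Polynomial.X ^ 2 : Polynomial ℂ) : PowerSeries ℂ) := by simp
  rw [h1, pval_mul (entire_coe _ w) (h w), pval_coe]
  simp

theorem pval_zero (φ : PowerSeries ℂ) : pval φ 0 = PowerSeries.coeff 0 φ := by
  rw [pval, tsum_eq_single 0 fun k hk => by rw [zero_pow hk, mul_zero]]
  simp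

theorem Entire.differentiable (h : Entire φ) : Differentiable ℂ (pval φ) := fun w => by
  have hs := h ((‖w‖ + 1 : ℝ) : ℂ)
  have hd : DifferentiableOn ℂ (pval φ) (Metric.ball 0 (‖w‖ + 1)) := by
    refine Complex.differentiableOn_tsum_of_summable_norm hs (fun k => ?_) Metric.isOpen_ball
      fun k z hz => ?_
    · exact (differentiable_const _).mul (differentiable_id.pow k) |>.differentiableOn
    · rw [norm_mul, norm_mul, norm_pow, norm_pow, Complex.norm_real, Real.norm_of_nonneg (by positivity)]
      have hz : ‖z‖ ≤ ‖w‖ + 1 := by simpa using (Metric.mem_ball.1 hz).le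
      gcongr
  exact hd.differentiableAt (Metric.isOpen_ball.mem_nhds (by simp))

theorem convAt_evenSer {a : ℕ → ℂ} (h : Summable fun k => ‖a k * w ^ (2 * k)‖) :
    ConvAt (evenSer a) w := by
  have hinj : Function.Injective fun k : ℕ => 2 * k := fun a b h => by simpa using h
  refine (hinj.summable_iff fun k hk => ?_).1 (h.congr fun k => ?_)
  · rw [coeff_evenSer_odd _ (by rintro ⟨m, rfl⟩; exact hk ⟨m, (two_mul m)⟩)]; simp
  · simp [coeff_evenSer_two_mul]

theorem pval_evenSer {a : ℕ → ℂ} (w : ℂ) : pval (evenSer a) w = ∑' k, a k * w ^ (2 * k) := by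
  have hinj : Function.Injective fun k : ℕ => 2 * k := fun a b h => by simpa using h
  rw [pval, ← hinj.tsum_eq]
  · simp only [coeff_evenSer_two_mul]
  · intro k hk
    by_contra hk'
    exact hk (by beta_reduce; rw [coeff_evenSer_odd _ (by rintro ⟨m, rfl⟩; exact hk' ⟨m, (two_mul m)⟩)]; simp)

theorem pval_evenSer_neg (a : ℕ → ℂ) (w : ℂ) : pval (evenSer a) (-w) = pval (evenSer a) w := by
  simp only [pval_evenSer, (even_two_mul _).neg_pow]

end Values

/-! ### Convergence, zeros and growth of the q-exponentials -/

section QExponentials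

variable {q : ℝ} (hq0 : 0 < q) (hq1 : q < 1)

include hq0 in
theorem cast_ne_zero : (q : ℂ) ≠ 0 := by exact_mod_cast hq0.ne'

include hq0 hq1

theorem cast_pow_ne_one : ∀ k, k ≠ 0 → (q : ℂ) ^ k ≠ 1 := fun k hk => by
  exact_mod_cast (pow_lt_one₀ hq0.le hq1 hk).ne

theorem norm_one_sub_pow_ge (k : ℕ) : 1 - q ^ 4 ≤ ‖1 - ((q : ℂ) ^ 4) ^ (k + 1)‖ := by
  have h : (1 - ((q : ℂ) ^ 4) ^ (k + 1)) = ((1 - (q ^ 4) ^ (k + 1) : ℝ) : ℂ) := by push_cast; rfl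
  rw [h, Complex.norm_real]
  refine le_trans ?_ (le_abs_self _)
  have : (q ^ 4) ^ (k + 1) ≤ (q ^ 4) ^ 1 :=
    pow_le_pow_of_le_one (by positivity) (pow_le_one₀ hq0.le hq1.le) (by omega)
  linarith [pow_one (q ^ 4)]

theorem one_sub_pow_four_pos : 0 < 1 - q ^ 4 := by
  have := pow_lt_one₀ hq0.le hq1 (show 4 ≠ 0 by decide)
  linarith

/-- The quotient of consecutive terms is q^{4k}w²/(1-q^{4(k+1)}), which tends to 0. -/
theorem entire_vSer : Entire (vSer q) := fun w => by
  have h4 := one_sub_pow_four_pos hq0 hq1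
  have hp := pow_pow_ne_one (cast_pow_ne_one hq0 hq1) (show 4 ≠ 0 by decide)
  refine convAt_evenSer (summable_norm_iff.2 ?_)
  refine summable_of_ratio_norm_eventually_le (r := 1 / 2) (by norm_num) ?_
  have ht : Tendsto (fun k : ℕ => (q ^ 4) ^ k * (‖w‖ ^ 2 / (1 - q ^ 4))) atTop (𝓝 (0 * _)) :=
    (tendsto_pow_atTop_nhds_zero_of_lt_one (by positivity) (by linarith)).mul_const _
  rw [zero_mul] at ht
  filter_upwards [ht.eventually_le_const (show (0 : ℝ) < 1 / 2 by norm_num)] with k hk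
  have h1 : ECoeff ((q : ℂ) ^ 4) (k + 1) * w ^ (2 * (k + 1)) =
      ((q : ℂ) ^ 4) ^ k * w ^ 2 / (1 - ((q : ℂ) ^ 4) ^ (k + 1)) *
        (ECoeff ((q : ℂ) ^ 4) k * w ^ (2 * k)) := by
    have h2 := qPoch_self_ne_zero hp k
    have h3 : 1 - ((q : ℂ) ^ 4) ^ (k + 1) ≠ 0 := sub_ne_zero.2 (hp _ k.succ_ne_zero).symm
    rw [ECoeff, ECoeff, Nat.triangle_succ, qPoch_self_succ, pow_add _ _ k]
    field_simp
    ring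
  rw [h1, norm_mul]
  refine mul_le_mul_of_nonneg_right (le_trans ?_ hk) (norm_nonneg _)
  rw [norm_div, norm_mul, norm_pow, norm_pow, norm_pow, Complex.norm_real,
    Real.norm_of_nonneg hq0.le, mul_div_assoc]
  have := norm_one_sub_pow_ge hq0 hq1 k
  gcongr

theorem entire_uSer : Entire (uSer q) := by
  rw [← rescale_vSer]
  exact (entire_vSer hq0 hq1).rescale _

/-- Only a small disc is needed, to identify the series with 1/v near 0. The bound is chosen to keep
every term ratio at most 1/2. -/
theorem convAt_eSer {w : ℂ} (hw : ‖w‖ ^ 2 ≤ (1 - q ^ 4) / 2) : ConvAt (eSer q) w := by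
  have h4 := one_sub_pow_four_pos hq0 hq1
  have hp := pow_pow_ne_one (cast_pow_ne_one hq0 hq1) (show 4 ≠ 0 by decide)
  refine convAt_evenSer (summable_norm_iff.2 ?_)
  refine summable_of_ratio_norm_eventually_le (r := 1 / 2) (by norm_num) (Eventually.of_forall ?_)
  intro k
  have h1 : (-1) ^ (k + 1) * eCoeff ((q : ℂ) ^ 4) (k + 1) * w ^ (2 * (k + 1)) =
      -w ^ 2 / (1 - ((q : ℂ) ^ 4) ^ (k + 1)) *
        ((-1) ^ k * eCoeff ((q : ℂ) ^ 4) k * w ^ (2 * k)) := by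
    have h2 := qPoch_self_ne_zero hp k
    have h3 : 1 - ((q : ℂ) ^ 4) ^ (k + 1) ≠ 0 := sub_ne_zero.2 (hp _ k.succ_ne_zero).symm
    rw [eCoeff, eCoeff, qPoch_self_succ]
    field_simp
    ring
  rw [h1, norm_mul]
  refine mul_le_mul_of_nonneg_right ?_ (norm_nonneg _)
  have := norm_one_sub_pow_ge hq0 hq1 k
  rw [norm_div, norm_neg, norm_pow, div_le_iff₀ (h4.trans_le this)]
  linarith

theorem pval_vSer_eq (w : ℂ) : pval (vSer q) w = (1 + w ^ 2) * pval (vSer q) ((q : ℂ) ^ 2 * w) := by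
  conv_lhs => rw [vSer_eq (cast_pow_ne_one hq0 hq1)]
  rw [pval_one_add_sq_mul ((entire_vSer hq0 hq1).rescale _), pval_rescale]

theorem pval_uSer_eq (t : ℂ) :
    pval (uSer q) (((q : ℂ) ^ 2)⁻¹ * t) = (1 - t ^ 2) * pval (uSer q) t := by
  have h := cast_ne_zero hq0
  rw [← rescale_vSer, pval_rescale, pval_rescale, pval_vSer_eq hq0 hq1]
  congr 1
  · field_simp
    linear_combination t ^ 2 * Complex.I_sq
  · congr 1
    field_simp

/-- In this strip 1+t² has no zero, so the functional equation would carry a zero at w to all points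
q^{2N}w. These tend to 0, where the value is 1. -/
theorem pval_vSer_ne_zero {w : ℂ} (hw : |w.im| < 1) : pval (vSer q) w ≠ 0 := fun h0 => by
  have h1 : ∀ N : ℕ, pval (vSer q) (((q ^ 2) ^ N : ℝ) * w) = 0 := fun N => by
    induction N with
    | zero => simpa using h0
    | succ N ih =>
      rw [pval_vSer_eq hq0 hq1] at ih
      rcases mul_eq_zero.1 ih with h | h
      · exfalso
        have h2 : ((((q ^ 2) ^ N : ℝ) * w - Complex.I) * (((q ^ 2) ^ N : ℝ) * w + Complex.I)) = 0 := by
          linear_combination h - Complex.I_sq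
        have h3 : |(((q ^ 2) ^ N : ℝ) * w).im| < 1 := by
          rw [Complex.im_ofReal_mul, abs_mul, abs_of_nonneg (by positivity)]
          exact lt_of_le_of_lt (mul_le_of_le_one_left (abs_nonneg _)
            (pow_le_one₀ (by positivity) (pow_le_one₀ hq0.le hq1.le))) hw
        rcases mul_eq_zero.1 h2 with h | h
        · rw [sub_eq_zero.1 h] at h3; simp at h3
        · rw [eq_neg_of_add_eq_zero_left h] at h3; simp at h3
      · rw [← h, ← mul_assoc]; push_cast; ring_nf
  have h2 : Tendsto (fun N : ℕ => pval (vSer q) (((q ^ 2) ^ N : ℝ) * w)) atTop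
      (𝓝 (pval (vSer q) 0)) := by
    refine ((entire_vSer hq0 hq1).differentiable.continuous.tendsto 0).comp ?_
    have h3 : Tendsto (fun N : ℕ => ((q ^ 2) ^ N : ℝ)) atTop (𝓝 0) :=
      tendsto_pow_atTop_nhds_zero_of_lt_one (by positivity)
        (pow_lt_one₀ hq0.le hq1 two_ne_zero)
    simpa using ((Complex.continuous_ofReal.tendsto 0).comp h3).mul_const w
  simp only [h1, pval_zero, constantCoeff_vSer] at h2
  exact zero_ne_one (tendsto_nhds_unique tendsto_const_nhds h2)

theorem pval_eSer {w : ℂ} (hw : ‖w‖ ^ 2 ≤ (1 - q ^ 4) / 2) :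
    pval (eSer q) w = (pval (vSer q) w)⁻¹ := by
  have h := pval_mul (convAt_eSer hq0 hq1 hw) (entire_vSer hq0 hq1 w)
  rw [eSer_mul_vSer (cast_pow_ne_one hq0 hq1), ← Polynomial.coe_one, pval_coe,
    Polynomial.eval_one] at h
  exact eq_inv_of_mul_eq_one_left h.symm

/-- The factor 1-t² vanishes at t = ±1, which gives a zero at ±q⁻²; the functional equation then
carries zeros outwards. They remove every lattice point of modulus greater than 1 from the Jackson
sum. -/
theorem pval_uSer_zero (m : ℕ) (ε : ℤˣ) :
    pval (uSer q) (((ε : ℤ) : ℂ) * ((q : ℂ) ^ (2 * (m + 1)))⁻¹) = 0 := by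
  have hε : (((ε : ℤ) : ℂ)) ^ 2 = 1 := by
    rcases Int.units_eq_one_or ε with rfl | rfl <;> simp
  induction m with
  | zero =>
    rw [mul_comm, zero_add, mul_one, pval_uSer_eq hq0 hq1, hε, sub_self, zero_mul]
  | succ m ih =>
    rw [show 2 * (m + 1 + 1) = 2 + 2 * (m + 1) by ring, pow_add, mul_inv, mul_left_comm,
      pval_uSer_eq hq0 hq1, ih, mul_zero]

/-- On the real line, `E_{q⁴}(t²)` dominates each term of its expansion. -/
theorem norm_pval_vSer_ge (t : ℝ) (k : ℕ) :
    ‖ECoeff ((q : ℂ) ^ 4) k‖ * |t| ^ (2 * k) ≤ ‖pval (vSer q) t‖ := by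
  have h4 : q ^ 4 < 1 := pow_lt_one₀ hq0.le hq1 (by decide)
  let a : ℕ → ℝ := fun k => (q ^ 4) ^ (k * (k - 1) / 2) / ∏ l ∈ Finset.range k, (1 - q ^ 4 * (q ^ 4) ^ l)
  have ha : ∀ k, ECoeff ((q : ℂ) ^ 4) k = (a k : ℂ) := fun k => by
    simp only [a, ECoeff, qPoch]; push_cast; rfl
  -- For real t the series in t² has nonnegative terms, so each single term is a lower bound for its
  -- sum.
  have ha0 : ∀ k, 0 ≤ a k := fun k => by
    refine div_nonneg (by positivity) (Finset.prod_nonneg fun l _ => ?_)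
    rw [← pow_succ']
    exact sub_nonneg.2 (pow_le_one₀ (by positivity) h4.le)
  have hs : Summable fun k => a k * t ^ (2 * k) := by
    have h1 := (entire_vSer hq0 hq1 t).comp_injective
      (show Function.Injective fun k : ℕ => 2 * k from fun a b h => by simpa using h)
    refine h1.congr fun k => ?_
    simp only [Function.comp_apply, vSer, coeff_evenSer_two_mul, ha]
    rw [← Complex.ofReal_pow, ← Complex.ofReal_mul, Complex.norm_real, Real.norm_of_nonneg]
    exact mul_nonneg (ha0 k) ((even_two_mul k).pow_nonneg t)
  have hv : pval (vSer q) t = ((∑' k, a k * t ^ (2 * k) : ℝ) : ℂ) := by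
    rw [vSer, pval_evenSer, Complex.ofReal_tsum]
    refine tsum_congr fun k => ?_
    rw [ha]; push_cast; rfl
  have hnn : ∀ k, 0 ≤ a k * t ^ (2 * k) := fun k =>
    mul_nonneg (ha0 k) ((even_two_mul k).pow_nonneg t)
  rw [hv, Complex.norm_real, Real.norm_of_nonneg (tsum_nonneg hnn), ha, Complex.norm_real,
    Real.norm_of_nonneg (ha0 k), (even_two_mul k).pow_abs]
  exact hs.le_tsum k fun j _ => hnn j

end QExponentials

/-! ### One-variable Jackson integrals -/

section Jackson

open Polynomial

theorem norm_units_cast (ε : ℤˣ) : ‖(((ε : ℤ) : ℂ))‖ = 1 := by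
  rcases Int.units_eq_one_or ε with rfl | rfl <;> simp

/-- Summand of the Jackson `q²`-integral of `H` with bounds `-ω · ∞` and `ω · ∞`. -/
def jackson (q ω : ℂ) (H : ℂ → ℂ) (x : ℤ × ℤˣ) : ℂ :=
  (1 - q ^ 2) * (q ^ (2 * x.1) * ω) * H (((x.2 : ℤ) : ℂ) * q ^ (2 * x.1) * ω)

theorem jackson_comp_mul (q ω : ℂ) (H : ℂ → ℂ) {a : ℂ} (ha : a ≠ 0) (x : ℤ × ℤˣ) :
    jackson q ω (fun t => H (a * t)) x = a⁻¹ * jackson q (a * ω) H x := by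
  simp only [jackson]
  rw [show a * (((x.2 : ℤ) : ℂ) * q ^ (2 * x.1) * ω) = ((x.2 : ℤ) : ℂ) * q ^ (2 * x.1) * (a * ω) by ring]
  field_simp

/-- A factor q^{2k} in the generator only reindexes the lattice. This is why the parity of exponents
of q is all that matters later. -/
theorem jackson_shift {q : ℂ} (hq : q ≠ 0) (ω : ℂ) (H : ℂ → ℂ) (k : ℤ) (x : ℤ × ℤˣ) :
    jackson q (q ^ (2 * k) * ω) H x = jackson q ω H (x.1 + k, x.2) := by
  simp only [jackson]
  rw [mul_add, zpow_add₀ hq]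
  ring_nf

theorem summable_jackson_shift {q : ℂ} (hq : q ≠ 0) (ω : ℂ) (H : ℂ → ℂ) (k : ℤ) :
    Summable (jackson q (q ^ (2 * k) * ω) H) ↔ Summable (jackson q ω H) := by
  rw [← ((Equiv.addRight k).prodCongr (Equiv.refl ℤˣ)).summable_iff (f := jackson q ω H)]
  exact summable_congr fun x => jackson_shift hq ω H k x

theorem tsum_jackson_shift {q : ℂ} (hq : q ≠ 0) (ω : ℂ) (H : ℂ → ℂ) (k : ℤ) :
    ∑' x, jackson q (q ^ (2 * k) * ω) H x = ∑' x, jackson q ω H x := by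
  rw [← ((Equiv.addRight k).prodCongr (Equiv.refl ℤˣ)).tsum_eq (jackson q ω H)]
  exact tsum_congr fun x => jackson_shift hq ω H k x

theorem tsum_norm_jackson_shift {q : ℂ} (hq : q ≠ 0) (ω : ℂ) (H : ℂ → ℂ) (k : ℤ) :
    ∑' x, ‖jackson q (q ^ (2 * k) * ω) H x‖ = ∑' x, ‖jackson q ω H x‖ := by
  rw [← ((Equiv.addRight k).prodCongr (Equiv.refl ℤˣ)).tsum_eq fun x => ‖jackson q ω H x‖]
  exact tsum_congr fun x => by rw [jackson_shift hq ω H k x]; rfl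

/-- Exchanging the two signs ε negates every summand, so the sum equals its own negative; this needs
no summability. -/
theorem tsum_jackson_odd (q ω : ℂ) {H : ℂ → ℂ} (hH : ∀ t, H (-t) = -H t) :
    ∑' x, jackson q ω H x = 0 := by
  have h := ((Equiv.refl ℤ).prodCongr (Equiv.neg ℤˣ)).tsum_eq (jackson q ω H)
  have h1 : ∀ x : ℤ × ℤˣ, jackson q ω H (((Equiv.refl ℤ).prodCongr (Equiv.neg ℤˣ)) x) =
      -jackson q ω H x := fun x => by
    simp only [jackson, Equiv.prodCongr_apply, Prod.map, Equiv.refl_apply, Equiv.neg_apply,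
      Units.val_neg, Int.cast_neg, neg_mul, hH, mul_neg]
  simp only [h1, tsum_neg] at h
  linear_combination (-1 / 2 : ℂ) * h

/-- Absolute convergence of a Jackson sum from geometric bounds at `0` and at infinity. -/
theorem summable_of_geometric_bound {f : ℤ × ℤˣ → ℂ} {r C : ℝ} (hr0 : 0 ≤ r) (hr1 : r < 1)
    (h1 : ∀ (k : ℕ) ε, ‖f (k, ε)‖ ≤ C * r ^ k) (h2 : ∀ (k : ℕ) ε, ‖f (-k, ε)‖ ≤ C * r ^ k) :
    Summable f := by
  have hg : Summable fun k : ℕ => C * r ^ k := (summable_geometric_of_lt_one hr0 hr1).mul_left C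
  have h3 : ∀ ε, Summable fun k : ℤ => ‖f (k, ε)‖ := fun ε =>
    Summable.of_nat_of_neg (Summable.of_nonneg_of_le (fun _ => norm_nonneg _) (fun k => h1 k ε) hg)
      (Summable.of_nonneg_of_le (fun _ => norm_nonneg _) (fun k => h2 k ε) hg)
  refine Summable.of_norm ((Equiv.prodComm ℤˣ ℤ).summable_iff.1 ?_)
  refine (summable_prod_of_nonneg fun _ => norm_nonneg _).2 ⟨h3, Summable.of_finite⟩

/-- The Jackson integral of `P(t) G(t)` as a linear functional of the polynomial `P`. -/
def jacksonFun (q ω : ℂ) (G : ℂ → ℂ)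
    (hs : ∀ P : ℂ[X], Summable (jackson q ω fun t => P.eval t * G t)) : ℂ[X] →ₗ[ℂ] ℂ where
  toFun P := ∑' x, jackson q ω (fun t => P.eval t * G t) x
  map_add' P R := by
    rw [← (hs P).tsum_add (hs R)]
    exact tsum_congr fun x => by simp only [jackson, eval_add]; ring
  map_smul' a P := by
    rw [smul_eq_mul, ← tsum_mul_left]
    exact tsum_congr fun x => by
      simp only [jackson, eval_smul, smul_eq_mul, RingHom.id_apply]; ring

theorem jacksonFun_apply {q ω : ℂ} {G : ℂ → ℂ}
    (hs : ∀ P : ℂ[X], Summable (jackson q ω fun t => P.eval t * G t)) (P : ℂ[X]) :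
    jacksonFun q ω G hs P = ∑' x, jackson q ω (fun t => P.eval t * G t) x := rfl

theorem HasParity.eval_neg {s : ℤˣ} {p : ℂ[X]} (hp : HasParity s p) (t : ℂ) :
    p.eval (-t) = ((s : ℤ) : ℂ) * p.eval t := by
  have := congr_arg (eval t) hp
  simpa using this

theorem jacksonFun_odd {q ω : ℂ} {G : ℂ → ℂ}
    (hs : ∀ P : ℂ[X], Summable (jackson q ω fun t => P.eval t * G t)) (hG : ∀ t, G (-t) = G t)
    {P : ℂ[X]} (hP : HasParity (-1) P) : jacksonFun q ω G hs P = 0 := by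
  rw [jacksonFun_apply]
  refine tsum_jackson_odd q ω fun t => ?_
  rw [hP.eval_neg, hG]
  simp

theorem hasParity_X : HasParity (-1) X := by simp [HasParity]

theorem hasParity_one : HasParity 1 1 := by simp [HasParity]

/-- The moment recursion implied by `G(q⁻² t) = (1 - t²) G(t)`. -/
theorem jacksonFun_recursion_C {q ω : ℂ} (hq : q ≠ 0) {G : ℂ → ℂ}
    (hs : ∀ P : ℂ[X], Summable (jackson q ω fun t => P.eval t * G t))
    (hG : ∀ t, G ((q ^ 2)⁻¹ * t) = (1 - t ^ 2) * G t) (m : ℕ) :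
    jacksonFun q ω G hs (X ^ (m + 2)) =
      (1 - q ^ (2 * (m + 1))) * jacksonFun q ω G hs (X ^ m) := by
  have h2 : q ^ 2 ≠ 0 := pow_ne_zero 2 hq
  -- ∫ t^m(1-t²)G(t) is ∫ t^m G(q⁻²t). The dilation by q⁻² yields q^{2m} from the monomial and q²
  -- from the measure.
  have h1 : jacksonFun q ω G hs (X ^ m - X ^ (m + 2)) =
      q ^ (2 * (m + 1)) * jacksonFun q ω G hs (X ^ m) := by
    rw [jacksonFun_apply, jacksonFun_apply,
      ← tsum_jackson_shift hq ω (fun t => eval t (X ^ m) * G t) (-1), ← tsum_mul_left]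
    refine tsum_congr fun x => ?_
    rw [show q ^ (2 * -1 : ℤ) = (q ^ 2)⁻¹ by rw [mul_neg, mul_one, zpow_neg]; norm_cast,
      show q ^ (2 * (m + 1)) = q ^ (2 * m) * ((q ^ 2)⁻¹)⁻¹ by rw [inv_inv]; ring, mul_assoc,
      ← jackson_comp_mul q ω _ (inv_ne_zero h2)]
    simp only [jackson, hG, eval_sub, eval_pow, eval_X, mul_pow, inv_pow, ← pow_mul]
    have h3 := pow_ne_zero (2 * m) hq
    field_simp
    ring_nf
  rw [map_sub] at h1
  linear_combination -h1

/-- The moment recursion implied by `G(q² t) = (1 + t²) G(t)`. -/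
theorem jacksonFun_recursion_V {q ω : ℂ} (hq : q ≠ 0) {G : ℂ → ℂ}
    (hs : ∀ P : ℂ[X], Summable (jackson q ω fun t => P.eval t * G t))
    (hG : ∀ x : ℤ × ℤˣ, G (q ^ 2 * (((x.2 : ℤ) : ℂ) * q ^ (2 * x.1) * ω)) =
      (1 + (((x.2 : ℤ) : ℂ) * q ^ (2 * x.1) * ω) ^ 2) * G (((x.2 : ℤ) : ℂ) * q ^ (2 * x.1) * ω))
    (m : ℕ) :
    jacksonFun q ω G hs (X ^ (m + 2)) =
      ((q ^ (2 * (m + 1)))⁻¹ - 1) * jacksonFun q ω G hs (X ^ m) := by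
  have h2 : q ^ 2 ≠ 0 := pow_ne_zero 2 hq
  -- Same dilation argument with q²; the equation for G is required only at lattice points because a
  -- reciprocal with value 0 at poles need not satisfy it everywhere.
  have h1 : jacksonFun q ω G hs (X ^ m + X ^ (m + 2)) =
      (q ^ (2 * (m + 1)))⁻¹ * jacksonFun q ω G hs (X ^ m) := by
    rw [jacksonFun_apply, jacksonFun_apply,
      ← tsum_jackson_shift hq ω (fun t => eval t (X ^ m) * G t) 1, ← tsum_mul_left]
    refine tsum_congr fun x => ?_
    rw [show q ^ (2 * 1 : ℤ) = q ^ 2 by norm_cast,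
      show (q ^ (2 * (m + 1)))⁻¹ = (q ^ (2 * m))⁻¹ * (q ^ 2)⁻¹ by rw [← mul_inv]; ring, mul_assoc,
      ← jackson_comp_mul q ω _ h2]
    simp only [jackson, hG, eval_add, eval_pow, eval_X, mul_pow, ← pow_mul]
    have h3 := pow_ne_zero (2 * m) hq
    field_simp
    ring_nf
  rw [map_add] at h1
  linear_combination h1

variable {q : ℝ} (hq0 : 0 < q) (hq1 : q < 1)

theorem norm_lattice_point (hq0 : 0 < q) (ω : ℂ) (x : ℤ × ℤˣ) :
    ‖((x.2 : ℤ) : ℂ) * (q : ℂ) ^ (2 * x.1) * ω‖ = (q ^ 2) ^ x.1 * ‖ω‖ := by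
  rw [norm_mul, norm_mul, norm_units_cast, norm_zpow, Complex.norm_real,
    Real.norm_of_nonneg hq0.le, one_mul, zpow_mul]
  norm_cast

theorem norm_jackson_eq (hq0 : 0 < q) (ω : ℂ) (H : ℂ → ℂ) (x : ℤ × ℤˣ) :
    ‖jackson q ω H x‖ = ‖1 - (q : ℂ) ^ 2‖ * ((q ^ 2) ^ x.1 * ‖ω‖) *
      ‖H (((x.2 : ℤ) : ℂ) * (q : ℂ) ^ (2 * x.1) * ω)‖ := by
  rw [jackson, norm_mul, norm_mul, ← norm_lattice_point hq0 ω x, mul_assoc ((x.2 : ℤ) : ℂ),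
    norm_mul ((x.2 : ℤ) : ℂ), norm_units_cast, one_mul]

include hq0 hq1

/-- A Jackson sum converges absolutely if the integrand is bounded near `0` and decays like `t⁻²`
on the lattice. -/
theorem summable_jackson_of_bounds {ω : ℂ} (hω : ω ≠ 0) {H : ℂ → ℂ} {C : ℝ}
    (h1 : ∀ (k : ℕ) (ε : ℤˣ), ‖H (((ε : ℤ) : ℂ) * (q : ℂ) ^ (2 * (k : ℤ)) * ω)‖ ≤ C)
    (h2 : ∀ (k : ℕ) (ε : ℤˣ), ‖H (((ε : ℤ) : ℂ) * (q : ℂ) ^ (2 * (-k : ℤ)) * ω)‖ ≤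
      C * (((q ^ 2) ^ (-k : ℤ) * ‖ω‖) ^ 2)⁻¹) :
    Summable (jackson q ω H) := by
  have hω' : 0 < ‖ω‖ := norm_pos_iff.2 hω
  have hC : 0 ≤ C := (norm_nonneg _).trans (h1 0 1)
  -- The measure at a lattice point is proportional to its modulus: ‖ω‖ comes from points near 0,
  -- and ‖ω‖⁻¹ from points near infinity, where the measure meets the bound t⁻².
  set D := ‖1 - (q : ℂ) ^ 2‖ * C * (‖ω‖ + ‖ω‖⁻¹) with hD
  have hn : 0 ≤ ‖1 - (q : ℂ) ^ 2‖ := norm_nonneg _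
  refine summable_of_geometric_bound (r := q ^ 2) (C := D) (by positivity)
    (pow_lt_one₀ hq0.le hq1 two_ne_zero) (fun k ε => ?_) fun k ε => ?_
  · rw [norm_jackson_eq hq0]
    calc _ ≤ ‖1 - (q : ℂ) ^ 2‖ * ((q ^ 2) ^ (k : ℤ) * ‖ω‖) * C := by gcongr; exact h1 k ε
      _ = ‖1 - (q : ℂ) ^ 2‖ * C * ‖ω‖ * (q ^ 2) ^ k := by rw [zpow_natCast]; ring
      _ ≤ D * (q ^ 2) ^ k := by
        rw [hD]; gcongr; linarith [inv_pos.2 hω']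
  · rw [norm_jackson_eq hq0]
    have hx : 0 < (q ^ 2) ^ (-k : ℤ) := by positivity
    calc _ ≤ ‖1 - (q : ℂ) ^ 2‖ * ((q ^ 2) ^ (-k : ℤ) * ‖ω‖) *
          (C * (((q ^ 2) ^ (-k : ℤ) * ‖ω‖) ^ 2)⁻¹) := by gcongr; exact h2 k ε
      _ = ‖1 - (q : ℂ) ^ 2‖ * C * ‖ω‖⁻¹ * ((q ^ 2) ^ (-k : ℤ))⁻¹ := by field_simp
      _ = ‖1 - (q : ℂ) ^ 2‖ * C * ‖ω‖⁻¹ * (q ^ 2) ^ k := by rw [zpow_neg, inv_inv, zpow_natCast]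
      _ ≤ D * (q ^ 2) ^ k := by
        rw [hD]; gcongr; linarith

/-- Points of the lattice in the unit disc are controlled by compactness; at all others `uSer`
vanishes. The generator 1 is essential for this second half. -/
theorem summable_jackson_uSer (P : ℂ[X]) :
    Summable (jackson q 1 fun t => P.eval t * pval (uSer q) t) := by
  have hc : Continuous fun t => P.eval t * pval (uSer q) t :=
    P.continuous.mul (entire_uSer hq0 hq1).differentiable.continuous
  obtain ⟨C, hC⟩ := (isCompact_closedBall (0 : ℂ) 1).exists_bound_of_continuousOn hc.continuousOn
  have hC0 : 0 ≤ C := (norm_nonneg _).trans (hC 0 (by simp))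
  have hb : ∀ (k : ℕ) (ε : ℤˣ), ((ε : ℤ) : ℂ) * (q : ℂ) ^ (2 * (k : ℤ)) * 1 ∈
      Metric.closedBall (0 : ℂ) 1 := fun k ε => by
    rw [mem_closedBall_zero_iff, norm_lattice_point hq0 1 ((k : ℤ), ε), norm_one, mul_one,
      zpow_natCast]
    exact pow_le_one₀ (by positivity) (pow_le_one₀ hq0.le hq1.le)
  refine summable_jackson_of_bounds hq0 hq1 one_ne_zero (C := C) (fun k ε => hC _ (hb k ε)) ?_
  intro k ε
  match k with
  | 0 => simpa using hC _ (hb 0 ε)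
  | k + 1 =>
    have h : ((ε : ℤ) : ℂ) * (q : ℂ) ^ (2 * (-((k + 1 : ℕ) : ℤ))) * 1 =
        ((ε : ℤ) : ℂ) * ((q : ℂ) ^ (2 * (k + 1)))⁻¹ := by
      rw [mul_one, mul_neg, zpow_neg]; norm_cast
    rw [h, pval_uSer_zero hq0 hq1, mul_zero, norm_zero]
    positivity

/-- Dividing the termwise lower bound for v by v bounds each even power of t times 1/v. -/
theorem exists_pow_bound (N : ℕ) : ∃ C : ℝ, ∀ t : ℝ, |t| ^ N * ‖(pval (vSer q) t)⁻¹‖ ≤ C := by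
  have hp := pow_pow_ne_one (cast_pow_ne_one hq0 hq1) (show 4 ≠ 0 by decide)
  have ha : ∀ k, 0 < ‖ECoeff ((q : ℂ) ^ 4) k‖ := fun k => norm_pos_iff.2
    (div_ne_zero (pow_ne_zero _ (pow_ne_zero _ (cast_ne_zero hq0))) (qPoch_self_ne_zero hp k))
  have h1 : ∀ (k : ℕ) (t : ℝ), |t| ^ (2 * k) * ‖(pval (vSer q) t)⁻¹‖ ≤
      ‖ECoeff ((q : ℂ) ^ 4) k‖⁻¹ := fun k t => by
    have hv : 0 < ‖pval (vSer q) t‖ := norm_pos_iff.2 (pval_vSer_ne_zero hq0 hq1 (by simp))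
    have := norm_pval_vSer_ge hq0 hq1 t k
    rw [norm_inv, ← div_eq_mul_inv, div_le_iff₀ hv, inv_mul_eq_div, le_div_iff₀ (ha k)]
    linarith
  refine ⟨‖ECoeff ((q : ℂ) ^ 4) 0‖⁻¹ + ‖ECoeff ((q : ℂ) ^ 4) N‖⁻¹, fun t => ?_⟩
  -- Odd N is handled by comparison with the even exponents 0 and 2N, according to whether |t| is at
  -- most or at least 1.
  have h0 : |t| ^ N ≤ |t| ^ (2 * 0) + |t| ^ (2 * N) := by
    rcases le_total |t| 1 with h | h
    · have := pow_le_one₀ (n := N) (abs_nonneg t) h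
      have := pow_nonneg (abs_nonneg t) (2 * N)
      simp only [mul_zero, pow_zero]; linarith
    · have := pow_le_pow_right₀ h (show N ≤ 2 * N by omega)
      simp only [mul_zero, pow_zero]; linarith
  calc _ ≤ (|t| ^ (2 * 0) + |t| ^ (2 * N)) * ‖(pval (vSer q) t)⁻¹‖ := by gcongr
    _ ≤ _ := by rw [add_mul]; exact add_le_add (h1 0 t) (h1 N t)

theorem exists_poly_bound (P : ℂ[X]) (N : ℕ) :
    ∃ C : ℝ, ∀ t : ℝ, |t| ^ N * ‖P.eval (t : ℂ) * (pval (vSer q) t)⁻¹‖ ≤ C := by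
  induction P using Polynomial.induction_on' with
  | add p s hp hs =>
    obtain ⟨C, hC⟩ := hp
    obtain ⟨D, hD⟩ := hs
    refine ⟨C + D, fun t => (le_trans ?_ (add_le_add (hC t) (hD t)))⟩
    rw [eval_add, add_mul, ← mul_add]
    gcongr
    exact norm_add_le _ _
  | monomial m a =>
    obtain ⟨C, hC⟩ := exists_pow_bound hq0 hq1 (N + m)
    refine ⟨‖a‖ * C, fun t => ?_⟩
    have := mul_le_mul_of_nonneg_left (hC t) (norm_nonneg a)
    rw [eval_monomial, norm_mul, norm_mul, norm_pow, Complex.norm_real, Real.norm_eq_abs]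
    calc _ = _ := by ring
      _ ≤ _ := this

theorem summable_jackson_vSer {ω : ℝ} (hω : ω ≠ 0) (P : ℂ[X]) :
    Summable (jackson q ω fun t => P.eval t * (pval (vSer q) t)⁻¹) := by
  obtain ⟨C0, h0⟩ := exists_poly_bound hq0 hq1 P 0
  obtain ⟨C2, h2⟩ := exists_poly_bound hq0 hq1 P 2
  have hr : ∀ (x : ℤ × ℤˣ), ((x.2 : ℤ) : ℂ) * (q : ℂ) ^ (2 * x.1) * ω =
      ((((x.2 : ℤ) : ℝ) * q ^ (2 * x.1) * ω : ℝ) : ℂ) := fun x => by push_cast; rfl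
  refine summable_jackson_of_bounds hq0 hq1 (by exact_mod_cast hω) (C := max C0 C2)
    (fun k ε => ?_) fun k ε => ?_
  · rw [hr ((k : ℤ), ε)]
    refine le_trans ?_ (le_max_left C0 C2)
    simpa only [pow_zero, one_mul] using h0 (((ε : ℤ) : ℝ) * q ^ (2 * (k : ℤ)) * ω)
  · have hpos : 0 < ((q ^ 2) ^ (-k : ℤ) * ‖(ω : ℂ)‖) ^ 2 := by
      have : 0 < ‖(ω : ℂ)‖ := norm_pos_iff.2 (by exact_mod_cast hω)
      positivity
    rw [← div_eq_mul_inv (max C0 C2), le_div_iff₀ hpos, mul_comm, ← norm_lattice_point hq0 ω (-(k : ℤ), ε),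
      hr (-(k : ℤ), ε), Complex.norm_real, Real.norm_eq_abs]
    exact (h2 _).trans (le_max_right C0 C2)

/-- The functional `P ↦ ∫ P(t) E_{q⁴}(-q⁴ t²)` over the lattice generated by `1`. -/
def covFun : ℂ[X] →ₗ[ℂ] ℂ := jacksonFun q 1 (pval (uSer q)) (summable_jackson_uSer hq0 hq1)

/-- The functional `P ↦ ∫ P(t) e_{q⁴}(-t²)` over the lattice generated by `ω`. -/
def vecFun {ω : ℝ} (hω : ω ≠ 0) : ℂ[X] →ₗ[ℂ] ℂ :=
  jacksonFun q ω (fun t => (pval (vSer q) t)⁻¹) (summable_jackson_vSer hq0 hq1 hω)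

theorem covFun_odd {P : ℂ[X]} (hP : HasParity (-1) P) : covFun hq0 hq1 P = 0 :=
  jacksonFun_odd _ (fun t => pval_evenSer_neg _ t) hP

theorem vecFun_odd {ω : ℝ} (hω : ω ≠ 0) {P : ℂ[X]} (hP : HasParity (-1) P) :
    vecFun hq0 hq1 hω P = 0 :=
  jacksonFun_odd _ (fun t => by rw [vSer, pval_evenSer_neg]) hP

/-- The one-variable transform of `p(x) E_{q⁴}(-q⁴ x²)`. -/
theorem momentV_covFun (p : ℂ[X]) :
    momentV q (covFun hq0 hq1) p =
      PowerSeries.C (covFun hq0 hq1 1) * ((polyV (q : ℂ) p : ℂ[X]) * eSer q) :=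
  momentV_eq (cast_pow_ne_one hq0 hq1) _ (covFun_odd hq0 hq1 hasParity_X)
    (jacksonFun_recursion_C (cast_ne_zero hq0) _ (pval_uSer_eq hq0 hq1)) p

/-- The one-variable inverse transform of `r(∂) e_{q⁴}(-∂²)`. -/
theorem momentC_vecFun {ω : ℝ} (hω : ω ≠ 0) (r : ℂ[X]) :
    momentC q (vecFun hq0 hq1 hω) r =
      PowerSeries.C (vecFun hq0 hq1 hω 1) * (uSer q * (polyC (q : ℂ) r : ℂ[X])) := by
  refine momentC_eq (cast_ne_zero hq0) (cast_pow_ne_one hq0 hq1) _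
    (vecFun_odd hq0 hq1 hω hasParity_X)
    (jacksonFun_recursion_V (cast_ne_zero hq0) _ fun x => ?_) r
  -- Lattice points are real, hence v is nonzero there and its functional equation may be inverted.
  have hr : ((x.2 : ℤ) : ℂ) * (q : ℂ) ^ (2 * x.1) * ω =
      ((((x.2 : ℤ) : ℝ) * q ^ (2 * x.1) * ω : ℝ) : ℂ) := by push_cast; rfl
  have h := pval_vSer_ne_zero hq0 hq1 (w := ((x.2 : ℤ) : ℂ) * (q : ℂ) ^ (2 * x.1) * ω)
    (by rw [hr, Complex.ofReal_im]; simp)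
  rw [pval_vSer_eq hq0 hq1] at h
  rw [pval_vSer_eq hq0 hq1 (((x.2 : ℤ) : ℂ) * (q : ℂ) ^ (2 * x.1) * ω), mul_inv,
    mul_inv_cancel_left₀ (left_ne_zero_of_mul h)]

theorem vecFun_shift {ω ω' : ℝ} (hω : ω ≠ 0) (hω' : ω' ≠ 0) {k : ℤ} (h : ω' = q ^ (2 * k) * ω) :
    vecFun hq0 hq1 hω' = vecFun hq0 hq1 hω := by
  refine LinearMap.ext fun P => ?_
  subst h
  simp only [vecFun, jacksonFun_apply]
  rw [← tsum_jackson_shift (cast_ne_zero hq0) ω _ k]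
  push_cast
  rfl

end Jackson

/-! ### Products of one-variable series in the quantum space algebras -/

section Products

variable {n : ℕ} {q : ℝ} {w : Fin n → Fin n → ℕ}

theorem twist_single_left (j : Fin n) (a : ℕ) (F : Fin n →₀ ℕ) :
    twist w (Finsupp.single j a) F = a * ∑ i, w j i * F i := by
  unfold twist
  rw [Finset.sum_eq_single j (fun b _ hb => by simp [Finsupp.single_eq_of_ne hb]) (by simp),
    Finset.mul_sum]
  exact Finset.sum_congr rfl fun i _ => by rw [Finsupp.single_eq_same]; ring

theorem mono_mul_apply (A : Fin n →₀ ℕ) (g : QSeries n q w) (G : Fin n →₀ ℕ) :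
    (mono A * g : QSeries n q w) G = if A ≤ G then (q : ℂ) ^ twist w A (G - A) * g (G - A) else 0 := by
  rw [mul_apply]
  split_ifs with h
  · rw [Finset.sum_eq_single (A, G - A)]
    · simp [mono]
    · rintro ⟨a, b⟩ hab hne
      rw [Finset.HasAntidiagonal.mem_antidiagonal] at hab
      have : a ≠ A := by
        rintro rfl
        exact hne (by rw [← hab]; simp)
      simp [mono, this]
    · intro h'
      exact absurd (Finset.HasAntidiagonal.mem_antidiagonal.2 (add_tsub_cancel_of_le h)) h'
  · refine Finset.sum_eq_zero fun x hx => ?_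
    rw [Finset.HasAntidiagonal.mem_antidiagonal] at hx
    have : x.1 ≠ A := by
      rintro rfl
      exact h (hx ▸ le_self_add)
    simp [mono, this]

theorem mul_mono_apply (A : Fin n →₀ ℕ) (g : QSeries n q w) (G : Fin n →₀ ℕ) :
    (g * mono A : QSeries n q w) G = if A ≤ G then (q : ℂ) ^ twist w (G - A) A * g (G - A) else 0 := by
  rw [mul_apply]
  split_ifs with h
  · rw [Finset.sum_eq_single (G - A, A)]
    · simp [mono]
    · rintro ⟨a, b⟩ hab hne
      rw [Finset.HasAntidiagonal.mem_antidiagonal] at hab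
      have : b ≠ A := by
        rintro rfl
        exact hne (by rw [← hab]; simp)
      simp [mono, this]
    · intro h'
      exact absurd (Finset.HasAntidiagonal.mem_antidiagonal.2 (tsub_add_cancel_of_le h)) h'
  · refine Finset.sum_eq_zero fun x hx => ?_
    rw [Finset.HasAntidiagonal.mem_antidiagonal] at hx
    have : x.2 ≠ A := by
      rintro rfl
      exact h (hx ▸ le_add_self)
    simp [mono, this]

/-- The power series `φ(x_j)`. -/
def emb (j : Fin n) (φ : PowerSeries ℂ) : QSeries n q w :=
  fun E => if E = Finsupp.single j (E j) then PowerSeries.coeff (E j) φ else 0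

theorem emb_mul (j : Fin n) (hw : w j j = 0) (φ ψ : PowerSeries ℂ) :
    (emb j (φ * ψ) : QSeries n q w) = emb j φ * emb j ψ := by
  funext G
  rw [mul_apply, emb]
  split_ifs with h
  · rw [h, Finsupp.antidiagonal_single, Finset.sum_map, Finsupp.single_eq_same,
      PowerSeries.coeff_mul]
    refine Finset.sum_congr rfl fun x _ => ?_
    change _ = (q : ℂ) ^ twist w (Finsupp.single j x.1) (Finsupp.single j x.2) *
      (emb j φ (Finsupp.single j x.1) * emb j ψ (Finsupp.single j x.2))
    simp only [emb, Finsupp.single_eq_same, if_true, twist_single_left]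
    rw [Finset.sum_eq_single j (fun b _ hb => by simp [Finsupp.single_eq_of_ne hb]) (by simp), hw]
    simp
  · refine (Finset.sum_eq_zero fun x hx => ?_).symm
    rw [Finset.HasAntidiagonal.mem_antidiagonal] at hx
    by_cases h1 : x.1 = Finsupp.single j (x.1 j)
    · by_cases h2 : x.2 = Finsupp.single j (x.2 j)
      · refine absurd ?_ h
        rw [← hx, Finsupp.add_apply, Finsupp.single_add, ← h1, ← h2]
      · simp [emb, h2]
    · simp [emb, h1]

theorem emb_one (j : Fin n) : (emb j 1 : QSeries n q w) = 1 := by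
  funext G
  rw [one_apply, emb, PowerSeries.coeff_one]
  by_cases h : G = 0
  · simp [h]
  · rw [if_neg h]
    split_ifs with h1 h2
    · exact absurd (by rw [h1, h2, Finsupp.single_zero]) h
    · rfl
    · rfl

theorem emb_pow (j : Fin n) (hw : w j j = 0) (φ : PowerSeries ℂ) (k : ℕ) :
    (emb j (φ ^ k) : QSeries n q w) = emb j φ ^ k := by
  induction k with
  | zero => rw [pow_zero, pow_zero, emb_one]
  | succ k ih => rw [pow_succ, pow_succ, emb_mul j hw, ih]

theorem emb_add (j : Fin n) (φ ψ : PowerSeries ℂ) :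
    (emb j (φ + ψ) : QSeries n q w) = emb j φ + emb j ψ := by
  funext G
  rw [add_apply]
  simp only [emb]
  split_ifs <;> simp

theorem emb_C_mul (j : Fin n) (a : ℂ) (φ : PowerSeries ℂ) :
    (emb j (PowerSeries.C a * φ) : QSeries n q w) = a • emb j φ := by
  funext G
  rw [smul_apply]
  simp only [emb, PowerSeries.coeff_C_mul]
  split_ifs <;> simp

theorem emb_X (j : Fin n) : (emb j PowerSeries.X : QSeries n q w) = gen j := by
  funext G
  simp only [emb, gen, mono, PowerSeries.coeff_X]
  by_cases h : G = Finsupp.single j 1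
  · simp [h]
  · rw [if_neg h]
    split_ifs with h1 h2
    · exact absurd (by rw [h1, h2]) h
    · rfl
    · rfl

theorem aeval_gen (j : Fin n) (hw : w j j = 0) (p : Polynomial ℂ) :
    Polynomial.aeval (gen j : QSeries n q w) p = emb j (p : PowerSeries ℂ) := by
  induction p using poly_induction with
  | h1 => rw [map_one, Polynomial.coe_one, emb_one]
  | hadd p s hp hs => rw [map_add, hp, hs, Polynomial.coe_add, emb_add]
  | hC a p hp =>
    rw [← Polynomial.smul_eq_C_mul, map_smul, hp, Polynomial.smul_eq_C_mul, Polynomial.coe_mul,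
      Polynomial.coe_C, emb_C_mul]
  | hX p hp =>
    rw [map_mul, Polynomial.aeval_X, hp, Polynomial.coe_mul, Polynomial.coe_X, emb_mul j hw, emb_X]

theorem subst_smul_gen_sq (j : Fin n) (hw : w j j = 0) (a : ℕ → ℂ) (c : ℂ) :
    subst a (c • gen j ^ 2 : QSeries n q w) = emb j (evenSer fun k => c ^ k * a k) := by
  have h1 : ∀ k, (c • gen j ^ 2 : QSeries n q w) ^ k =
      emb j (PowerSeries.C (c ^ k) * PowerSeries.X ^ (2 * k)) := fun k => by
    rw [emb_C_mul, emb_pow j hw, emb_X, smul_pow, pow_mul]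
  funext E
  simp only [subst, h1]
  by_cases h : E = Finsupp.single j (E j)
  · simp only [emb, if_pos h, PowerSeries.coeff_C_mul, PowerSeries.coeff_X_pow]
    have hd : deg E = E j := by
      rw [deg, Finset.sum_eq_single j _ (by simp)]
      intro b _ hb
      rw [h, Finsupp.single_eq_of_ne hb]
    rw [hd]
    rcases Nat.even_or_odd' (E j) with ⟨m, hm | hm⟩
    · rw [hm, coeff_evenSer_two_mul, Finset.sum_eq_single m]
      · simp [mul_comm]
      · intro b _ hb
        rw [if_neg (by omega), mul_zero, mul_zero]
      · intro hm'
        exact absurd (Finset.mem_range.2 (by omega)) hm'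
    · rw [hm, coeff_evenSer_odd _ (by simp)]
      exact Finset.sum_eq_zero fun k _ => by rw [if_neg (by omega), mul_zero, mul_zero]
  · simp only [emb, if_neg h, mul_zero, Finset.sum_const_zero]

/-- The exponent of `q` created by reordering the product of the `x_i ^ e_i` with decreasing
indices. -/
def cross (w : Fin n → Fin n → ℕ) (G : Fin n →₀ ℕ) : ℕ :=
  ∑ i, ∑ j, if j < i then w i j * (G i * G j) else 0

/-- Splits off the largest index j: this is the cost of moving x_j, which stands leftmost in the
product, past all the others. -/
theorem cross_eq_erase (G : Fin n →₀ ℕ) (j : Fin n) (hj : ∀ i, j < i → G i = 0) :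
    cross w G = twist w (Finsupp.single j (G j)) (G.erase j) + cross w (G.erase j) := by
  rw [twist_single_left, cross, cross,
    ← Finset.sum_erase_add _ _ (Finset.mem_univ j),
    ← Finset.sum_erase_add (s := Finset.univ) (a := j)
      (f := fun i => ∑ k, if k < i then w i k * ((G.erase j) i * (G.erase j) k) else 0)
      (Finset.mem_univ j)]
  have h1 : (∑ k, if k < j then w j k * ((G.erase j) j * (G.erase j) k) else 0) = 0 :=
    Finset.sum_eq_zero fun k _ => by simp
  have h2 : (∑ k, if k < j then w j k * (G j * G k) else 0) =
      G j * ∑ i, w j i * (G.erase j) i := by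
    rw [Finset.mul_sum]
    refine Finset.sum_congr rfl fun k _ => ?_
    rcases lt_trichotomy k j with h | h | h
    · rw [if_pos h, Finsupp.erase_ne h.ne]; ring
    · subst h; simp
    · rw [if_neg h.not_gt, Finsupp.erase_ne h.ne', hj k h]; simp
  rw [h1, h2, add_zero, add_comm]
  congr 1
  refine Finset.sum_congr rfl fun i hi => Finset.sum_congr rfl fun k _ => ?_
  have hi : i ≠ j := Finset.ne_of_mem_erase hi
  split_ifs with hki
  · rw [Finsupp.erase_ne hi]
    by_cases hk : k = j
    · subst hk
      rw [hj i hki]; simp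
    · rw [Finsupp.erase_ne hk]
  · rfl

/-- As g does not involve x_j, the exponent of x_j forces a single splitting of G. -/
theorem emb_mul_apply (j : Fin n) (φ : PowerSeries ℂ) (g : QSeries n q w)
    (hg : ∀ E, E j ≠ 0 → g E = 0) (G : Fin n →₀ ℕ) :
    (emb j φ * g : QSeries n q w) G = (q : ℂ) ^ twist w (Finsupp.single j (G j)) (G.erase j) *
      (PowerSeries.coeff (G j) φ * g (G.erase j)) := by
  rw [mul_apply, Finset.sum_eq_single (Finsupp.single j (G j), G.erase j)]
  · simp [emb]
  · rintro ⟨a, b⟩ hab hne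
    rw [Finset.HasAntidiagonal.mem_antidiagonal] at hab
    by_cases ha : a = Finsupp.single j (a j)
    · by_cases hb : b j = 0
      · exfalso
        apply hne
        have h1 : a j = G j := by
          have := DFunLike.congr_fun hab j
          simpa [hb] using this
        rw [h1] at ha
        have h2 : b = G.erase j := by
          ext i
          by_cases hi : i = j
          · subst hi; simpa using hb
          · rw [Finsupp.erase_ne hi, ← hab, ha, Finsupp.add_apply, Finsupp.single_eq_of_ne hi,
              zero_add]
        rw [ha, h2]
      · simp [hg b hb]
    · simp [emb, ha]
  · intro h
    exact absurd (Finset.HasAntidiagonal.mem_antidiagonal.2 (Finsupp.single_add_erase j G)) h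

theorem list_prod_emb (A : Fin n → PowerSeries ℂ) (ls : List (Fin n))
    (hls : ls.Pairwise (· > ·)) (G : Fin n →₀ ℕ) :
    ((ls.map fun j => (emb j (A j) : QSeries n q w)).prod) G =
      if ∀ j, j ∉ ls → G j = 0 then
        (q : ℂ) ^ cross w G * (ls.map fun j => PowerSeries.coeff (G j) (A j)).prod else 0 := by
  induction ls generalizing G with
  | nil =>
    have h : (∀ j, j ∉ ([] : List (Fin n)) → G j = 0) ↔ G = 0 := by
      simp [Finsupp.ext_iff]
    simp only [List.map_nil, List.prod_nil, one_apply, h]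
    split_ifs with h0
    · subst h0; simp [cross]
    · rfl
  | cons j ls ih =>
    rw [List.pairwise_cons] at hls
    have hj : j ∉ ls := fun h => lt_irrefl _ (hls.1 j h)
    rw [List.map_cons, List.prod_cons, emb_mul_apply, ih hls.2]
    · have hiff : (∀ i, i ∉ ls → (G.erase j) i = 0) ↔ ∀ i, i ∉ j :: ls → G i = 0 := by
        refine forall_congr' fun i => ?_
        by_cases hi : i = j
        · subst hi; simp
        · rw [Finsupp.erase_ne hi, List.mem_cons]; simp [hi]
      simp only [hiff]
      split_ifs with h
      · rw [cross_eq_erase G j, pow_add, List.map_cons, List.prod_cons]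
        · have : (ls.map fun i => PowerSeries.coeff ((G.erase j) i) (A i)) =
              ls.map fun i => PowerSeries.coeff (G i) (A i) :=
            List.map_congr_left fun i hi => by
              rw [Finsupp.erase_ne (by rintro rfl; exact hj hi)]
          rw [this]; ring
        · intro i hi
          refine h i fun hmem => ?_
          rcases List.mem_cons.1 hmem with rfl | hmem
          · exact lt_irrefl _ hi
          · exact lt_asymm hi (hls.1 i hmem)
      · ring
    · intro E hE
      rw [ih hls.2, if_neg]
      exact fun h => hE (h j hj)

/-- The product `A_n(x_n) ⋯ A_1(x_1)`, expressed in ordered monomials. -/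
def prodSer (A : Fin n → PowerSeries ℂ) : QSeries n q w :=
  fun G => (q : ℂ) ^ cross w G * ∏ j, PowerSeries.coeff (G j) (A j)

theorem reverse_prod_emb (A : Fin n → PowerSeries ℂ) :
    (List.ofFn fun j => (emb j (A j) : QSeries n q w)).reverse.prod = prodSer A := by
  funext G
  rw [List.ofFn_eq_map, ← List.map_reverse, list_prod_emb]
  · rw [if_pos (fun j hj => absurd (by simp) hj), List.map_reverse, List.prod_reverse,
      ← List.ofFn_eq_map, List.prod_ofFn, prodSer]
  · rw [List.pairwise_reverse]
    exact List.pairwise_lt_finRange n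

/-! #### Powers of a sum of squares -/

theorem gen_sq (j : Fin n) (hw : w j j = 0) :
    (gen j ^ 2 : QSeries n q w) = mono (Finsupp.single j 2) := by
  rw [gen, sq, mono_mul_mono, twist_single, hw, pow_zero, one_smul, ← Finsupp.single_add]

/-- Consecutive terms are differences of powers of p at successive partial sums of K. This is the
recursion for p-multinomial coefficients. -/
theorem sum_telescope {ι : Type*} [LinearOrder ι] (s : Finset ι) (p : ℂ) (K : ι → ℕ) :
    ∑ j ∈ s, p ^ (∑ i ∈ s, if i < j then K i else 0) * (1 - p ^ K j) = 1 - p ^ ∑ i ∈ s, K i := by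
  induction s using Finset.induction_on_max with
  | empty => simp
  | insert a s ha ih =>
    have has : a ∉ s := fun h => lt_irrefl _ (ha a h)
    rw [Finset.sum_insert has, Finset.sum_insert has, Finset.sum_insert has]
    have h1 : ∑ j ∈ s, p ^ (∑ i ∈ insert a s, if i < j then K i else 0) * (1 - p ^ K j) =
        ∑ j ∈ s, p ^ (∑ i ∈ s, if i < j then K i else 0) * (1 - p ^ K j) :=
      Finset.sum_congr rfl fun j hj => by
        rw [Finset.sum_insert has, if_neg (ha j hj).not_gt, zero_add]
    have h2 : ∑ i ∈ s, (if i < a then K i else 0) = ∑ i ∈ s, K i :=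
      Finset.sum_congr rfl fun i hi => if_pos (ha i hi)
    rw [h1, ih, h2, if_neg (lt_irrefl a), zero_add, pow_add]
    ring

/-- The q-multinomial theorem with base q⁴, by splitting off one factor on the left: the
contributions of the various squares add up by the telescoping identity. That identity is the
hypothesis htel because the order of the indices is opposite in the two algebras. -/
theorem sum_gen_sq_pow (hw : ∀ j, w j j = 0)
    (hp : ∀ k, k ≠ 0 → ((q : ℂ) ^ 4) ^ k ≠ 1)
    (htel : ∀ K : Fin n → ℕ, ∑ j, ((q : ℂ) ^ 4) ^ (∑ i, w j i * K i) * (1 - ((q : ℂ) ^ 4) ^ K j) =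
      1 - ((q : ℂ) ^ 4) ^ ∑ i, K i) (k : ℕ) (K : Fin n →₀ ℕ) :
    ((∑ j, gen j ^ 2 : QSeries n q w) ^ k) (2 • K) =
      if ∑ i, K i = k then qPoch ((q : ℂ) ^ 4) ((q : ℂ) ^ 4) k /
        ∏ i, qPoch ((q : ℂ) ^ 4) ((q : ℂ) ^ 4) (K i) else 0 := by
  set p := (q : ℂ) ^ 4 with hpdef
  have hP := qPoch_self_ne_zero hp
  induction k generalizing K with
  | zero =>
    rw [pow_zero, one_apply]
    have h : (2 • K = 0) ↔ ∑ i, K i = 0 := by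
      simp [Finsupp.ext_iff]
    simp only [h]
    split_ifs with h0
    · have : ∀ i, K i = 0 := by simpa using h0
      simp [this, qPoch_zero]
    · rfl
  | succ k ih =>
    have hterm : ∀ j, (gen j ^ 2 * (∑ j, gen j ^ 2) ^ k : QSeries n q w) (2 • K) =
        if ∑ i, K i = k + 1 then p ^ (∑ i, w j i * K i) * (1 - p ^ K j) *
          (qPoch p p k / ∏ i, qPoch p p (K i)) else 0 := fun j => by
      rw [gen_sq j (hw j), mono_mul_apply]
      by_cases hj : K j = 0
      · rw [if_neg, hj]
        · simp
        · intro h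
          have := h j
          simp [hj] at this
      · have hle : Finsupp.single j 1 ≤ K := by
          simpa [Nat.one_le_iff_ne_zero] using hj
        have h2 : Finsupp.single j 2 = 2 • Finsupp.single j 1 := by simp
        obtain ⟨K', rfl⟩ := exists_add_of_le hle
        have h3 : 2 • (Finsupp.single j 1 + K' : Fin n →₀ ℕ) - Finsupp.single j 2 = 2 • K' := by
          rw [smul_add, h2, add_tsub_cancel_left]
        rw [if_pos (by rw [smul_add, h2]; exact le_self_add), h3, ih, twist_single_left]
        have h4 : ∑ i, (Finsupp.single j 1 + K' : Fin n →₀ ℕ) i = k + 1 ↔ ∑ i, K' i = k := by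
          have : ∑ i, (Finsupp.single j 1 : Fin n →₀ ℕ) i = 1 := by
            rw [Finset.sum_eq_single j (fun b _ hb => Finsupp.single_eq_of_ne hb) (by simp)]; simp
          simp only [Finsupp.add_apply, Finset.sum_add_distrib, this]
          omega
        simp only [h4]
        split_ifs with h5
        · have h6 : (q : ℂ) ^ (2 * ∑ i, w j i * (2 • K') i) =
              p ^ ∑ i, w j i * (Finsupp.single j 1 + K' : Fin n →₀ ℕ) i := by
            rw [hpdef, ← pow_mul]
            congr 1
            rw [show (4 : ℕ) = 2 * 2 by norm_num, mul_assoc]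
            congr 1
            rw [Finset.mul_sum]
            refine Finset.sum_congr rfl fun i _ => ?_
            by_cases hi : i = j
            · subst hi; simp [hw]
            · simp [Finsupp.single_eq_of_ne hi]; ring
          have h7 : ∏ i, qPoch p p ((Finsupp.single j 1 + K' : Fin n →₀ ℕ) i) =
              (1 - p ^ (Finsupp.single j 1 + K' : Fin n →₀ ℕ) j) * ∏ i, qPoch p p (K' i) := by
            rw [← Finset.mul_prod_erase _ _ (Finset.mem_univ j),
              ← Finset.mul_prod_erase (Finset.univ) (fun i => qPoch p p (K' i)) (Finset.mem_univ j),
              Finsupp.add_apply, Finsupp.single_eq_same, add_comm 1, qPoch_self_succ]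
            have : ∏ i ∈ Finset.univ.erase j, qPoch p p ((Finsupp.single j 1 + K' : Fin n →₀ ℕ) i) =
                ∏ i ∈ Finset.univ.erase j, qPoch p p (K' i) :=
              Finset.prod_congr rfl fun i hi => by
                rw [Finsupp.add_apply, Finsupp.single_eq_of_ne (Finset.ne_of_mem_erase hi), zero_add]
            rw [this]; ring
          have h8 : 1 - p ^ (Finsupp.single j 1 + K' : Fin n →₀ ℕ) j ≠ 0 := sub_ne_zero.2 (hp _ hj).symm
          have h9 : ∏ i, qPoch p p (K' i) ≠ 0 := Finset.prod_ne_zero_iff.2 fun i _ => hP _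
          rw [h6, h7]
          field_simp
        · ring
    rw [pow_succ', Finset.sum_mul]
    have hsum : ∀ (s : Finset (Fin n)) (f : Fin n → QSeries n q w) (G : Fin n →₀ ℕ),
        (∑ j ∈ s, f j) G = ∑ j ∈ s, f j G := fun s f G => Finset.sum_apply G s f
    rw [hsum]
    simp only [hterm]
    split_ifs with h
    · rw [← Finset.sum_mul, htel, h, qPoch_self_succ]
      ring
    · simp

theorem sum_gen_sq_pow_odd (hw : ∀ j, w j j = 0) (k : ℕ) (E : Fin n →₀ ℕ)
    (hE : ¬ ∀ j, Even (E j)) : ((∑ j, gen j ^ 2 : QSeries n q w) ^ k) E = 0 := by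
  induction k generalizing E with
  | zero =>
    rw [pow_zero, one_apply, if_neg]
    rintro rfl
    exact hE fun j => by simp
  | succ k ih =>
    rw [pow_succ', Finset.sum_mul]
    refine (Finset.sum_apply E _ _).trans (Finset.sum_eq_zero fun j _ => ?_)
    rw [gen_sq j (hw j), mono_mul_apply]
    split_ifs with h
    · obtain ⟨F, rfl⟩ := exists_add_of_le h
      rw [add_tsub_cancel_left, ih, mul_zero]
      intro hF
      refine hE fun i => ?_
      rw [Finsupp.add_apply]
      refine Even.add ?_ (hF i)
      rw [Finsupp.single_apply]
      split_ifs <;> simp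
    · rfl

theorem exists_two_nsmul {E : Fin n →₀ ℕ} (hE : ∀ j, Even (E j)) : ∃ K : Fin n →₀ ℕ, E = 2 • K := by
  refine ⟨E.mapRange (· / 2) rfl, ?_⟩
  ext j
  rw [Finsupp.smul_apply, Finsupp.mapRange_apply, smul_eq_mul, Nat.mul_div_cancel' (hE j).two_dvd]

/-- Factorises a function of the sum of squares into one-variable series. The condition hab says
that the multinomial coefficient and the reordering factor fit the coefficients a and b. -/
theorem subst_smul_sum_gen_sq (hw : ∀ j, w j j = 0)
    (hp : ∀ k, k ≠ 0 → ((q : ℂ) ^ 4) ^ k ≠ 1)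
    (htel : ∀ K : Fin n → ℕ, ∑ j, ((q : ℂ) ^ 4) ^ (∑ i, w j i * K i) * (1 - ((q : ℂ) ^ 4) ^ K j) =
      1 - ((q : ℂ) ^ 4) ^ ∑ i, K i) (a b : ℕ → ℂ) (c : ℂ)
    (hab : ∀ K : Fin n →₀ ℕ, a (∑ i, K i) * c ^ (∑ i, K i) *
      (qPoch ((q : ℂ) ^ 4) ((q : ℂ) ^ 4) (∑ i, K i) /
        ∏ i, qPoch ((q : ℂ) ^ 4) ((q : ℂ) ^ 4) (K i)) =
      (q : ℂ) ^ cross w (2 • K) * ∏ i, b (K i)) :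
    subst a (c • ∑ j, gen j ^ 2 : QSeries n q w) = prodSer fun _ => evenSer b := by
  funext E
  simp only [subst, smul_pow, smul_apply, prodSer]
  by_cases hE : ∀ j, Even (E j)
  · obtain ⟨K, rfl⟩ := exists_two_nsmul hE
    simp only [sum_gen_sq_pow hw hp htel, Finsupp.smul_apply, smul_eq_mul, coeff_evenSer_two_mul]
    rw [← hab, Finset.sum_eq_single (∑ i, K i)]
    · rw [if_pos rfl]; ring
    · intro k _ hk
      rw [if_neg hk.symm, mul_zero, mul_zero]
    · intro h
      refine absurd (Finset.mem_range.2 ?_) h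
      simp only [deg, Finsupp.smul_apply, smul_eq_mul, ← Finset.mul_sum]
      omega
  · rw [Finset.sum_eq_zero fun k _ => by rw [sum_gen_sq_pow_odd hw k E hE, mul_zero, mul_zero]]
    push Not at hE
    obtain ⟨j, hj⟩ := hE
    rw [Finset.prod_eq_zero (Finset.mem_univ j) (coeff_evenSer_odd _ hj), mul_zero]

end Products

/-! ### The series to be transformed -/

section Series

variable {n : ℕ} {q : ℝ}

/-- `∑_{j < i} eᵢ eⱼ`. -/
def pairSum (E : Fin n →₀ ℕ) : ℕ := ∑ i, ∑ j, if j < i then E i * E j else 0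

theorem cross_cov (E : Fin n →₀ ℕ) :
    cross (fun i j : Fin n => if j < i then 1 else 0) E = pairSum E :=
  Finset.sum_congr rfl fun i _ => Finset.sum_congr rfl fun j _ => by
    by_cases h : j < i <;> simp [h]

theorem cross_vec (E : Fin n →₀ ℕ) : cross (fun i j : Fin n => if i < j then 1 else 0) E = 0 :=
  Finset.sum_eq_zero fun i _ => Finset.sum_eq_zero fun j _ => by
    by_cases h : j < i
    · simp [h.not_gt]
    · simp [h]

theorem deg_sq (E : Fin n →₀ ℕ) : deg E ^ 2 = ∑ j, E j ^ 2 + 2 * pairSum E := by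
  have h1 : ∑ i, ∑ j, (if i < j then E i * E j else 0) = pairSum E := by
    rw [Finset.sum_comm]
    exact Finset.sum_congr rfl fun i _ => Finset.sum_congr rfl fun j _ => by rw [mul_comm]
  have h2 : ∑ i, ∑ j, (if i = j then E i * E j else 0) = ∑ j, E j ^ 2 :=
    Finset.sum_congr rfl fun i _ => by simp [sq]
  rw [sq, deg, Finset.sum_mul_sum, ← h2, two_mul]
  nth_rewrite 1 [← h1]
  rw [pairSum, ← Finset.sum_add_distrib, ← Finset.sum_add_distrib]
  refine Finset.sum_congr rfl fun i _ => ?_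
  rw [← Finset.sum_add_distrib, ← Finset.sum_add_distrib]
  refine Finset.sum_congr rfl fun j _ => ?_
  rcases lt_trichotomy i j with h | h | h
  · simp [h, h.ne, h.not_gt]
  · simp [h]
  · simp [h, h.ne', h.not_gt]

theorem mul_pred_add_self (m : ℕ) : m * (m - 1) + m = m ^ 2 := by
  cases m
  · rfl
  · simp; ring

theorem triangle_add_self (m : ℕ) : 2 * (m * (m - 1) / 2) + m = m ^ 2 := by
  rw [Nat.mul_div_cancel' (Nat.even_mul_pred_self m).two_dvd, mul_pred_add_self]

theorem deg_mul_pred (E : Fin n →₀ ℕ) :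
    deg E * (deg E - 1) = ∑ j, E j * (E j - 1) + 2 * pairSum E := by
  have h1 := mul_pred_add_self (deg E)
  have h2 : ∑ j, E j * (E j - 1) + deg E = ∑ j, E j ^ 2 := by
    rw [deg, ← Finset.sum_add_distrib]
    exact Finset.sum_congr rfl fun j _ => mul_pred_add_self _
  have h3 := deg_sq E
  omega

theorem pairSum_two_nsmul (K : Fin n →₀ ℕ) : pairSum (2 • K) = 4 * pairSum K := by
  simp only [pairSum, Finset.mul_sum]
  refine Finset.sum_congr rfl fun i _ => Finset.sum_congr rfl fun j _ => ?_
  split_ifs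
  · simp; ring
  · rfl

theorem triangle_deg (E : Fin n →₀ ℕ) :
    deg E * (deg E - 1) / 2 = ∑ j, E j * (E j - 1) / 2 + pairSum E := by
  have h1 := triangle_add_self (deg E)
  have h2 : 2 * ∑ j, E j * (E j - 1) / 2 + deg E = ∑ j, E j ^ 2 := by
    rw [deg, Finset.mul_sum, ← Finset.sum_add_distrib]
    exact Finset.sum_congr rfl fun j _ => triangle_add_self _
  have h3 := deg_sq E
  omega

theorem covSeries_eq (p : Fin n → Polynomial ℂ) :
    covSeries q p = prodSer fun j => uSer q * (p j : PowerSeries ℂ) := by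
  rw [covSeries, ← reverse_prod_emb]
  congr 3
  funext j
  rw [← neg_smul, subst_smul_gen_sq j (by simp), aeval_gen j (by simp), uSer, emb_mul j (by simp)]

theorem vecSeries_eq (r : Fin n → Polynomial ℂ) :
    vecSeries q r = prodSer fun j => (r j : PowerSeries ℂ) * eSer q := by
  rw [vecSeries, ← reverse_prod_emb]
  congr 3
  funext j
  rw [← neg_one_smul ℂ, subst_smul_gen_sq j (by simp), aeval_gen j (by simp), eSer,
    emb_mul j (by simp)]

/-- The quadratic exponent of E_{q⁴} at |K| exceeds the sum of those at the K_i by mixed terms,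
which give q to the power 4·`pairSum K` = `pairSum (2 • K)`. This is exactly the cost of reordering
the decreasing product. -/
theorem bigGaussian_eq (hq0 : 0 < q) (hq1 : q < 1) : bigGaussian n q = covSeries q fun _ => 1 := by
  have hp := pow_pow_ne_one (cast_pow_ne_one hq0 hq1) (show 4 ≠ 0 by decide)
  have h1 : -∑ j, ((q : ℂ) ^ 2 • gen j : Cov n q) ^ 2 = (-(q : ℂ) ^ 4) • ∑ j, gen j ^ 2 := by
    simp only [smul_pow, ← Finset.smul_sum, neg_smul]
    rw [← pow_mul]
  rw [covSeries_eq, bigGaussian, h1,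
    subst_smul_sum_gen_sq (b := fun k => (-(q : ℂ) ^ 4) ^ k * ECoeff ((q : ℂ) ^ 4) k)
      (by simp) hp]
  · simp only [uSer, Polynomial.coe_one, mul_one]
  · intro K
    rw [← sum_telescope Finset.univ _ K]
    simp only [ite_mul, one_mul, zero_mul]
  · intro K
    have hP := qPoch_self_ne_zero hp
    have h2 : ∏ i, qPoch ((q : ℂ) ^ 4) ((q : ℂ) ^ 4) (K i) ≠ 0 :=
      Finset.prod_ne_zero_iff.2 fun i _ => hP _
    have h3 := triangle_deg K
    rw [deg] at h3
    simp only [ECoeff]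
    rw [h3, cross_cov, pairSum_two_nsmul, Finset.prod_mul_distrib, Finset.prod_div_distrib,
      Finset.prod_pow_eq_pow_sum, Finset.prod_pow_eq_pow_sum, pow_add, ← pow_mul (q : ℂ) 4 (pairSum K)]
    have := hP (∑ i, K i)
    field_simp

theorem smallGaussian_eq (hq0 : 0 < q) (hq1 : q < 1) :
    smallGaussian n q = vecSeries q fun _ => 1 := by
  have hp := pow_pow_ne_one (cast_pow_ne_one hq0 hq1) (show 4 ≠ 0 by decide)
  rw [vecSeries_eq, smallGaussian, ← neg_one_smul ℂ,
    subst_smul_sum_gen_sq (b := fun k => (-1) ^ k * eCoeff ((q : ℂ) ^ 4) k) (by simp) hp]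
  · simp only [eSer, Polynomial.coe_one, one_mul]
  · intro K
    -- In the vector algebra larger indices produce the powers of q, so the telescoping runs through
    -- the dual order.
    refine Eq.trans ?_ (sum_telescope (ι := (Fin n)ᵒᵈ) Finset.univ _ K)
    refine Finset.sum_congr rfl fun j _ => ?_
    congr 2
    refine Finset.sum_congr rfl fun i _ => ?_
    rw [ite_mul, one_mul, zero_mul]
    rfl
  · intro K
    have hP := qPoch_self_ne_zero hp (∑ i, K i)
    have h2 : ∏ i, qPoch ((q : ℂ) ^ 4) ((q : ℂ) ^ 4) (K i) ≠ 0 :=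
      Finset.prod_ne_zero_iff.2 fun i _ => qPoch_self_ne_zero hp _
    simp only [eCoeff]
    rw [cross_vec, Finset.prod_mul_distrib, Finset.prod_div_distrib, Finset.prod_pow_eq_pow_sum]
    field_simp
    simp

end Series

/-! ### Multiple series -/

section MultipleSeries

theorem summable_norm_prod_pi {ι : Type*} {n : ℕ} (f : Fin n → ι → ℂ)
    (hf : ∀ j, Summable fun i => ‖f j i‖) :
    Summable (fun x : Fin n → ι => ‖∏ j, f j (x j)‖) ∧
      ∑' x : Fin n → ι, ∏ j, f j (x j) = ∏ j, ∑' i, f j i := by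
  induction n with
  | zero => exact ⟨(hasSum_fintype _).summable, by simp⟩
  | succ n ih =>
    obtain ⟨h1, h2⟩ := ih (fun j => f j.succ) fun j => hf j.succ
    have e : ∀ y : ι × (Fin n → ι), ∏ j, f j (Fin.consEquiv (fun _ => ι) y j) =
        f 0 y.1 * ∏ j, f j.succ (y.2 j) := fun y => by
      rw [Fin.prod_univ_succ]; simp [Fin.consEquiv]
    constructor
    · have h3 := Summable.mul_norm (hf 0) h1
      rw [← (Fin.consEquiv fun _ => ι).summable_iff]
      refine h3.congr fun y => ?_
      rw [← e y]
      rfl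
    · have h3 := tsum_mul_tsum_of_summable_norm (hf 0) h1
      rw [h2] at h3
      rw [← (Fin.consEquiv fun _ => ι).tsum_eq, Fin.prod_univ_succ, h3]
      exact tsum_congr e

variable {n : ℕ} {q : ℝ} {w : Fin n → Fin n → ℕ}

theorem summable_norm_prod_finsupp (f : Fin n → ℕ → ℂ) (hf : ∀ j, Summable fun i => ‖f j i‖) :
    Summable fun E : Fin n →₀ ℕ => ‖∏ j, f j (E j)‖ :=
  (Finsupp.equivFunOnFinite.summable_iff (f := fun x : Fin n → ℕ => ‖∏ j, f j (x j)‖)).2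
    (summable_norm_prod_pi f hf).1

theorem tsum_prod_finsupp (f : Fin n → ℕ → ℂ) (hf : ∀ j, Summable fun i => ‖f j i‖) :
    ∑' E : Fin n →₀ ℕ, ∏ j, f j (E j) = ∏ j, ∑' i, f j i := by
  rw [← (summable_norm_prod_pi f hf).2]
  exact Finsupp.equivFunOnFinite.tsum_eq fun x : Fin n → ℕ => ∏ j, f j (x j)

theorem summable_norm_prodSer (hq0 : 0 < q) (hq1 : q < 1) {A : Fin n → PowerSeries ℂ}
    {z : Fin n → ℂ} (hA : ∀ j, ConvAt (A j) (z j)) :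
    Summable fun E => ‖(prodSer A : QSeries n q w) E * monoVal z E‖ := by
  refine Summable.of_nonneg_of_le (fun _ => norm_nonneg _) (fun E => ?_)
    (summable_norm_prod_finsupp (fun j k => PowerSeries.coeff k (A j) * z j ^ k) hA)
  rw [prodSer, monoVal, mul_assoc, ← Finset.prod_mul_distrib, norm_mul, norm_pow,
    Complex.norm_real, Real.norm_of_nonneg hq0.le]
  exact mul_le_of_le_one_left (norm_nonneg _) (pow_le_one₀ hq0.le hq1.le)

theorem monoVal_smul (t : ℂ) (z : Fin n → ℂ) (E : Fin n →₀ ℕ) :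
    monoVal (fun j => t * z j) E = t ^ deg E * monoVal z E := by
  simp only [monoVal, mul_pow, Finset.prod_mul_distrib, Finset.prod_pow_eq_pow_sum, deg]

theorem monoVal_add (z : Fin n → ℂ) (E F : Fin n →₀ ℕ) :
    monoVal z (E + F) = monoVal z E * monoVal z F := by
  simp only [monoVal, Finsupp.add_apply, pow_add, Finset.prod_mul_distrib]

theorem monoVal_single (z : Fin n → ℂ) (l : Fin n) (k : ℕ) :
    monoVal z (Finsupp.single l k) = z l ^ k := by
  rw [monoVal, Finset.prod_eq_single l (fun b _ hb => by simp [Finsupp.single_eq_of_ne hb]) (by simp),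
    Finsupp.single_eq_same]

theorem coeff_eq_zero_of_hasSum_zero {a : ℕ → ℂ} (h : ∀ t : ℂ, HasSum (fun k => a k * t ^ k) 0) :
    a = 0 := by
  have h1 : HasFPowerSeriesAt (0 : ℂ → ℂ) (FormalMultilinearSeries.ofScalars ℂ a) 0 := by
    rw [hasFPowerSeriesAt_iff]
    refine Eventually.of_forall fun t => ?_
    simp only [FormalMultilinearSeries.coeff_ofScalars, smul_eq_mul, Pi.zero_apply]
    simpa only [mul_comm] using h t
  funext k
  have h2 := congr_arg (fun p => FormalMultilinearSeries.coeff p k) h1.eq_zero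
  rw [FormalMultilinearSeries.coeff_ofScalars] at h2
  exact h2

/-- An everywhere convergent power series with vanishing values is zero. -/
theorem eq_zero_of_hasSum_zero {h : (Fin n →₀ ℕ) → ℂ}
    (hh : ∀ z : Fin n → ℂ, HasSum (fun E => h E * monoVal z E) 0) : h = 0 := by
  have hmem : ∀ (d : ℕ) (E : Fin n →₀ ℕ), E ∈ Finset.univ.finsuppAntidiag d ↔ deg E = d :=
    fun d E => by simp [Finset.mem_finsuppAntidiag, deg]
  -- Along the ray tz the series is a one-variable power series in t whose coefficients are the
  -- homogeneous components at z; each must vanish.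
  have hd : ∀ (z : Fin n → ℂ) (d : ℕ),
      ∑ E ∈ Finset.univ.finsuppAntidiag d, h E * monoVal z E = 0 := fun z => by
    refine congr_fun (coeff_eq_zero_of_hasSum_zero
      (a := fun d => ∑ E ∈ Finset.univ.finsuppAntidiag d, h E * monoVal z E) fun t => ?_)
    have h1 := (Equiv.sigmaFiberEquiv (deg (n := n))).hasSum_iff.2 (hh fun j => t * z j)
    refine h1.sigma fun d => ?_
    have h2 : ∑ E ∈ Finset.univ.finsuppAntidiag d, h E * monoVal (fun j => t * z j) E =
        (∑ E ∈ Finset.univ.finsuppAntidiag d, h E * monoVal z E) * t ^ d := by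
      rw [Finset.sum_mul]
      refine Finset.sum_congr rfl fun E hE => ?_
      rw [monoVal_smul, (hmem d E).1 hE]
      ring
    rw [← h2]
    have h3 : {E : Fin n →₀ ℕ | deg E = d} = (Finset.univ.finsuppAntidiag d : Finset (Fin n →₀ ℕ)) := by
      ext E; simp [← hmem]
    have h4 := (Finset.univ.finsuppAntidiag d).hasSum fun E => h E * monoVal (fun j => t * z j) E
    have h5 : HasSum ((fun E => h E * monoVal (fun j => t * z j) E) ∘
        ((↑) : {E : Fin n →₀ ℕ | deg E = d} → _))
        (∑ E ∈ Finset.univ.finsuppAntidiag d, h E * monoVal (fun j => t * z j) E) := by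
      rw [h3]; exact h4
    exact h5
  funext E
  -- Each homogeneous component is now a polynomial vanishing at every point.
  have h1 : (∑ F ∈ Finset.univ.finsuppAntidiag (deg E), MvPolynomial.monomial F (h F)) =
      (0 : MvPolynomial (Fin n) ℂ) := by
    refine MvPolynomial.funext fun z => ?_
    rw [map_sum, map_zero, ← hd z (deg E)]
    refine Finset.sum_congr rfl fun F _ => ?_
    rw [MvPolynomial.eval_monomial, monoVal, Finsupp.prod_fintype _ _ (by simp)]
  have h2 := congr_arg (MvPolynomial.coeff E) h1
  rw [MvPolynomial.coeff_sum, Finset.sum_eq_single E] at h2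
  · simpa using h2
  · intro F _ hF
    rw [MvPolynomial.coeff_monomial, if_neg hF]
  · intro hE
    exact absurd ((hmem _ E).2 rfl) hE

/-- An entire realization determines its series. Iterated, this makes the choice in `loIntegral`
immaterial. -/
theorem IsPartialIntegral.unique {c : ℝ} {l : Fin n} {f g g' : Cov n q}
    (h : IsPartialIntegral c l f g) (h' : IsPartialIntegral c l f g') : g = g' := by
  have h0 : g - g' = 0 := eq_zero_of_hasSum_zero fun z => by
    obtain ⟨-, h1, h2⟩ := h z
    obtain ⟨-, h1', h2'⟩ := h' z
    have h3 : evalAt g z - evalAt g' z = 0 := sub_eq_zero.2 (h2.unique h2')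
    rw [← h3]
    have h4 := h1.hasSum.sub h1'.hasSum
    simp only [← sub_mul] at h4
    exact h4
  exact sub_eq_zero.1 h0

theorem HasIteratedIntegral.unique {γ : Fin n → ℝ} {ls : List (Fin n)} {f : Cov n q} {v v' : ℂ}
    (h : HasIteratedIntegral γ ls f v) (h' : HasIteratedIntegral γ ls f v') : v = v' := by
  induction ls generalizing f with
  | nil => exact h.trans h'.symm
  | cons l ls ih =>
    obtain ⟨g, hg, h⟩ := h
    obtain ⟨g', hg', h'⟩ := h'
    rw [hg.unique hg'] at h
    exact ih h h'

theorem loIntegral_eq {σ : Equiv.Perm (Fin n)} {γ : Fin n → ℝ} {f : Cov n q} {v : ℂ}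
    (h : HasIteratedIntegral γ (List.ofFn σ) f v) : loIntegral σ γ f = v := by
  have h1 : ∃ v, HasIteratedIntegral γ (List.ofFn σ) f v := ⟨v, h⟩
  rw [loIntegral, dif_pos h1]
  exact h1.choose_spec.unique h

theorem evenPart_zero : evenPart (0 : QSeries n q w) = 0 := by
  funext E
  simp [evenPart, zero_apply]

theorem isPartialIntegral_zero (c : ℝ) (l : Fin n) {f : Cov n q} (hf : evenPart f = 0) :
    IsPartialIntegral c l f 0 := fun z => by
  have h1 : ∀ h ε, partialTerm l h ε (evenPart f) = 0 := fun h ε => by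
    have : ∀ a : Fin n → ℂ, rescale a (0 : Cov n q) = 0 := fun a => by
      funext E; simp [rescale, zero_apply]
    rw [hf, partialTerm, this, mul_zero, smul_zero]
  have h2 : ∀ z, evalAt (0 : Cov n q) z = 0 := fun z => by simp [evalAt, zero_apply]
  simp only [h1, h2, zero_apply, zero_mul]
  exact ⟨fun _ _ => summable_zero, summable_zero, hasSum_zero⟩

theorem hasIteratedIntegral_zero (γ : Fin n → ℝ) {ls : List (Fin n)} (hls : ls ≠ []) {f : Cov n q}
    (hf : evenPart f = 0) : HasIteratedIntegral γ ls f 0 := by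
  induction ls generalizing f with
  | nil => exact absurd rfl hls
  | cons l ls ih =>
    refine ⟨0, isPartialIntegral_zero _ l hf, ?_⟩
    by_cases h : ls = []
    · subst h; rfl
    · exact ih h evenPart_zero

end MultipleSeries

/-! ### One step of the lattice order integral -/

section Step

variable {n : ℕ} {q : ℝ}

theorem hasSum_of_eq {ι : Type*} {f g : ι → ℂ} {a b : ℂ} (h : HasSum f a) (hf : ∀ x, g x = f x)
    (hab : b = a) : HasSum g b := by
  rw [hab, funext hf]
  exact h

theorem deg_add (E F : Fin n →₀ ℕ) : deg (E + F) = deg E + deg F := by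
  simp [deg, Finset.sum_add_distrib]

theorem deg_single (l : Fin n) (k : ℕ) : deg (Finsupp.single l k) = k := by
  rw [deg, Finset.sum_eq_single l (fun b _ hb => Finsupp.single_eq_of_ne hb) (by simp),
    Finsupp.single_eq_same]

/-- Polarisation of `deg_sq`: the mixed terms do not depend on the position of l among the
variables. -/
theorem pairSum_add_single (F : Fin n →₀ ℕ) {l : Fin n} (hF : F l = 0) (k : ℕ) :
    pairSum (F + Finsupp.single l k) = pairSum F + k * deg F := by
  have h1 := deg_sq (F + Finsupp.single l k)
  have h2 := deg_sq F
  have h3 : ∑ j, (F + Finsupp.single l k) j ^ 2 = ∑ j, F j ^ 2 + k ^ 2 := by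
    rw [← Finset.add_sum_erase _ _ (Finset.mem_univ l),
      ← Finset.add_sum_erase Finset.univ (fun j => F j ^ 2) (Finset.mem_univ l)]
    have : ∑ j ∈ Finset.univ.erase l, (F + Finsupp.single l k) j ^ 2 =
        ∑ j ∈ Finset.univ.erase l, F j ^ 2 := Finset.sum_congr rfl fun j hj => by
      rw [Finsupp.add_apply, Finsupp.single_eq_of_ne (Finset.ne_of_mem_erase hj), add_zero]
    rw [this]
    simp [hF]
    ring
  rw [deg_add, deg_single, h3] at h1
  nlinarith

/-- The decomposition of exponents into the exponent of `x_l` and those of the other variables. -/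
def splitEquiv (l : Fin n) : {F : Fin n →₀ ℕ // F l = 0} × ℕ ≃ (Fin n →₀ ℕ) where
  toFun y := y.1.1 + Finsupp.single l y.2
  invFun E := (⟨E.erase l, by simp⟩, E l)
  left_inv y := by
    obtain ⟨⟨F, hF⟩, k⟩ := y
    refine Prod.ext (Subtype.ext (Finsupp.ext fun j => ?_)) (by simp [hF])
    by_cases hj : j = l
    · subst hj; simp [hF]
    · simp [Finsupp.erase_ne hj]
  right_inv E := (add_comm _ _).trans (Finsupp.single_add_erase l E)

/-- The one-variable factors of the series resulting from integration with respect to `x_l`. -/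
def stepSer (q : ℂ) (l : Fin n) (A : Fin n → PowerSeries ℂ) : Fin n → PowerSeries ℂ := fun j =>
  if j = l then 1 else PowerSeries.rescale (if j < l then (q ^ 2)⁻¹ else q⁻¹) (A j)

/-- The point at which the commutative series is evaluated when `x_l` is integrated. -/
def stepPoint (q : ℂ) (l : Fin n) (t : ℂ) (z : Fin n → ℂ) : Fin n → ℂ := fun j =>
  if j < l then q⁻¹ * z j else if j = l then t else z j

/-- Each other letter multiplies the argument of A_l by q, whatever its index. A further q^{deg F}
is extracted to serve as the Jacobian of this dilation and is compensated by q⁻¹ in every factor of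
`stepSer`; factors with j < l carry a second q⁻¹ from the evaluation point. -/
theorem prodSer_split (hq0 : 0 < q) (A : Fin n → PowerSeries ℂ) (l : Fin n) (t : ℂ)
    (z : Fin n → ℂ) (F : Fin n →₀ ℕ) (hF : F l = 0) (k : ℕ) :
    (prodSer A : Cov n q) (F + Finsupp.single l k) *
        monoVal (stepPoint q l t z) (F + Finsupp.single l k) =
      (q : ℂ) ^ deg F * ((prodSer (stepSer q l A) : Cov n q) F * monoVal z F) *
        (PowerSeries.coeff k (A l) * (t * (q : ℂ) ^ deg F) ^ k) := by
  have hq := cast_ne_zero hq0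
  have hL : (∏ j, PowerSeries.coeff ((F + Finsupp.single l k) j) (A j)) *
      monoVal (stepPoint q l t z) (F + Finsupp.single l k) =
      PowerSeries.coeff k (A l) * t ^ k *
        ((q : ℂ) ^ deg F * ((∏ j, PowerSeries.coeff (F j) (stepSer (q : ℂ) l A j)) *
          monoVal z F)) := by
    rw [deg, ← Finset.prod_pow_eq_pow_sum, monoVal, monoVal, ← Finset.prod_mul_distrib,
      ← Finset.prod_mul_distrib, ← Finset.prod_mul_distrib,
      ← Finset.mul_prod_erase _ _ (Finset.mem_univ l),
      ← Finset.mul_prod_erase Finset.univ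
        (fun j => (q : ℂ) ^ F j * (PowerSeries.coeff (F j) (stepSer (q : ℂ) l A j) * z j ^ F j))
        (Finset.mem_univ l)]
    have h1 : ∀ j ∈ Finset.univ.erase l, PowerSeries.coeff ((F + Finsupp.single l k) j) (A j) *
        stepPoint (q : ℂ) l t z j ^ (F + Finsupp.single l k) j =
        (q : ℂ) ^ F j * (PowerSeries.coeff (F j) (stepSer (q : ℂ) l A j) * z j ^ F j) :=
      fun j hj => by
        have hj := Finset.ne_of_mem_erase hj
        rw [Finsupp.add_apply, Finsupp.single_eq_of_ne hj, add_zero, stepPoint, stepSer, if_neg hj,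
          if_neg hj, PowerSeries.coeff_rescale]
        have h2 := pow_ne_zero (F j) hq
        split_ifs
        · rw [mul_pow, inv_pow, inv_pow, ← pow_mul, mul_comm 2, pow_mul]
          field_simp
        · rw [inv_pow]
          field_simp
    rw [Finset.prod_congr rfl h1]
    simp [hF, stepPoint, stepSer]
  simp only [prodSer, cross_cov, pairSum_add_single F hF]
  rw [pow_add, mul_assoc, mul_assoc, hL, mul_pow, ← pow_mul, mul_comm (deg F) k]
  ring

/-- Summing over the exponent of x_l first turns evaluation into a series over the other variables,
in each term of which A_l is evaluated on a lattice dilated by q^{deg F}. -/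
theorem hasSum_prodSer_split (hq0 : 0 < q) (hq1 : q < 1) {A : Fin n → PowerSeries ℂ}
    (hA : ∀ j, Entire (A j)) (l : Fin n) (t : ℂ) (z : Fin n → ℂ) :
    HasSum (fun F : {F : Fin n →₀ ℕ // F l = 0} =>
      (prodSer (stepSer q l A) : Cov n q) F.1 * monoVal z F.1 *
        ((q : ℂ) ^ deg F.1 * pval (A l) (t * (q : ℂ) ^ deg F.1)))
      (evalAt (prodSer A : Cov n q) (stepPoint q l t z)) := by
  have h1 : HasSum (fun E => (prodSer A : Cov n q) E * monoVal (stepPoint q l t z) E)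
      (evalAt (prodSer A : Cov n q) (stepPoint q l t z)) :=
    (Summable.of_norm (summable_norm_prodSer hq0 hq1 fun j => hA j _)).hasSum
  refine ((splitEquiv l).hasSum_iff.2 h1).prod_fiberwise fun F => ?_
  have h2 := (hA l (t * (q : ℂ) ^ deg F.1)).hasSum.mul_left
    ((q : ℂ) ^ deg F.1 * ((prodSer (stepSer q l A) : Cov n q) F.1 * monoVal z F.1))
  refine hasSum_of_eq h2 (fun k => prodSer_split hq0 A l t z F.1 F.2 k) ?_
  rw [← mul_assoc, mul_comm _ ((q : ℂ) ^ deg F.1)]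

theorem entire_stepSer {A : Fin n → PowerSeries ℂ} (hA : ∀ j, Entire (A j)) (q : ℂ) (l : Fin n)
    (j : Fin n) : Entire (stepSer q l A j) := by
  rw [stepSer]
  split_ifs
  · rw [← Polynomial.coe_one]; exact entire_coe 1
  · exact (hA j).rescale _
  · exact (hA j).rescale _

/-- All coefficients of odd index vanish. -/
def EvenCoeffs (φ : PowerSeries ℂ) : Prop := ∀ k, ¬ Even k → PowerSeries.coeff k φ = 0

theorem EvenCoeffs.rescale {φ : PowerSeries ℂ} (h : EvenCoeffs φ) (a : ℂ) :
    EvenCoeffs (PowerSeries.rescale a φ) := fun k hk => by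
  rw [PowerSeries.coeff_rescale, h k hk, mul_zero]

theorem evenCoeffs_one : EvenCoeffs 1 := fun k hk => by
  rw [PowerSeries.coeff_one, if_neg]
  rintro rfl
  exact hk (by simp)

theorem evenCoeffs_stepSer {A : Fin n → PowerSeries ℂ} (hA : ∀ j, EvenCoeffs (A j)) (q : ℂ)
    (l : Fin n) (j : Fin n) : EvenCoeffs (stepSer q l A j) := by
  rw [stepSer]
  split_ifs
  · exact evenCoeffs_one
  · exact (hA j).rescale _
  · exact (hA j).rescale _

theorem prodSer_eq_zero_of_odd {w : Fin n → Fin n → ℕ} {A : Fin n → PowerSeries ℂ}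
    (hA : ∀ j, EvenCoeffs (A j)) {E : Fin n →₀ ℕ} (hE : ¬ ∀ j, Even (E j)) :
    (prodSer A : QSeries n q w) E = 0 := by
  push Not at hE
  obtain ⟨j, hj⟩ := hE
  rw [prodSer, Finset.prod_eq_zero (Finset.mem_univ j) (hA j _ hj), mul_zero]

theorem evenPart_smul_prodSer {w : Fin n → Fin n → ℕ} {A : Fin n → PowerSeries ℂ}
    (hA : ∀ j, EvenCoeffs (A j)) (c : ℂ) :
    evenPart (c • prodSer A : QSeries n q w) = c • prodSer A := by
  funext E
  rw [evenPart]
  split_ifs with h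
  · rfl
  · rw [smul_apply, prodSer_eq_zero_of_odd hA h, mul_zero]

/-- The value of a summand of the partial integral. -/
theorem hasSum_partialTerm (hq0 : 0 < q) (l : Fin n) (h : ℤ) (ε : ℤˣ) (f : Cov n q) (c : ℂ)
    (z : Fin n → ℂ)
    (hf : Summable fun E => f E *
      monoVal (stepPoint q l (((ε : ℤ) : ℂ) * (q : ℂ) ^ (2 * h) * c) z) E) :
    HasSum (fun E => partialTerm l h ε f E * monoVal (Function.update z l c) E)
      ((1 - (q : ℂ) ^ 2) * ((q : ℂ) ^ (2 * h) * c) *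
        evalAt f (stepPoint q l (((ε : ℤ) : ℂ) * (q : ℂ) ^ (2 * h) * c) z)) := by
  have hq := cast_ne_zero hq0
  have hinj : Function.Injective fun E : Fin n →₀ ℕ => Finsupp.single l 1 + E :=
    add_right_injective _
  rw [← hinj.hasSum_iff]
  -- Only monomials containing x_l occur, owing to the left factor `gen l`.
  · have h1 : HasSum _ (evalAt f _) := hf.hasSum
    refine hasSum_of_eq (h1.mul_left ((1 - (q : ℂ) ^ 2) * ((q : ℂ) ^ (2 * h) * c))) (fun E => ?_) rfl
    simp only [Function.comp_apply]
    rw [partialTerm, smul_apply, gen, mono_mul_apply, if_pos le_self_add, add_tsub_cancel_left,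
      twist_single_left, monoVal_add, monoVal_single, Function.update_self, one_mul, rescale]
    -- Bringing the extra x_l into place past x_j with j < l costs q per letter, which turns the
    -- dilation q⁻² of these variables into the q⁻¹ of `stepPoint`.
    have h2 : (q : ℂ) ^ (∑ i, (if i < l then 1 else 0) * E i) *
        (monoVal (fun j => if j < l then (q : ℂ) ^ (-2 : ℤ)
          else if j = l then ((ε : ℤ) : ℂ) * (q : ℂ) ^ (2 * h) else 1) E *
            monoVal (Function.update z l c) E) =
        monoVal (stepPoint q l (((ε : ℤ) : ℂ) * (q : ℂ) ^ (2 * h) * c) z) E := by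
      rw [← Finset.prod_pow_eq_pow_sum, monoVal, monoVal, monoVal, ← Finset.prod_mul_distrib,
        ← Finset.prod_mul_distrib]
      refine Finset.prod_congr rfl fun j _ => ?_
      rw [stepPoint]
      rcases lt_trichotomy j l with hj | hj | hj
      · rw [if_pos hj, if_pos hj, if_pos hj, one_mul, Function.update_of_ne hj.ne, ← mul_pow,
          ← mul_pow]
        congr 1
        rw [show (q : ℂ) ^ (-2 : ℤ) = ((q : ℂ) ^ 2)⁻¹ by rw [zpow_neg]; rfl]
        field_simp
      · subst hj
        simp [mul_pow]
      · simp [hj.not_gt, hj.ne']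
    rw [← h2]
    ring
  · intro E hE
    rw [partialTerm, smul_apply, gen, mono_mul_apply, if_neg, mul_zero, zero_mul]
    intro hle
    exact hE ⟨E - Finsupp.single l 1, add_tsub_cancel_of_le hle⟩

/-- Integration of an even product series with respect to `x_l`. -/
theorem isPartialIntegral_prodSer (hq0 : 0 < q) (hq1 : q < 1) {A : Fin n → PowerSeries ℂ}
    (hA : ∀ j, Entire (A j)) (hA' : ∀ j, EvenCoeffs (A j)) (l : Fin n) (c : ℂ) {m k : ℤ}
    {P : Polynomial ℂ}
    (hAl : A l = PowerSeries.rescale ((q : ℂ) ^ m) (uSer q * (P : PowerSeries ℂ)))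
    (hmk : Even (k + m)) :
    IsPartialIntegral (q ^ k) l (c • prodSer A : Cov n q)
      ((c * ((q : ℂ) ^ (-m) * covFun hq0 hq1 P)) • prodSer (stepSer q l A)) := by
  intro z
  have hq := cast_ne_zero hq0
  have hcast : ((q ^ k : ℝ) : ℂ) = (q : ℂ) ^ k := by push_cast; rfl
  have hs : ∀ z, Summable fun E => (c • prodSer A : Cov n q) E * monoVal z E := fun z => by
    refine ((Summable.of_norm (summable_norm_prodSer (w := fun i j : Fin n => if j < i then 1 else 0)
      hq0 hq1 fun j => hA j (z j))).mul_left c).congr fun E => ?_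
    rw [smul_apply, mul_assoc]
  have hB := summable_norm_prodSer (w := fun i j : Fin n => if j < i then 1 else 0) hq0 hq1
    fun j => entire_stepSer hA q l j (z j)
  have heval : ∀ (d : ℂ) (A : Fin n → PowerSeries ℂ) z, evalAt (d • prodSer A : Cov n q) z =
      d * evalAt (prodSer A : Cov n q) z := fun d A z => by
    simp only [evalAt, smul_apply, mul_assoc, tsum_mul_left]
  rw [evenPart_smul_prodSer hA', hcast]
  refine ⟨fun h ε => (hasSum_partialTerm hq0 l h ε _ _ z (hs _)).summable, ?_, ?_⟩
  · refine ((Summable.of_norm hB).mul_left (c * ((q : ℂ) ^ (-m) * covFun hq0 hq1 P))).congr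
      fun E => ?_
    rw [smul_apply, ← mul_assoc]
  set g : {F : Fin n →₀ ℕ // F l = 0} → ℂ := fun F =>
    (prodSer (stepSer q l A) : Cov n q) F.1 * monoVal z F.1 with hg
  set H : ℂ → ℂ := fun t => P.eval t * pval (uSer q) t with hH
  have hAl' : ∀ t, pval (A l) t = H ((q : ℂ) ^ m * t) := fun t => by
    rw [hAl, pval_rescale, pval_mul (entire_uSer hq0 hq1 _) (entire_coe P _), pval_coe, mul_comm]
  -- the lattice in each fibre
  have hlat : ∀ F, g F ≠ 0 → ∃ s : ℤ, (q : ℂ) ^ m * ((q : ℂ) ^ k * (q : ℂ) ^ deg F.1) =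
      (q : ℂ) ^ (2 * s) * 1 := fun F hF => by
    -- A nonzero fibre has only even exponents, so its total degree dilates the lattice by a power
    -- of q².
    have hev : Even ((deg F.1 : ℕ) : ℤ) := by
      have h1 : ∀ j, Even (F.1 j) := by
        by_contra h
        exact hF (by rw [hg]; dsimp only; rw [prodSer_eq_zero_of_odd (evenCoeffs_stepSer hA' q l) h, zero_mul])
      rw [Int.even_coe_nat]
      exact Finset.even_sum _ fun j _ => h1 j
    obtain ⟨s, hs⟩ := hmk.add hev
    refine ⟨s, ?_⟩
    rw [mul_one, ← zpow_natCast, ← zpow_add₀ hq, ← zpow_add₀ hq]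
    congr 1
    linarith
  -- The double family over exponents of the other variables and lattice points. Absolute
  -- summability allows the sum over the lattice to be taken fibre by fibre.
  set S : {F : Fin n →₀ ℕ // F l = 0} × (ℤ × ℤˣ) → ℂ := fun y =>
    c * (g y.1 * ((q : ℂ) ^ (-m) *
      jackson q ((q : ℂ) ^ m * ((q : ℂ) ^ k * (q : ℂ) ^ deg y.1.1)) H y.2)) with hS
  have hbase := summable_jackson_uSer hq0 hq1 P
  have hsum1 : ∀ F, HasSum (fun x => S (F, x)) (c * (g F * ((q : ℂ) ^ (-m) * covFun hq0 hq1 P))) :=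
    fun F => by
      by_cases hF : g F = 0
      · simp only [hS, hF, zero_mul, mul_zero]; exact hasSum_zero
      · obtain ⟨s, hs⟩ := hlat F hF
        have h1 : HasSum (jackson q ((q : ℂ) ^ (2 * s) * 1) H) (covFun hq0 hq1 P) := by
          rw [covFun, jacksonFun_apply, ← tsum_jackson_shift hq 1 _ s]
          exact ((summable_jackson_shift hq 1 _ s).2 hbase).hasSum
        simp only [hS, hs]
        exact ((h1.mul_left _).mul_left _).mul_left _
  -- The norm sum over the lattice does not depend on F apart from ‖g F‖, so summability over F is
  -- that of the resulting entire series.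
  have hnorm : ∀ F, ∑' x, ‖S (F, x)‖ =
      ‖g F‖ * (‖c‖ * (‖(q : ℂ) ^ (-m)‖ * ∑' x, ‖jackson q 1 H x‖)) := fun F => by
    by_cases hF : g F = 0
    · simp only [hS, hF, zero_mul, mul_zero, norm_zero, tsum_zero]
    · obtain ⟨s, hs⟩ := hlat F hF
      rw [← tsum_norm_jackson_shift hq 1 _ s]
      simp only [hS, hs, norm_mul c, norm_mul (g F), norm_mul ((q : ℂ) ^ (-m)), tsum_mul_left]
      ring
  have hsumS : Summable S := by
    refine Summable.of_norm ((summable_prod_of_nonneg fun _ => norm_nonneg _).2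
      ⟨fun F => (hsum1 F).summable.norm, ?_⟩)
    simp only [hnorm]
    exact (hB.subtype _).mul_right _
  have htot := hsumS.hasSum
  have h1 := htot.prod_fiberwise hsum1
  have h2 : ∑' y, S y = evalAt ((c * ((q : ℂ) ^ (-m) * covFun hq0 hq1 P)) •
      prodSer (stepSer q l A) : Cov n q) z := by
    have h3 : ∑' F, g F = evalAt (prodSer (stepSer q l A) : Cov n q) z := by
      rw [evalAt]
      refine tsum_subtype_eq_of_support_subset (s := {F : Fin n →₀ ℕ | F l = 0})
        (f := fun F => (prodSer (stepSer q l A) : Cov n q) F * monoVal z F) fun F hF => ?_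
      by_contra hFl
      refine hF ?_
      have : PowerSeries.coeff (F l) (stepSer (q : ℂ) l A l) = 0 := by
        rw [stepSer, if_pos rfl, PowerSeries.coeff_one]
        exact if_neg hFl
      beta_reduce
      rw [prodSer, Finset.prod_eq_zero (Finset.mem_univ l) this, mul_zero, zero_mul]
    rw [heval, ← h3, ← h1.tsum_eq, ← tsum_mul_left]
    exact tsum_congr fun F => by ring
  rw [← h2]
  refine ((Equiv.prodComm _ _).hasSum_iff.2 htot).prod_fiberwise fun x => ?_
  have h4 := (((hasSum_prodSer_split hq0 hq1 hA l
    (((x.2 : ℤ) : ℂ) * (q : ℂ) ^ (2 * x.1) * (q : ℂ) ^ k) z).mul_left c).mul_left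
      ((1 - (q : ℂ) ^ 2) * ((q : ℂ) ^ (2 * x.1) * (q : ℂ) ^ k)))
  have h5 := (hasSum_partialTerm hq0 l x.1 x.2 _ ((q : ℂ) ^ k) z (hs _)).tsum_eq
  rw [heval] at h5
  rw [evalAt, h5]
  refine hasSum_of_eq h4 (fun F => ?_) rfl
  simp only [Function.comp_apply, Equiv.prodComm_apply, Prod.swap_prod_mk, hS, jackson, hAl', hg]
  have h6 : (q : ℂ) ^ m * ((((x.2 : ℤ) : ℂ) * (q : ℂ) ^ (2 * x.1) * (q : ℂ) ^ k) * (q : ℂ) ^ deg F.1) =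
      ((x.2 : ℤ) : ℂ) * (q : ℂ) ^ (2 * x.1) * ((q : ℂ) ^ m * ((q : ℂ) ^ k * (q : ℂ) ^ deg F.1)) := by
    ring
  have h7 := zpow_ne_zero m hq
  rw [h6, zpow_neg]
  field_simp

end Step

/-! ### Lattice order integrals and the transform of covector series -/

section Parity

open Polynomial

theorem coeff_eq_zero_of_parity {φ : PowerSeries ℂ} {s : ℤˣ}
    (h : PowerSeries.rescale (-1) φ = PowerSeries.C ((s : ℤ) : ℂ) * φ) {k : ℕ}
    (hk : ((-1) ^ k : ℤˣ) ≠ s) : PowerSeries.coeff k φ = 0 := by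
  have h1 := congr_arg (PowerSeries.coeff k) h
  rw [PowerSeries.coeff_rescale, PowerSeries.coeff_C_mul] at h1
  have h2 : ((-1 : ℂ) ^ k - ((s : ℤ) : ℂ)) * PowerSeries.coeff k φ = 0 := by
    linear_combination h1
  refine (mul_eq_zero.1 h2).resolve_left fun h3 => hk ?_
  have h4 : ((((-1) ^ k : ℤˣ) : ℤ) : ℂ) = ((s : ℤ) : ℂ) := by
    push_cast
    linear_combination h3
  exact Units.ext (by exact_mod_cast h4)

theorem rescale_neg_evenSer (a : ℕ → ℂ) : PowerSeries.rescale (-1) (evenSer a) = evenSer a := by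
  ext k
  rw [PowerSeries.coeff_rescale]
  by_cases hk : Even k
  · rw [hk.neg_one_pow, one_mul]
  · rw [coeff_evenSer_odd _ hk, mul_zero]

theorem HasParity.rescale_coe {s : ℤˣ} {p : ℂ[X]} (hp : HasParity s p) :
    PowerSeries.rescale (-1) (p : PowerSeries ℂ) = PowerSeries.C ((s : ℤ) : ℂ) * p := by
  rw [← coe_scaleArg, scaleArg, ← coe_C, ← coe_mul, ← hp]
  simp

theorem HasParity.X_pow_mul {s : ℤˣ} {p : ℂ[X]} (hp : HasParity s p) (k : ℕ) :
    HasParity ((-1) ^ k * s) (X ^ k * p) := by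
  rw [HasParity, mul_comp, hp, pow_comp, X_comp, neg_pow]
  push_cast
  simp only [map_mul, map_pow, map_neg, map_one]
  ring

theorem evenCoeffs_of_parity {φ : PowerSeries ℂ}
    (h : PowerSeries.rescale (-1) φ = PowerSeries.C (((1 : ℤˣ) : ℤ) : ℂ) * φ) : EvenCoeffs φ :=
  fun k hk => coeff_eq_zero_of_parity h (by
    rw [(Nat.not_even_iff_odd.1 hk).neg_one_pow]; decide)

theorem HasParity.uSer_mul {s : ℤˣ} {p : ℂ[X]} (hp : HasParity s p) (q : ℂ) :
    PowerSeries.rescale (-1) (uSer q * (p : PowerSeries ℂ)) =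
      PowerSeries.C ((s : ℤ) : ℂ) * (uSer q * p) := by
  rw [map_mul, hp.rescale_coe, uSer, rescale_neg_evenSer]
  ring

theorem HasParity.mul_eSer {s : ℤˣ} {p : ℂ[X]} (hp : HasParity s p) (q : ℂ) :
    PowerSeries.rescale (-1) ((p : PowerSeries ℂ) * eSer q) =
      PowerSeries.C ((s : ℤ) : ℂ) * (p * eSer q) := by
  rw [map_mul, hp.rescale_coe, eSer, rescale_neg_evenSer]
  ring

theorem rescale_parity {φ : PowerSeries ℂ} {s : ℂ}
    (h : PowerSeries.rescale (-1) φ = PowerSeries.C s * φ) (a : ℂ) :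
    PowerSeries.rescale (-1) (PowerSeries.rescale a φ) =
      PowerSeries.C s * PowerSeries.rescale a φ := by
  rw [PowerSeries.rescale_rescale, mul_comm a (-1), ← PowerSeries.rescale_rescale, h, map_mul, rescale_C]

end Parity

/-! ### Iterated integrals of product series and the weak Fourier transform -/

section Iterated

variable {n : ℕ} {q : ℝ}

/-- Odd factors do not contribute to the even part. -/
theorem evenPart_smul_prodSer_eq_zero {w : Fin n → Fin n → ℕ} {A : Fin n → PowerSeries ℂ}
    {j : Fin n} (hA : PowerSeries.rescale (-1) (A j) = PowerSeries.C (((-1 : ℤˣ) : ℤ) : ℂ) * A j)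
    (c : ℂ) : evenPart (c • prodSer A : QSeries n q w) = 0 := by
  funext E
  rw [evenPart, zero_apply]
  split_ifs with h
  · rw [smul_apply, prodSer, Finset.prod_eq_zero (Finset.mem_univ j), mul_zero, mul_zero]
    exact coeff_eq_zero_of_parity hA (by rw [(h j).neg_one_pow]; decide)
  · rfl

/-- Change of the scaling exponents of the remaining variables when `x_l` is integrated. -/
def stepExp (l : Fin n) (m : Fin n → ℤ) : Fin n → ℤ := fun j => m j - if j < l then 2 else 1

/-- The lattice meets the zeros of the `q`-exponentials in every step of the integration. -/
def LatticeOK (q : ℝ) (γ : Fin n → ℝ) : List (Fin n) → (Fin n → ℤ) → Prop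
  | [], _ => True
  | l :: ls, m => (∃ k : ℤ, γ l = q ^ k ∧ Even (k + m l)) ∧ LatticeOK q γ ls (stepExp l m)

/-- The exponent of `q` in the value of the iterated integral. -/
def shiftExp : List (Fin n) → (Fin n → ℤ) → ℤ
  | [], _ => 0
  | l :: ls, m => -m l + shiftExp ls (stepExp l m)

/-- Each step changes the exponents by amounts independent of m, so a change of the initial
exponents is carried through unaltered. -/
theorem shiftExp_eq (ls : List (Fin n)) (m m' : Fin n → ℤ) :
    shiftExp ls m = shiftExp ls m' + (ls.map fun j => m' j - m j).sum := by
  induction ls generalizing m m' with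
  | nil => simp [shiftExp]
  | cons l ls ih =>
    rw [shiftExp, shiftExp, ih _ (stepExp l m'), List.map_cons, List.sum_cons]
    have : (fun j => stepExp l m' j - stepExp l m j) = fun j => m' j - m j := by
      funext j; simp [stepExp]
    rw [this]; ring

/-- When its turn comes, the exponent of s k has been lowered once by each of the k earlier steps (k
counted from 0), and once more by each earlier step with a larger index. -/
theorem latticeOK_ofFn {N : ℕ} (γ : Fin n → ℝ) (s : Fin N → Fin n) (m : Fin n → ℤ)
    (h : ∀ k, ∃ c : ℤ, γ (s k) = q ^ c ∧ Even (c + m (s k) - (k : ℕ) -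
      ((Finset.univ.filter fun j : Fin N => j < k ∧ s k < s j).card : ℕ))) :
    LatticeOK q γ (List.ofFn s) m := by
  induction N generalizing m with
  | zero => rw [List.ofFn_zero]; trivial
  | succ N ih =>
    rw [List.ofFn_succ]
    refine ⟨?_, ih _ _ fun k => ?_⟩
    · obtain ⟨c, hc, he⟩ := h 0
      refine ⟨c, hc, ?_⟩
      simpa using he
    · obtain ⟨c, hc, he⟩ := h k.succ
      refine ⟨c, hc, ?_⟩
      rw [Fin.card_filter_univ_succ] at he
      simp only [Fin.succ_pos, true_and, Fin.succ_lt_succ_iff] at he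
      convert he using 1
      rw [stepExp, Fin.val_succ]
      split_ifs <;> (push_cast; ring)

/-- The class of even products of dilated factors is stable under a step: integrated factors become
1, the remaining ones change only their exponent m. The induction therefore runs over arbitrary m
and scalar c. -/
theorem hasIteratedIntegral_prodSer (hq0 : 0 < q) (hq1 : q < 1) {γ : Fin n → ℝ}
    {ls : List (Fin n)} (hls : ls.Nodup) {m : Fin n → ℤ} {P : Fin n → Polynomial ℂ}
    {A : Fin n → PowerSeries ℂ}
    (hA : ∀ j ∈ ls, A j = PowerSeries.rescale ((q : ℂ) ^ m j) (uSer q * (P j : PowerSeries ℂ)))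
    (hA' : ∀ j, j ∉ ls → A j = 1) (hP : ∀ j, HasParity 1 (P j)) (hm : LatticeOK q γ ls m) (c : ℂ) :
    HasIteratedIntegral γ ls (c • prodSer A : Cov n q)
      (c * ((q : ℂ) ^ shiftExp ls m * (ls.map fun j => covFun hq0 hq1 (P j)).prod)) := by
  have hq := cast_ne_zero hq0
  induction ls generalizing m A c with
  | nil =>
    have h1 : ∀ j, A j = 1 := fun j => hA' j (by simp)
    simp [HasIteratedIntegral, smul_apply, prodSer, h1, cross, shiftExp]
  | cons l ls ih =>
    obtain ⟨⟨k, hk, hkm⟩, hm⟩ := hm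
    rw [List.nodup_cons] at hls
    have hent : ∀ j, Entire (A j) := fun j => by
      by_cases hj : j ∈ l :: ls
      · rw [hA j hj]
        exact ((entire_uSer hq0 hq1).mul (entire_coe _)).rescale _
      · rw [hA' j hj, ← Polynomial.coe_one]
        exact entire_coe 1
    have hev : ∀ j, EvenCoeffs (A j) := fun j => by
      by_cases hj : j ∈ l :: ls
      · rw [hA j hj]
        exact (evenCoeffs_of_parity ((hP j).uSer_mul q)).rescale _
      · rw [hA' j hj]
        exact evenCoeffs_one
    refine ⟨(c * ((q : ℂ) ^ (-m l) * covFun hq0 hq1 (P l))) • prodSer (stepSer q l A), ?_, ?_⟩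
    · rw [hk]
      exact isPartialIntegral_prodSer hq0 hq1 hent hev l c (hA l (by simp)) hkm
    · have h1 := ih hls.2 (m := stepExp l m) (A := stepSer q l A) (fun j hj => ?_) (fun j hj => ?_) hm
        (c * ((q : ℂ) ^ (-m l) * covFun hq0 hq1 (P l)))
      · convert h1 using 1
        rw [shiftExp, zpow_add₀ hq, List.map_cons, List.prod_cons]
        ring
      · have hjl : j ≠ l := by rintro rfl; exact hls.1 hj
        rw [stepSer, if_neg hjl, hA j (List.mem_cons_of_mem _ hj), PowerSeries.rescale_rescale]
        congr 2
        rw [stepExp, zpow_sub₀ hq, div_eq_mul_inv]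
        congr 2
        split_ifs
        · rfl
        · simp
      · rw [stepSer]
        by_cases hjl : j = l
        · rw [if_pos hjl]
        · rw [if_neg hjl, hA' j (by simp [hjl, hj]), map_one]

/-- `∑_{i > j} fᵢ`. -/
def upSum (F : Fin n →₀ ℕ) (j : Fin n) : ℕ := ∑ i, if j < i then F i else 0

/-- Supplies the power of q that cancels the factors q^{1-j} in the arguments of exp; indices in
`Fin n` start at 0. -/
theorem sum_upSum (F : Fin n →₀ ℕ) : ∑ j, upSum F j = ∑ j : Fin n, (j : ℕ) * F j := by
  unfold upSum
  rw [Finset.sum_comm]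
  refine Finset.sum_congr rfl fun i _ => ?_
  rw [← Finset.sum_filter, Finset.sum_const, smul_eq_mul, Finset.filter_gt_eq_Iio, Fin.card_Iio]

theorem twist_cov_add (E F : Fin n →₀ ℕ) :
    twist (fun i j : Fin n => if j < i then 1 else 0) E F + pairSum E +
      ∑ j, upSum F j * (E + F) j = pairSum (E + F) := by
  have h1 : ∑ j, upSum F j * (E + F) j = ∑ i, ∑ j, if j < i then F i * (E + F) j else 0 := by
    simp only [upSum, Finset.sum_mul]
    rw [Finset.sum_comm]
    exact Finset.sum_congr rfl fun i _ => Finset.sum_congr rfl fun j _ => by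
      split_ifs <;> simp
  rw [h1, twist, pairSum, pairSum, ← Finset.sum_add_distrib, ← Finset.sum_add_distrib]
  refine Finset.sum_congr rfl fun i _ => ?_
  rw [← Finset.sum_add_distrib, ← Finset.sum_add_distrib]
  refine Finset.sum_congr rfl fun j _ => ?_
  split_ifs
  · simp only [Finsupp.add_apply]; ring
  · simp

/-- Absorbs x^F into the factors. The target reordering cost of the full exponent overcounts by
`upSum F j` for each x_j, so that factor is dilated by the corresponding negative power. -/
theorem prodSer_mul_mono (hq0 : 0 < q) (A : Fin n → PowerSeries ℂ) (c : ℂ) (F : Fin n →₀ ℕ) :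
    (c • prodSer A * mono F : Cov n q) =
      c • prodSer fun j => PowerSeries.rescale ((q : ℂ) ^ (-(upSum F j : ℤ)))
        (PowerSeries.X ^ F j * A j) := by
  have hq := cast_ne_zero hq0
  rw [smul_mul_assoc]
  congr 1
  funext G
  rw [mul_mono_apply]
  split_ifs with h
  · obtain ⟨E, rfl⟩ := exists_add_of_le h
    rw [add_comm F E, add_tsub_cancel_right, prodSer, prodSer, cross_cov, cross_cov, ← twist_cov_add]
    have h1 : ∏ j, PowerSeries.coeff ((E + F) j) (PowerSeries.rescale
        ((q : ℂ) ^ (-(upSum F j : ℤ))) (PowerSeries.X ^ F j * A j)) =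
        ((q : ℂ) ^ ∑ j, upSum F j * (E + F) j)⁻¹ * ∏ j, PowerSeries.coeff (E j) (A j) := by
      rw [← Finset.prod_pow_eq_pow_sum, ← Finset.prod_inv_distrib, ← Finset.prod_mul_distrib]
      refine Finset.prod_congr rfl fun j _ => ?_
      rw [PowerSeries.coeff_rescale, Finsupp.add_apply, PowerSeries.coeff_X_pow_mul, zpow_neg,
        inv_pow, zpow_natCast, ← pow_mul]
    rw [h1, pow_add, pow_add]
    have h2 := pow_ne_zero (∑ j, upSum F j * (E + F) j) hq
    field_simp
  · have : ∃ j, ¬ F j ≤ G j := by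
      by_contra h'
      push Not at h'
      exact h h'
    obtain ⟨j, hj⟩ := this
    rw [prodSer, Finset.prod_eq_zero (Finset.mem_univ j), mul_zero]
    rw [PowerSeries.coeff_rescale, PowerSeries.coeff_X_pow_mul', if_neg hj, mul_zero]

theorem inC_smul_prodSer (hq0 : 0 < q) (hq1 : q < 1) {w : Fin n → Fin n → ℕ}
    {A : Fin n → PowerSeries ℂ} (hA : ∀ j, Entire (A j)) (c : ℂ) :
    InC (c • prodSer A : QSeries n q w) := by
  refine ⟨1, one_pos, ?_⟩
  have h := (summable_norm_prodSer (w := w) hq0 hq1 (z := fun _ => 1) fun j => hA j 1).mul_left ‖c‖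
  refine h.congr fun E => ?_
  simp [smul_apply, monoVal]

/-- The lattice order integrals of a covector series times monomials. -/
theorem hasIteratedIntegral_covSeries_mul_mono (hq0 : 0 < q) (hq1 : q < 1)
    {σ : Equiv.Perm (Fin n)} {γ : Fin n → ℝ} {p : Fin n → Polynomial ℂ} {F : Fin n →₀ ℕ}
    {s : Fin n → ℤˣ} (hs : ∀ j, HasParity (s j) (Polynomial.X ^ F j * p j))
    (hγ : (∀ j, s j = 1) → ∀ k, ∃ c : ℤ, γ (σ k) = q ^ c ∧ Even (c - upSum F (σ k) - (k : ℕ) -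
      ((Finset.univ.filter fun j : Fin n => j < k ∧ σ k < σ j).card : ℕ))) (c : ℂ) :
    HasIteratedIntegral γ (List.ofFn σ) (c • covSeries q p * mono F : Cov n q)
      (c * ((q : ℂ) ^ shiftExp (List.ofFn σ) 0 * (q : ℂ) ^ (∑ j : Fin n, (j : ℕ) * F j) *
        ∏ j, covFun hq0 hq1 (Polynomial.X ^ F j * p j))) := by
  have hq := cast_ne_zero hq0
  have hA : ∀ j, PowerSeries.X ^ F j * (uSer (q : ℂ) * (p j : PowerSeries ℂ)) =
      uSer (q : ℂ) * ((Polynomial.X ^ F j * p j : Polynomial ℂ) : PowerSeries ℂ) := fun j => by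
    simp only [Polynomial.coe_mul, Polynomial.coe_pow, Polynomial.coe_X]
    ring
  rw [covSeries_eq, prodSer_mul_mono hq0]
  simp only [hA]
  -- If some factor is odd, the even part is zero and so is the corresponding moment. The lattice
  -- condition is needed only in the all-even case.
  by_cases h1 : ∀ j, s j = 1
  · have h2 := hasIteratedIntegral_prodSer hq0 hq1 (γ := γ) (ls := List.ofFn σ)
      (List.nodup_ofFn.2 σ.injective) (m := fun j => -(upSum F j : ℤ))
      (P := fun j => Polynomial.X ^ F j * p j) (fun j _ => rfl)
      (fun j hj => absurd (List.mem_ofFn.2 (σ.surjective j)) hj) (fun j => h1 j ▸ hs j)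
      (latticeOK_ofFn γ σ _ fun k => by simpa only [← sub_eq_add_neg] using hγ h1 k) c
    convert h2 using 3
    · rw [shiftExp_eq (List.ofFn σ) (fun j => -(upSum F j : ℤ)) 0, zpow_add₀ hq]
      congr 1
      rw [List.map_ofFn, List.sum_ofFn, ← sum_upSum, ← zpow_natCast]
      congr 1
      simp only [Function.comp_apply, Pi.zero_apply, sub_neg_eq_add, zero_add]
      rw [Equiv.sum_comp σ fun j => (upSum F j : ℤ)]
      push_cast
      rfl
    · rw [List.map_ofFn, List.prod_ofFn]
      exact (Equiv.prod_comp σ fun j => covFun hq0 hq1 (Polynomial.X ^ F j * p j)).symm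
  · push Not at h1
    obtain ⟨j, hj⟩ := h1
    have hj : s j = -1 := (Int.units_eq_one_or (s j)).resolve_left hj
    have h2 : ∏ j, covFun hq0 hq1 (Polynomial.X ^ F j * p j) = 0 :=
      Finset.prod_eq_zero (Finset.mem_univ j) (covFun_odd hq0 hq1 (hj ▸ hs j))
    rw [h2, mul_zero, mul_zero]
    refine hasIteratedIntegral_zero γ ?_ (evenPart_smul_prodSer_eq_zero (j := j) ?_ c)
    · intro h
      have := List.mem_ofFn.2 (σ.surjective j)
      rw [h] at this
      exact absurd this (by simp)
    · exact rescale_parity ((hj ▸ hs j).uSer_mul q) _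

theorem loIntegrable_covSeries_mul_mono (hq0 : 0 < q) (hq1 : q < 1)
    {σ : Equiv.Perm (Fin n)} {γ : Fin n → ℝ} {p : Fin n → Polynomial ℂ} {F : Fin n →₀ ℕ}
    {s : Fin n → ℤˣ} (hs : ∀ j, HasParity (s j) (Polynomial.X ^ F j * p j))
    (hγ : (∀ j, s j = 1) → ∀ k, ∃ c : ℤ, γ (σ k) = q ^ c ∧ Even (c - upSum F (σ k) - (k : ℕ) -
      ((Finset.univ.filter fun j : Fin n => j < k ∧ σ k < σ j).card : ℕ))) (c : ℂ) :
    LOIntegrable σ γ (c • covSeries q p * mono F : Cov n q) := by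
  refine ⟨?_, _, hasIteratedIntegral_covSeries_mul_mono hq0 hq1 hs hγ c⟩
  rw [covSeries_eq, prodSer_mul_mono hq0]
  refine inC_smul_prodSer hq0 hq1 (fun j => Entire.rescale ?_ _) c
  have : (PowerSeries.X ^ F j : PowerSeries ℂ) = ((Polynomial.X ^ F j : Polynomial ℂ) : PowerSeries ℂ) := by
    simp
  rw [this]
  exact (entire_coe _).mul ((entire_uSer hq0 hq1).mul (entire_coe _))

theorem expCov_eq (c : Fin n → ℂ) (F : Fin n →₀ ℕ) :
    expCov q c F = (monoVal c F / ∏ j, qFactorial ((q : ℂ) ^ 2) (F j)) • mono F := by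
  funext E
  rw [smul_apply, expCov, expCoeff, mono]
  split_ifs <;> simp

/-- The transform of a covector series. -/
theorem weakFourier_covSeries (hq0 : 0 < q) (hq1 : q < 1)
    {σ : Equiv.Perm (Fin n)} {γ : Fin n → ℝ} {p : Fin n → Polynomial ℂ} {β : Fin n → ℤˣ}
    (hp : ∀ j, HasParity (β j) (p j))
    (hγ : ∀ F : Fin n →₀ ℕ, (∀ j, (-1) ^ F j * β j = 1) → ∀ k, ∃ c : ℤ, γ (σ k) = q ^ c ∧
      Even (c - upSum F (σ k) - (k : ℕ) -
      ((Finset.univ.filter fun j : Fin n => j < k ∧ σ k < σ j).card : ℕ))) (c : ℂ) :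
    weakFourier σ γ (c • covSeries q p) =
      (c * ((q : ℂ) ^ shiftExp (List.ofFn σ) 0 * covFun hq0 hq1 1 ^ n)) •
        vecSeries q fun j => polyV (q : ℂ) (p j) := by
  have hq := cast_ne_zero hq0
  have hp2 := pow_pow_ne_one (cast_pow_ne_one hq0 hq1) (show 2 ≠ 0 by decide)
  funext F
  rw [weakFourier, expCov_eq, mul_smul_comm, ← smul_mul_assoc, smul_smul,
    loIntegral_eq (hasIteratedIntegral_covSeries_mul_mono hq0 hq1
      (fun j => (hp j).X_pow_mul (F j)) (hγ F) _), smul_apply, vecSeries_eq, prodSer, cross_vec,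
    pow_zero, one_mul]
  -- One-variable transform in each coordinate; the q^{j f_j} from the integral cancels the inverse
  -- power in the argument of exp.
  have h1 : ∀ j : Fin n, covFun hq0 hq1 1 * PowerSeries.coeff (F j)
      ((polyV (q : ℂ) (p j) : PowerSeries ℂ) * eSer q) =
      (Complex.I / (1 - (q : ℂ) ^ 2) * ((q : ℂ) ^ (j : ℕ))⁻¹) ^ F j /
        qFactorial ((q : ℂ) ^ 2) (F j) * (q : ℂ) ^ ((j : ℕ) * F j) *
        covFun hq0 hq1 (Polynomial.X ^ F j * p j) := fun j => by
    have h2 := congr_arg (PowerSeries.coeff (F j)) (momentV_covFun hq0 hq1 (p j))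
    rw [PowerSeries.coeff_C_mul] at h2
    rw [← h2, momentV, PowerSeries.coeff_mk, qPoch_eq_qFactorial hp2]
    have h3 : (q : ℂ) ^ ((j : ℕ) * F j) ≠ 0 := pow_ne_zero _ hq
    rw [mul_pow, div_pow, inv_pow, ← pow_mul]
    have h4 : (1 - (q : ℂ) ^ 2) ^ F j ≠ 0 :=
      pow_ne_zero _ (sub_ne_zero.2 (cast_pow_ne_one hq0 hq1 2 two_ne_zero).symm)
    have h5 : qFactorial ((q : ℂ) ^ 2) (F j) ≠ 0 := by
      have := qPoch_self_ne_zero hp2 (F j)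
      rw [qPoch_eq_qFactorial hp2] at this
      exact right_ne_zero_of_mul this
    field_simp
  have h6 : covFun hq0 hq1 1 ^ n * ∏ j, PowerSeries.coeff (F j)
      ((polyV (q : ℂ) (p j) : PowerSeries ℂ) * eSer q) =
      monoVal (fun j => Complex.I / (1 - (q : ℂ) ^ 2) * ((q : ℂ) ^ (j : ℕ))⁻¹) F /
        (∏ j, qFactorial ((q : ℂ) ^ 2) (F j)) * (q : ℂ) ^ (∑ j : Fin n, (j : ℕ) * F j) *
        ∏ j, covFun hq0 hq1 (Polynomial.X ^ F j * p j) := by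
    rw [monoVal, ← Finset.prod_pow_eq_pow_sum, ← Finset.prod_div_distrib, ← Finset.prod_mul_distrib,
      ← Finset.prod_mul_distrib, ← Finset.prod_congr rfl fun j _ => h1 j, Finset.prod_mul_distrib]
    simp
  linear_combination (-c * (q : ℂ) ^ shiftExp (List.ofFn σ) 0) * h6

end Iterated

/-! ### Right integrals and the transform of vector series -/

section Continuation

variable {n : ℕ} {q : ℝ}

/-- A ball inside both neighbourhoods U gives a convex, hence connected, tube containing 0 and ℝⁿ,
on which the identity theorem applies. Real points are all that the Jackson integral sees. -/
theorem IsContinuation.eq_ofReal {f : Vec n q} {G G' : (Fin n → ℂ) → ℂ} (h : IsContinuation f G)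
    (h' : IsContinuation f G') (t : Fin n → ℝ) : G (fun j => t j) = G' fun j => t j := by
  obtain ⟨⟨U, hU, hU0, hG⟩, hs⟩ := h
  obtain ⟨⟨U', hU', hU0', hG'⟩, hs'⟩ := h'
  obtain ⟨r, hr, hball⟩ := Metric.isOpen_iff.1 (hU.inter hU') 0 ⟨hU0, hU0'⟩
  set V : Set (Fin n → ℂ) := {w | (fun j => (w j).im) ∈ Metric.ball (0 : Fin n → ℝ) r} with hV
  have hconv : Convex ℝ V :=
    (convex_ball (0 : Fin n → ℝ) r).is_linear_preimage (f := fun w : Fin n → ℂ => fun j => (w j).im)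
      ⟨fun x y => by funext j; simp, fun c x => by funext j; simp⟩
  have h0 : (fun j => ((0 : ℝ) : ℂ)) ∈ V := by
    simp only [hV, Set.mem_ofPred_eq, Complex.ofReal_im]
    exact Metric.mem_ball_self hr
  have ht : (fun j => (t j : ℂ)) ∈ V := by
    simp only [hV, Set.mem_ofPred_eq, Complex.ofReal_im]
    exact Metric.mem_ball_self hr
  refine AnalyticOnNhd.eqOn_of_preconnected_of_eventuallyEq (hG.mono fun w hw => (hball hw).1)
    (hG'.mono fun w hw => (hball hw).2) hconv.isPreconnected h0 ?_ ht
  have hz : (fun _ => ((0 : ℝ) : ℂ) : Fin n → ℂ) = 0 := by funext; simp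
  rw [hz]
  filter_upwards [hs, hs'] with w hw hw' using hw.unique hw'

theorem continuation_ofReal {f : Vec n q} {G : (Fin n → ℂ) → ℂ} (h : IsContinuation f G)
    (t : Fin n → ℝ) : continuation f (fun j => t j) = G fun j => t j := by
  have h1 : ∃ G, IsContinuation f G := ⟨G, h⟩
  rw [continuation, dif_pos h1]
  exact h1.choose_spec.eq_ofReal h t

/-- In the vector algebra the decreasing product is already in basis order, so its realization is
literally the product of the one-variable functions. -/
theorem isContinuation_prodSer {A : Fin n → PowerSeries ℂ}
    {H : Fin n → ℂ → ℂ} (hH : ∀ j w, |w.im| < 1 → AnalyticAt ℂ (H j) w)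
    (hA : ∀ j, ∀ᶠ w in 𝓝 (0 : ℂ), ConvAt (A j) w ∧ pval (A j) w = H j w) (c : ℂ) :
    IsContinuation (c • prodSer A : Vec n q) fun w => c * ∏ j, H j (w j) := by
  refine ⟨⟨Metric.ball 0 1, Metric.isOpen_ball, Metric.mem_ball_self one_pos, fun w hw => ?_⟩, ?_⟩
  · refine analyticAt_const.mul (Finset.analyticAt_fun_prod _ fun j _ => ?_)
    have h1 : |(w j).im| < 1 := by
      have := (dist_pi_lt_iff one_pos).1 (Metric.mem_ball.1 hw) j
      simpa using this
    have h2 : AnalyticAt ℂ (fun w : Fin n → ℂ => w j) w :=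
      (ContinuousLinearMap.proj (R := ℂ) (φ := fun _ : Fin n => ℂ) j).analyticAt w
    exact AnalyticAt.fun_comp (hH j (w j) h1) h2
  · have h1 : ∀ᶠ w in 𝓝 (0 : Fin n → ℂ), ∀ j, ConvAt (A j) (w j) ∧ pval (A j) (w j) = H j (w j) :=
      eventually_all.2 fun j => ((continuous_apply j).tendsto (0 : Fin n → ℂ)).eventually (hA j)
    filter_upwards [h1] with w hw
    have h2 : (fun E : Fin n →₀ ℕ => (c • prodSer A : Vec n q) E * monoVal w E) =
        fun E : Fin n →₀ ℕ => c * ∏ j, PowerSeries.coeff (E j) (A j) * w j ^ E j := by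
      funext E
      rw [smul_apply, prodSer, cross_vec, pow_zero, one_mul, monoVal, mul_assoc,
        ← Finset.prod_mul_distrib]
    rw [h2]
    refine HasSum.mul_left c ?_
    have h3 : ∏ j, H j (w j) =
        ∑' E : Fin n →₀ ℕ, ∏ j, PowerSeries.coeff (E j) (A j) * w j ^ E j := by
      rw [tsum_prod_finsupp (fun j k => PowerSeries.coeff k (A j) * w j ^ k) fun j => (hw j).1]
      exact Finset.prod_congr rfl fun j _ => (hw j).2.symm
    rw [h3]
    exact (Summable.of_norm (summable_norm_prod_finsupp
      (fun j k => PowerSeries.coeff k (A j) * w j ^ k) fun j => (hw j).1)).hasSum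

theorem jacksonTerm_eq {f : Vec n q} {H : Fin n → ℂ → ℂ} {c : ℂ}
    (h : IsContinuation f fun w => c * ∏ j, H j (w j)) (a : Fin n → ℝ)
    (p : (Fin n → ℤ) × (Fin n → ℤˣ)) :
    jacksonTerm q a (continuation f) p = c * ∏ j, jackson q (a j) (H j) (p.1 j, p.2 j) := by
  have h1 : (fun j => ((p.2 j : ℤ) : ℂ) * (q : ℂ) ^ (2 * p.1 j) * (a j : ℂ)) =
      fun j => ((((p.2 j : ℤ) : ℝ) * q ^ (2 * p.1 j) * a j : ℝ) : ℂ) := by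
    funext j; push_cast; rfl
  rw [jacksonTerm, h1, continuation_ofReal h, ← h1]
  simp only [jackson, Finset.prod_mul_distrib, Finset.prod_const, Finset.card_univ,
    Fintype.card_fin]
  ring

theorem hasSum_jacksonTerm {f : Vec n q} {H : Fin n → ℂ → ℂ} {c : ℂ}
    (h : IsContinuation f fun w => c * ∏ j, H j (w j)) (a : Fin n → ℝ)
    (hs : ∀ j, Summable (jackson q (a j) (H j))) :
    HasSum (jacksonTerm q a (continuation f)) (c * ∏ j, ∑' x, jackson q (a j) (H j) x) := by
  obtain ⟨h1, h2⟩ := summable_norm_prod_pi (fun j => jackson q (a j) (H j)) fun j => (hs j).norm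
  have h3 := (Equiv.arrowProdEquivProdArrow (Fin n) (fun _ => ℤ) fun _ => ℤˣ).symm.hasSum_iff.2
    (Summable.of_norm h1).hasSum
  rw [h2] at h3
  exact hasSum_of_eq (h3.mul_left c) (jacksonTerm_eq h a) rfl

end Continuation

/-! ### Integrals of vector series and the inverse transform -/

section VectorSeries

variable {n : ℕ} {q : ℝ}

/-- `∑_{i < j} eᵢ`. -/
def lowSum (E : Fin n →₀ ℕ) (j : Fin n) : ℕ := ∑ i, if i < j then E i else 0

/-- Measures the total Jacobian of the dilations below; it is cancelled by the factors q^{n-j} in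
the arguments of exp. -/
theorem sum_lowSum (E : Fin n →₀ ℕ) : ∑ j, lowSum E j = ∑ j : Fin n, (Fin.rev j : ℕ) * E j := by
  unfold lowSum
  rw [Finset.sum_comm]
  refine Finset.sum_congr rfl fun i _ => ?_
  rw [← Finset.sum_filter, Finset.sum_const, smul_eq_mul, Finset.filter_lt_eq_Ioi, Fin.card_Ioi,
    Fin.val_rev]
  congr 1
  omega

theorem sum_lowSum_mul (E F : Fin n →₀ ℕ) :
    ∑ j, lowSum E j * F j = twist (fun i j : Fin n => if i < j then 1 else 0) E F := by
  simp only [lowSum, Finset.sum_mul]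
  rw [Finset.sum_comm]
  exact Finset.sum_congr rfl fun i _ => Finset.sum_congr rfl fun j _ => by
    by_cases h : i < j <;> simp [h]

theorem sum_lowSum_mul_self (E : Fin n →₀ ℕ) : ∑ j, lowSum E j * E j = pairSum E := by
  simp only [lowSum, Finset.sum_mul]
  exact Finset.sum_congr rfl fun i _ => Finset.sum_congr rfl fun j _ => by
    split_ifs
    · ring
    · simp

/-- The one-variable factors of a monomial times a vector series. -/
def vecFactor (q : ℂ) (e m : ℕ) (r : Polynomial ℂ) : PowerSeries ℂ :=
  PowerSeries.X ^ e * PowerSeries.rescale (q ^ m) ((r : PowerSeries ℂ) * eSer q)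

/-- The function realizing `vecFactor`. -/
def vecFactorFun (q : ℂ) (e m : ℕ) (r : Polynomial ℂ) (w : ℂ) : ℂ :=
  w ^ e * (r.eval (q ^ m * w) * (pval (vSer q) (q ^ m * w))⁻¹)

/-- A letter ∂_i of the monomial moving right past ∂_j with i < j costs q, hence the dilation of the
jth factor by `lowSum E j`. -/
theorem mono_mul_vecSeries (r : Fin n → Polynomial ℂ) (c : ℂ) (E : Fin n →₀ ℕ) :
    (mono E * c • vecSeries q r : Vec n q) =
      c • prodSer fun j => vecFactor q (E j) (lowSum E j) (r j) := by
  rw [mul_smul_comm, vecSeries_eq]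
  congr 1
  funext G
  rw [mono_mul_apply]
  split_ifs with h
  · obtain ⟨F, rfl⟩ := exists_add_of_le h
    rw [add_tsub_cancel_left, prodSer, prodSer, cross_vec, cross_vec, ← sum_lowSum_mul, pow_zero,
      one_mul, one_mul, ← Finset.prod_pow_eq_pow_sum, ← Finset.prod_mul_distrib]
    refine Finset.prod_congr rfl fun j _ => ?_
    rw [vecFactor, Finsupp.add_apply, add_comm (E j), PowerSeries.coeff_X_pow_mul,
      PowerSeries.coeff_rescale, ← pow_mul]
  · have : ∃ j, ¬ E j ≤ G j := by
      by_contra h'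
      push Not at h'
      exact h h'
    obtain ⟨j, hj⟩ := this
    rw [prodSer, Finset.prod_eq_zero (Finset.mem_univ j), mul_zero]
    rw [vecFactor, PowerSeries.coeff_X_pow_mul', if_neg hj]

theorem vecFactor_parity {s : ℤˣ} {r : Polynomial ℂ} (hr : HasParity s r) (q : ℂ) (e m : ℕ) :
    PowerSeries.rescale (-1) (vecFactor q e m r) =
      PowerSeries.C ((((-1) ^ e * s : ℤˣ) : ℤ) : ℂ) * vecFactor q e m r := by
  have h : PowerSeries.rescale (-1 : ℂ) PowerSeries.X = -PowerSeries.X := by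
    rw [PowerSeries.rescale_X]; simp
  rw [vecFactor, map_mul, map_pow, h, rescale_parity (hr.mul_eSer q), neg_pow]
  push_cast
  simp only [map_mul, map_pow, map_neg, map_one]
  ring

section

variable (hq0 : 0 < q) (hq1 : q < 1)
include hq0 hq1

theorem eventually_vecFactor (e m : ℕ) (r : Polynomial ℂ) : ∀ᶠ w in 𝓝 (0 : ℂ),
    ConvAt (vecFactor q e m r) w ∧ pval (vecFactor q e m r) w = vecFactorFun q e m r w := by
  have h4 := one_sub_pow_four_pos hq0 hq1
  have hc : Tendsto (fun w : ℂ => ‖(q : ℂ) ^ m * w‖ ^ 2) (𝓝 0) (𝓝 (‖(q : ℂ) ^ m * 0‖ ^ 2)) :=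
    Continuous.tendsto (by fun_prop) 0
  rw [mul_zero, norm_zero, zero_pow two_ne_zero] at hc
  filter_upwards [hc.eventually_le_const (show 0 < (1 - q ^ 4) / 2 by linarith)] with w hw
  have hX : (PowerSeries.X ^ e : PowerSeries ℂ) = ((Polynomial.X ^ e : Polynomial ℂ) : PowerSeries ℂ) := by
    simp
  have h1 := (entire_coe r ((q : ℂ) ^ m * w)).mul (convAt_eSer hq0 hq1 hw)
  have h2 := entire_coe (Polynomial.X ^ e) w
  rw [vecFactor, hX]
  refine ⟨h2.mul (convAt_rescale h1), ?_⟩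
  rw [pval_mul h2 (convAt_rescale h1), pval_rescale,
    pval_mul (entire_coe r _) (convAt_eSer hq0 hq1 hw), pval_coe, pval_coe, pval_eSer hq0 hq1 hw,
    vecFactorFun]
  simp

theorem analyticAt_vecFactorFun (e m : ℕ) (r : Polynomial ℂ) {w : ℂ} (hw : |w.im| < 1) :
    AnalyticAt ℂ (vecFactorFun q e m r) w := by
  have hopen : IsOpen {w : ℂ | |w.im| < 1} :=
    isOpen_lt (continuous_abs.comp Complex.continuous_im) continuous_const
  have hd : DifferentiableOn ℂ (vecFactorFun q e m r) {w : ℂ | |w.im| < 1} := fun z hz => by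
    have hm : DifferentiableAt ℂ (fun w : ℂ => (q : ℂ) ^ m * w) z := by fun_prop
    have him : |((q : ℂ) ^ m * z).im| < 1 := by
      rw [← Complex.ofReal_pow, Complex.im_ofReal_mul, abs_mul, abs_of_nonneg (by positivity)]
      exact lt_of_le_of_lt (mul_le_of_le_one_left (abs_nonneg _) (pow_le_one₀ hq0.le hq1.le)) hz
    refine DifferentiableAt.differentiableWithinAt ?_
    refine (differentiableAt_id.pow e).mul (DifferentiableAt.mul ?_ (DifferentiableAt.fun_inv ?_
      (pval_vSer_ne_zero hq0 hq1 him)))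
    · exact (r.differentiable _).comp z hm
    · exact ((entire_vSer hq0 hq1).differentiable _).comp z hm
  exact hd.analyticAt (hopen.mem_nhds hw)

/-- Substituting q^m t for t costs q^{-m} in the measure and q^{-me} in the monomial, and moves the
lattice to the generator q^m a. -/
theorem hasSum_jackson_vecFactorFun (e m : ℕ) (r : Polynomial ℂ) {a : ℝ} (ha : a ≠ 0) :
    HasSum (jackson q a (vecFactorFun q e m r))
      (((q : ℂ) ^ (m * (e + 1)))⁻¹ * vecFun hq0 hq1
        (mul_ne_zero (pow_ne_zero m hq0.ne') ha) (Polynomial.X ^ e * r)) := by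
  have hq := pow_ne_zero m (cast_ne_zero hq0)
  have h1 := (summable_jackson_vSer hq0 hq1 (mul_ne_zero (pow_ne_zero m hq0.ne') ha)
    (Polynomial.X ^ e * r)).hasSum.mul_left ((q : ℂ) ^ (m * (e + 1)))⁻¹
  refine hasSum_of_eq h1 (fun x => ?_) rfl
  push_cast
  have h2 := jackson_comp_mul (q : ℂ) a
    (fun t => (Polynomial.X ^ e * r).eval t * (pval (vSer q) t)⁻¹) hq x
  rw [pow_mul, pow_succ, mul_inv, mul_assoc, ← h2]
  simp only [jackson, vecFactorFun, Polynomial.eval_mul, Polynomial.eval_pow, Polynomial.eval_X,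
    mul_pow]
  have h3 := pow_ne_zero e hq
  field_simp

theorem isContinuation_vecFactor (e m : Fin n → ℕ) (r : Fin n → Polynomial ℂ) (c : ℂ) :
    IsContinuation (c • prodSer fun j => vecFactor q (e j) (m j) (r j) : Vec n q)
      fun w => c * ∏ j, vecFactorFun q (e j) (m j) (r j) (w j) :=
  isContinuation_prodSer (fun j _ hw => analyticAt_vecFactorFun hq0 hq1 (e j) (m j) (r j) hw)
    (fun j => eventually_vecFactor hq0 hq1 (e j) (m j) (r j)) c

theorem vecIntegrable_vecFactor (e m : Fin n → ℕ) (r : Fin n → Polynomial ℂ) (c : ℂ) :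
    VecIntegrable (c • prodSer fun j => vecFactor q (e j) (m j) (r j) : Vec n q) :=
  ⟨⟨_, isContinuation_vecFactor hq0 hq1 e m r c⟩, fun a ha =>
    (hasSum_jacksonTerm (isContinuation_vecFactor hq0 hq1 e m r c) a fun j =>
      (hasSum_jackson_vecFactorFun hq0 hq1 (e j) (m j) (r j) (ha j)).summable).summable⟩

theorem rightIntegral_vecFactor (e m : Fin n → ℕ) (r : Fin n → Polynomial ℂ) (c : ℂ)
    (b z : Fin n → ℝ) (h : ∀ j, q ^ (Fin.rev j : ℕ) * b j * z j ≠ 0) :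
    rightIntegral b (c • prodSer fun j => vecFactor q (e j) (m j) (r j) : Vec n q) z =
      c * ∏ j, (((q : ℂ) ^ (m j * (e j + 1)))⁻¹ * vecFun hq0 hq1
        (mul_ne_zero (pow_ne_zero (m j) hq0.ne') (h j)) (Polynomial.X ^ e j * r j)) := by
  have h1 := fun j => hasSum_jackson_vecFactorFun hq0 hq1 (e j) (m j) (r j) (h j)
  rw [rightIntegral, (hasSum_jacksonTerm (isContinuation_vecFactor hq0 hq1 e m r c) _ fun j =>
    (h1 j).summable).tsum_eq]
  exact congr_arg (c * ·) (Finset.prod_congr rfl fun j _ => (h1 j).tsum_eq)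

end

/-- Every factor has a definite parity, so taking the even part either changes nothing or gives 0.
-/
theorem evenPart_vecFactor {β : Fin n → ℤˣ} {r : Fin n → Polynomial ℂ}
    (hr : ∀ j, HasParity (β j) (r j)) (e m : Fin n → ℕ) (c : ℂ) :
    ∃ c', evenPart (c • prodSer fun j => vecFactor q (e j) (m j) (r j) : Vec n q) =
      c' • prodSer (fun j => vecFactor q (e j) (m j) (r j)) ∧
      ((∀ j, (-1) ^ e j * β j = 1) → c' = c) ∧ ((∃ j, (-1) ^ e j * β j = -1) → c' = 0) := by
  by_cases h : ∀ j, (-1) ^ e j * β j = 1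
  · refine ⟨c, evenPart_smul_prodSer (fun j => evenCoeffs_of_parity ?_) c, fun _ => rfl, ?_⟩
    · rw [← h j]
      exact vecFactor_parity (hr j) q (e j) (m j)
    · rintro ⟨j, hj⟩
      rw [h j] at hj
      exact absurd hj (by decide)
  · refine ⟨0, ?_, fun h' => absurd h' h, fun _ => rfl⟩
    push Not at h
    obtain ⟨j, hj⟩ := h
    have hj := (Int.units_eq_one_or _).resolve_left hj
    rw [zero_smul]
    refine evenPart_smul_prodSer_eq_zero (j := j) ?_ c
    rw [← hj]
    exact vecFactor_parity (hr j) q (e j) (m j)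

theorem inS_vecSeries (hq0 : 0 < q) (hq1 : q < 1) {β : Fin n → ℤˣ} {r : Fin n → Polynomial ℂ}
    (hr : ∀ j, HasParity (β j) (r j)) (c : ℂ) : InS (c • vecSeries q r : Vec n q) := fun E => by
  obtain ⟨c', h, -, -⟩ := evenPart_vecFactor hr (fun j => E j) (fun j => lowSum E j) c (q := q)
  rw [mono_mul_vecSeries, h]
  exact vecIntegrable_vecFactor hq0 hq1 (fun j => E j) (fun j => lowSum E j) r c'

theorem smallGaussian_eq_vecFactor (hq0 : 0 < q) (hq1 : q < 1) :
    smallGaussian n q = (1 : ℂ) • prodSer fun _ => vecFactor q 0 0 1 := by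
  rw [smallGaussian_eq hq0 hq1, vecSeries_eq, one_smul]
  simp [vecFactor]

theorem expVec_eq (c : Fin n → ℂ) (E : Fin n →₀ ℕ) :
    expVec q c E = (monoVal c E / ∏ j, qFactorial ((q : ℂ) ^ 2) (E j)) • mono E := by
  funext F
  rw [smul_apply, expVec, expCoeff, mono]
  by_cases h : F = E
  · simp [h]
  · simp [h, Ne.symm h]

theorem parityBit_cast (s : ℤˣ) (e : ℕ) (h : (-1) ^ e * s = 1) : Even ((e : ℤ) - parityBit s) := by
  rcases Int.units_eq_one_or s with rfl | rfl
  · rw [mul_one] at h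
    have he : Even e := by
      by_contra he
      rw [(Nat.not_even_iff_odd.1 he).neg_one_pow] at h
      exact absurd h (by decide)
    simpa [parityBit] using he
  · have he : ¬ Even e := fun he => by
      rw [he.neg_one_pow] at h
      exact absurd h (by decide)
    have := Nat.not_even_iff_odd.1 he
    simp only [parityBit, if_neg (show (-1 : ℤˣ) ≠ 1 by decide)]
    rw [Nat.cast_one]
    exact (Int.odd_coe_nat e |>.2 this).sub_odd odd_one

/-- Under the hypothesis each exponent is congruent modulo 2 to its parity bit. Monomials that
contribute to the transform thus all need the same lattice, fixed by β. -/
theorem even_upSum_sub {β : Fin n → ℤˣ} {E : Fin n →₀ ℕ} (h : ∀ j, (-1) ^ E j * β j = 1)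
    (k : Fin n) : Even ((upSum E k : ℤ) - upperB β k) := by
  rw [upSum, upperB, Finset.sum_filter]
  push_cast
  rw [← Finset.sum_sub_distrib]
  refine Finset.even_sum _ fun j _ => ?_
  split_ifs
  · exact parityBit_cast _ _ (h j)
  · simp

theorem even_lowSum_sub {β : Fin n → ℤˣ} {E : Fin n →₀ ℕ} (h : ∀ j, (-1) ^ E j * β j = 1)
    (k : Fin n) : Even ((lowSum E k : ℤ) - lowerB β k) := by
  rw [lowSum, lowerB, Finset.sum_filter]
  push_cast
  rw [← Finset.sum_sub_distrib]
  refine Finset.even_sum _ fun j _ => ?_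
  split_ifs
  · exact parityBit_cast _ _ (h j)
  · simp

/-- The inverse transform of a vector series. -/
theorem inverseFourier_vecSeries (hq0 : 0 < q) (hq1 : q < 1) {β : Fin n → ℤˣ}
    {r : Fin n → Polynomial ℂ} (hr : ∀ j, HasParity (β j) (r j)) (c : ℂ) (z : Fin n → ℝ)
    (h : ∀ j, q ^ (Fin.rev j : ℕ) * q ^ lowerB β j * z j ≠ 0) :
    inverseFourier (c • vecSeries q r : Vec n q) z =
      (c * ∏ j, vecFun hq0 hq1 (h j) 1) • covSeries q fun j => polyC (q : ℂ) (r j) := by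
  have hq := cast_ne_zero hq0
  have hp2 := pow_pow_ne_one (cast_pow_ne_one hq0 hq1) (show 2 ≠ 0 by decide)
  have h' : ∀ j : Fin n, q ^ (Fin.rev j : ℕ) * 1 * z j ≠ 0 := fun j => by
    rw [mul_one]
    exact mul_ne_zero (left_ne_zero_of_mul (left_ne_zero_of_mul (h j))) (right_ne_zero_of_mul (h j))
  funext E
  have hmom : ∀ j, vecFun hq0 hq1 (h j) 1 *
      PowerSeries.coeff (E j) (uSer q * (polyC (q : ℂ) (r j) : PowerSeries ℂ)) =
      (-Complex.I * (q : ℂ) ^ 2) ^ E j * (q : ℂ) ^ (E j * (E j - 1)) /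
        qPoch ((q : ℂ) ^ 2) ((q : ℂ) ^ 2) (E j) *
        vecFun hq0 hq1 (h j) (Polynomial.X ^ E j * r j) := fun j => by
    have h2 := congr_arg (PowerSeries.coeff (E j)) (momentC_vecFun hq0 hq1 (h j) (r j))
    rw [PowerSeries.coeff_C_mul] at h2
    rw [← h2, momentC, PowerSeries.coeff_mk]
  have hR : ((c * ∏ j, vecFun hq0 hq1 (h j) 1) •
      covSeries q fun j => polyC (q : ℂ) (r j) : Cov n q) E =
      c * ((q : ℂ) ^ pairSum E * ∏ j, ((-Complex.I * (q : ℂ) ^ 2) ^ E j *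
        (q : ℂ) ^ (E j * (E j - 1)) / qPoch ((q : ℂ) ^ 2) ((q : ℂ) ^ 2) (E j) *
        vecFun hq0 hq1 (h j) (Polynomial.X ^ E j * r j))) := by
    rw [smul_apply, covSeries_eq, prodSer, cross_cov, ← Finset.prod_congr rfl fun j _ => hmom j,
      Finset.prod_mul_distrib]
    ring
  have hL : inverseFourier (c • vecSeries q r : Vec n q) z E =
      (-1) ^ deg E * (q : ℂ) ^ (deg E * (deg E - 1)) * evenRightIntegral (expVec q
        (fun j => Complex.I * (q : ℂ) ^ 2 / (1 - (q : ℂ) ^ 2) * (q : ℂ) ^ (Fin.rev j : ℕ)) E *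
          (c • vecSeries q r)) z := rfl
  rw [hR, hL, expVec_eq, smul_mul_assoc, ← mul_smul_comm, smul_smul,
    mono_mul_vecSeries, evenRightIntegral]
  set d := monoVal (fun j : Fin n => Complex.I * (q : ℂ) ^ 2 / (1 - (q : ℂ) ^ 2) *
    (q : ℂ) ^ (Fin.rev j : ℕ)) E / ∏ j, qFactorial ((q : ℂ) ^ 2) (E j) with hd
  obtain ⟨c', hc', h1, h2⟩ :=
    evenPart_vecFactor hr (fun j => E j) (fun j => lowSum E j) (d * c) (q := q)
  rw [hc', rightIntegral_vecFactor hq0 hq1 (fun j => E j) (fun j => lowSum E j) r c' _ z h']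
  by_cases hE : ∀ j, (-1) ^ E j * β j = 1
  -- The dilation exponent is congruent to `lowerB β j` modulo 2, so both generators describe the
  -- same q²-lattice: the one in Λ.
  · have hvec : ∀ j, vecFun hq0 hq1 (mul_ne_zero (pow_ne_zero (lowSum E j) hq0.ne') (h' j)) =
        vecFun hq0 hq1 (h j) := fun j => by
      obtain ⟨k, hk⟩ := even_lowSum_sub hE j
      refine vecFun_shift hq0 hq1 (k := k) _ _ ?_
      have h3 : q ^ lowSum E j = q ^ (2 * k) * q ^ lowerB β j := by
        rw [← zpow_natCast, ← zpow_natCast, ← zpow_add₀ hq0.ne']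
        congr 1
        linarith
      rw [h3]; ring
    have hterm : ∀ j, (Complex.I * (q : ℂ) ^ 2 / (1 - (q : ℂ) ^ 2) * (q : ℂ) ^ (Fin.rev j : ℕ)) ^ E j /
        qFactorial ((q : ℂ) ^ 2) (E j) * ((-1) ^ E j * (q : ℂ) ^ (E j * (E j - 1)) *
        (((q : ℂ) ^ (lowSum E j * (E j + 1)))⁻¹ *
          vecFun hq0 hq1 (h j) (Polynomial.X ^ E j * r j))) =
        (q : ℂ) ^ ((Fin.rev j : ℕ) * E j) * ((q : ℂ) ^ lowSum E j)⁻¹ *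
          ((q : ℂ) ^ (lowSum E j * E j))⁻¹ *
        ((-Complex.I * (q : ℂ) ^ 2) ^ E j *
        (q : ℂ) ^ (E j * (E j - 1)) / qPoch ((q : ℂ) ^ 2) ((q : ℂ) ^ 2) (E j) *
        vecFun hq0 hq1 (h j) (Polynomial.X ^ E j * r j)) := fun j => by
      rw [qPoch_eq_qFactorial hp2, mul_pow, div_pow, ← pow_mul (q : ℂ) (Fin.rev j : ℕ),
        mul_add (lowSum E j), mul_one, pow_add (q : ℂ) (lowSum E j * E j), neg_mul,
        neg_pow (Complex.I * (q : ℂ) ^ 2)]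
      have h4 : (1 - (q : ℂ) ^ 2) ^ E j ≠ 0 :=
        pow_ne_zero _ (sub_ne_zero.2 (cast_pow_ne_one hq0 hq1 2 two_ne_zero).symm)
      have h5 : qFactorial ((q : ℂ) ^ 2) (E j) ≠ 0 := by
        have := qPoch_self_ne_zero hp2 (E j)
        rw [qPoch_eq_qFactorial hp2] at this
        exact right_ne_zero_of_mul this
      have h6 := pow_ne_zero (lowSum E j) hq
      have h7 := pow_ne_zero (lowSum E j * E j) hq
      generalize vecFun hq0 hq1 (h j) (Polynomial.X ^ E j * r j) = V
      field_simp
    -- In the product over j, the powers q^{n-j} cancel the Jacobians, and `lowSum` against E leaves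
    -- q to the power -`pairSum E`. The antipode contributes twice `pairSum E`; the surplus is the
    -- reordering factor of the covector series.
    have hprod := Finset.prod_congr (rfl : (Finset.univ : Finset (Fin n)) = Finset.univ)
      fun j _ => hterm j
    simp only [Finset.prod_mul_distrib, Finset.prod_div_distrib, Finset.prod_pow_eq_pow_sum,
      Finset.prod_inv_distrib, sum_lowSum, sum_lowSum_mul_self] at hprod
    rw [h1 hE, deg_mul_pred]
    simp only [hvec, hd, monoVal, Finset.prod_mul_distrib, Finset.prod_div_distrib,
      Finset.prod_pow_eq_pow_sum, Finset.prod_inv_distrib]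
    rw [← deg] at hprod ⊢
    have h8 := pow_ne_zero (pairSum E) hq
    have h9 := pow_ne_zero (∑ j : Fin n, (Fin.rev j : ℕ) * E j) hq
    rw [mul_inv_cancel₀ h9, one_mul] at hprod
    rw [pow_add, two_mul, pow_add]
    rw [eq_inv_mul_iff_mul_eq₀ h8] at hprod
    linear_combination (c * (q : ℂ) ^ pairSum E) * hprod
  · push Not at hE
    obtain ⟨j, hj⟩ := hE
    have hj := (Int.units_eq_one_or _).resolve_left hj
    rw [h2 ⟨j, hj⟩, zero_mul, mul_zero, Finset.prod_eq_zero (Finset.mem_univ j), mul_zero, mul_zero]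
    rw [vecFun_odd hq0 hq1 (h j) (hj ▸ (hr j).X_pow_mul (E j)), mul_zero]

end VectorSeries

/-! ### The constant and the lattice -/

section Lattice

variable {n : ℕ} {q : ℝ} {σ : Equiv.Perm (Fin n)} {β : Fin n → ℤˣ} {γ γ' : Fin n → ℝ}

/-- The inversion count and position cancel exactly, and `upperB` cancels `upSum F` modulo 2. -/
theorem lattice_of_parity
    (hγ : ∀ k : Fin n, γ (σ k) = q ^ (upperB β (σ k) + (k : ℕ) +
      (Finset.univ.filter fun j : Fin n => j < k ∧ σ k < σ j).card))
    (F : Fin n →₀ ℕ) (h : ∀ j, (-1) ^ F j * β j = 1) (k : Fin n) :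
    ∃ c : ℤ, γ (σ k) = q ^ c ∧ Even (c - upSum F (σ k) - (k : ℕ) -
      ((Finset.univ.filter fun j : Fin n => j < k ∧ σ k < σ j).card : ℕ)) := by
  refine ⟨_, (hγ k).trans (zpow_natCast _ _).symm, ?_⟩
  obtain ⟨m, hm⟩ := even_upSum_sub h (σ k)
  refine ⟨-m, ?_⟩
  push_cast
  linarith

/-- The Gaussian is the all-even case with trivial monomial, where nothing offsets `upperB`. The
additional factor in γ' doubles it and restores evenness, so the value is the same constant as in
the transform. -/
theorem hasIteratedIntegral_bigGaussian (hq0 : 0 < q) (hq1 : q < 1)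
    (hγ : ∀ k : Fin n, γ (σ k) = q ^ (upperB β (σ k) + (k : ℕ) +
      (Finset.univ.filter fun j : Fin n => j < k ∧ σ k < σ j).card))
    (hγ' : ∀ k : Fin n, γ' k = γ k * q ^ upperB β k) :
    LOIntegrable σ γ' (bigGaussian n q) ∧ loIntegral σ γ' (bigGaussian n q) =
      (q : ℂ) ^ shiftExp (List.ofFn σ) 0 * covFun hq0 hq1 1 ^ n := by
  have hG : bigGaussian n q = (1 : ℂ) • covSeries q (fun _ => 1) * mono 0 := by
    rw [bigGaussian_eq hq0 hq1, one_smul]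
    exact (mul_one _).symm
  have hs : ∀ j : Fin n, HasParity ((fun _ => 1 : Fin n → ℤˣ) j)
      (Polynomial.X ^ (0 : Fin n →₀ ℕ) j * (fun _ => 1 : Fin n → Polynomial ℂ) j) := fun j => by
    simpa using hasParity_one
  have hl : ∀ k, ∃ c : ℤ, γ' (σ k) = q ^ c ∧ Even (c - upSum (0 : Fin n →₀ ℕ) (σ k) - (k : ℕ) -
      ((Finset.univ.filter fun j : Fin n => j < k ∧ σ k < σ j).card : ℕ)) := fun k => by
    refine ⟨(upperB β (σ k) + (k : ℕ) + (Finset.univ.filter fun j : Fin n =>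
      j < k ∧ σ k < σ j).card + upperB β (σ k) : ℕ), ?_, upperB β (σ k), ?_⟩
    · rw [hγ', hγ, zpow_natCast, ← pow_add]
    · simp only [upSum, Finsupp.coe_zero, Pi.zero_apply, ite_self, Finset.sum_const_zero]
      push_cast
      ring
  have hI := hasIteratedIntegral_covSeries_mul_mono hq0 hq1 hs (fun _ => hl) 1
  rw [hG]
  refine ⟨loIntegrable_covSeries_mul_mono hq0 hq1 hs (fun _ => hl) 1, ?_⟩
  rw [loIntegral_eq hI]
  simp

theorem inR_smul_covSeries (hq0 : 0 < q) (hq1 : q < 1)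
    (hγ : ∀ k : Fin n, γ (σ k) = q ^ (upperB β (σ k) + (k : ℕ) +
      (Finset.univ.filter fun j : Fin n => j < k ∧ σ k < σ j).card))
    {p : Fin n → Polynomial ℂ} (hp : ∀ j, HasParity (β j) (p j)) (c : ℂ) :
    InR σ γ (c • covSeries q p) := fun F =>
  loIntegrable_covSeries_mul_mono hq0 hq1 (fun j => (hp j).X_pow_mul (F j))
    (lattice_of_parity hγ F) c

theorem vecIntegrable_smallGaussian (hq0 : 0 < q) (hq1 : q < 1) :
    VecIntegrable (smallGaussian n q) := by
  rw [smallGaussian_eq_vecFactor hq0 hq1]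
  exact vecIntegrable_vecFactor hq0 hq1 (fun _ => 0) (fun _ => 0) (fun _ => 1) 1

theorem rightIntegral_smallGaussian (hq0 : 0 < q) (hq1 : q < 1) (b z : Fin n → ℝ)
    (h : ∀ j, q ^ (Fin.rev j : ℕ) * b j * z j ≠ 0) :
    rightIntegral b (smallGaussian n q) z = ∏ j, vecFun hq0 hq1 (h j) 1 := by
  rw [smallGaussian_eq_vecFactor hq0 hq1,
    rightIntegral_vecFactor hq0 hq1 (fun _ => 0) (fun _ => 0) (fun _ => 1) 1 b z h, one_mul]
  refine Finset.prod_congr rfl fun j _ => ?_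
  rw [vecFun_shift hq0 hq1 (h j) _ (k := 0) (by simp)]
  simp

end Lattice

end QSpace

end

/-! ### The two inversion formulas -/

theorem mainTheorem2 (n : ℕ) (q : ℝ) (hq0 : 0 < q) (hq1 : q < 1)
    (σ : Equiv.Perm (Fin n)) (β : Fin n → ℤˣ) (γ γ' : Fin n → ℝ)
    (hγ : ∀ k : Fin n, γ (σ k) =
      q ^ (QSpace.upperB β (σ k) + (k : ℕ) +
        (Finset.univ.filter fun j : Fin n => j < k ∧ σ k < σ j).card))
    (hγ' : ∀ k : Fin n, γ' k = γ k * q ^ QSpace.upperB β k) :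
    QSpace.LOIntegrable σ γ' (QSpace.bigGaussian n q) ∧
    QSpace.VecIntegrable (QSpace.smallGaussian n q) ∧
    (∀ p : Fin n → Polynomial ℂ, (∀ j, QSpace.HasParity (β j) (p j)) →
      QSpace.InR σ γ (QSpace.covSeries q p) ∧
      QSpace.InS (QSpace.weakFourier σ γ (QSpace.covSeries q p)) ∧
      ∀ z : Fin n → ℝ, (∀ j, z j ≠ 0) →
        QSpace.inverseFourier (QSpace.weakFourier σ γ (QSpace.covSeries q p)) z =
          (QSpace.loIntegral σ γ' (QSpace.bigGaussian n q) *
            QSpace.rightIntegral (fun j => q ^ QSpace.lowerB β j) (QSpace.smallGaussian n q) z) •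
          QSpace.covSeries q p) ∧
    (∀ r : Fin n → Polynomial ℂ, (∀ j, QSpace.HasParity (β j) (r j)) →
      QSpace.InS (QSpace.vecSeries q r) ∧
      ∀ z : Fin n → ℝ, (∀ j, z j ≠ 0) →
        QSpace.InR σ γ (QSpace.inverseFourier (QSpace.vecSeries q r) z) ∧
        QSpace.weakFourier σ γ (QSpace.inverseFourier (QSpace.vecSeries q r) z) =
          (QSpace.loIntegral σ γ' (QSpace.bigGaussian n q) *
            QSpace.rightIntegral (fun j => q ^ QSpace.lowerB β j) (QSpace.smallGaussian n q) z) •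
          QSpace.vecSeries q r) := by
  have hq := QSpace.cast_ne_zero hq0
  have hnz : ∀ z : Fin n → ℝ, (∀ j, z j ≠ 0) →
      ∀ j : Fin n, q ^ (Fin.rev j : ℕ) * q ^ QSpace.lowerB β j * z j ≠ 0 := fun z hz j =>
    mul_ne_zero (mul_ne_zero (pow_ne_zero _ hq0.ne') (pow_ne_zero _ hq0.ne')) (hz j)
  obtain ⟨hG, hI⟩ := QSpace.hasIteratedIntegral_bigGaussian hq0 hq1 hγ hγ'
  -- Kept for arbitrary scalar multiples, since the inverse transform returns a multiple of a
  -- covector series; linearity of the lattice order integral is then not needed.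
  have hF := fun {p : Fin n → Polynomial ℂ} (hp : ∀ j, QSpace.HasParity (β j) (p j)) c =>
    QSpace.weakFourier_covSeries hq0 hq1 hp (QSpace.lattice_of_parity hγ) c
  refine ⟨hG, QSpace.vecIntegrable_smallGaussian hq0 hq1, fun p hp => ?_, fun r hr => ?_⟩
  · have h1 := hF hp 1
    have h2 := QSpace.inR_smul_covSeries hq0 hq1 hγ hp 1
    have hv := fun j => (hp j).polyV (q := (q : ℂ))
    rw [one_smul] at h1 h2
    rw [h1]
    refine ⟨h2, QSpace.inS_vecSeries hq0 hq1 hv _, fun z hz => ?_⟩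
    rw [QSpace.inverseFourier_vecSeries hq0 hq1 hv _ z (hnz z hz), hI,
      QSpace.rightIntegral_smallGaussian hq0 hq1 _ z (hnz z hz), one_mul]
    simp only [QSpace.polyC_polyV hq]
  · have h1 := QSpace.inS_vecSeries hq0 hq1 hr 1
    have hv := fun j => (hr j).polyC (q := (q : ℂ))
    rw [one_smul] at h1
    refine ⟨h1, fun z hz => ?_⟩
    have h2 := QSpace.inverseFourier_vecSeries hq0 hq1 hr 1 z (hnz z hz)
    rw [one_smul, one_mul] at h2
    rw [h2]
    refine ⟨QSpace.inR_smul_covSeries hq0 hq1 hγ hv _, ?_⟩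
    rw [hF hv, hI, QSpace.rightIntegral_smallGaussian hq0 hq1 _ z (hnz z hz), mul_comm]
    simp only [QSpace.polyV_polyC hq]
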